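/- \textbf{Corollary (Classic KLST).} Work in \emph{synthetic computability}, i.e. in intuitionistic higher-order logic (truth values, natural numbers with induction and primitive recursion, products, function sets, extensionality, and the principle that every functional relation is the graph of a function) over arbitrary sets, extended by the following four postulates. A truth value is \emph{semidecidable} if it is equivalent to $\exists n\in\mathbb N.\, f(n)=1$ for some $f\in\{0,1\}^{\mathbb N}$; a subset of a set is semidecidable if membership in it is semidecidable for each element of the set. \begin{itemize} \item \emph{Dependent Choice}: if $S$ is a set and $R$ a relation on $S$ with $\forall x\in S\,\exists y\in S.\,R(x,y)$, then for every $a\in S$ there is a sequence $s:\mathbb N\to S$ with $s(0)=a$ and $R(s(n),s(n+1))$ for all $n$. \item \emph{Markov principle}: if not all terms of a binary sequence are $0$, then the sequence contains a $1$. \item \emph{Enumerability Axiom}: there is a sequence $(W_n)_{n\in\mathbb N}$ enumerating all semidecidable (equivalently, all countable) subsets of $\mathbb N$. \item \emph{Stable Subspace Axiom}: if $X\subseteq\mathbb N$ satisfies $\neg\neg(n\in X)\Rightarrow n\in X$ for all $n\in\mathbb N$, then every semidecidable subset of $X$ is of the form $V\cap X$ for a semidecidable $V\subseteq\mathbb N$.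 \end{itemize} Metrics take values in the Dedekind reals (rounded, disjoint, located, inhabited two-sided cuts of rationals). A metric space is \emph{separable} if it has a dense sequence, and \emph{complete} if every Cauchy sequence converges. A subset $U$ of a metric space is \emph{pointwise open} if every point of $U$ lies in some open ball contained in $U$, and a map is \emph{pointwise continuous} if inverse images of pointwise open sets are pointwise open. Then the following is a theorem (it is formally derivable from these postulates in intuitionistic higher-order logic): for all metric spaces $M$ and $N$, if $M$ is complete and separable, then every map $f:M\to N$ is pointwise continuous. -/

import Mathlib

/-! Intuitionistic higher-order logic with a type of natural numbers, presented as an intrinsically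
typed simple type theory (de Bruijn variables) with a natural-deduction calculus; on top of it, the
postulates of synthetic computability and the vocabulary of metric spaces, all written as formulas
of that logic. -/

namespace SynthComp

/-! ### Types, terms, substitution -/

/-- Types: truth values, natural numbers, uninterpreted sorts standing for arbitrary sets,
binary products, function sets. -/
inductive Ty : Type
  | prop : Ty
  | nat : Ty
  | sort (i : ℕ) : Ty
  | prod (A B : Ty) : Ty
  | arr (A B : Ty) : Ty

infixr:60 " ⇒ₜ " => Ty.arr
infixr:65 " ×ₜ " => Ty.prod

/-- Contexts list the types of the free variables; nothing is assumed about inhabitedness. -/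
abbrev Ctx := List Ty

/-- Variables (typed de Bruijn indices). -/
inductive Var : Ctx → Ty → Type
  | here {Γ : Ctx} {A : Ty} : Var (A :: Γ) A
  | there {Γ : Ctx} {A B : Ty} (x : Var Γ A) : Var (B :: Γ) A

/-- Terms in context.  Terms of type `prop` are the formulas. -/
inductive Tm : Ctx → Ty → Type
  | var {Γ : Ctx} {A : Ty} (x : Var Γ A) : Tm Γ A
  | lam {Γ : Ctx} {A B : Ty} (t : Tm (A :: Γ) B) : Tm Γ (A ⇒ₜ B)
  | app {Γ : Ctx} {A B : Ty} (f : Tm Γ (A ⇒ₜ B)) (t : Tm Γ A) : Tm Γ B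
  | pair {Γ : Ctx} {A B : Ty} (s : Tm Γ A) (t : Tm Γ B) : Tm Γ (A ×ₜ B)
  | fst {Γ : Ctx} {A B : Ty} (t : Tm Γ (A ×ₜ B)) : Tm Γ A
  | snd {Γ : Ctx} {A B : Ty} (t : Tm Γ (A ×ₜ B)) : Tm Γ B
  | zero {Γ : Ctx} : Tm Γ Ty.nat
  | succ {Γ : Ctx} (n : Tm Γ Ty.nat) : Tm Γ Ty.nat
  | natrec {Γ : Ctx} {A : Ty} (z : Tm Γ A) (s : Tm Γ (Ty.nat ⇒ₜ A ⇒ₜ A)) (n : Tm Γ Ty.nat) : Tm Γ A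
  | eq {Γ : Ctx} {A : Ty} (s t : Tm Γ A) : Tm Γ Ty.prop
  | bot {Γ : Ctx} : Tm Γ Ty.prop
  | and {Γ : Ctx} (φ ψ : Tm Γ Ty.prop) : Tm Γ Ty.prop
  | or {Γ : Ctx} (φ ψ : Tm Γ Ty.prop) : Tm Γ Ty.prop
  | imp {Γ : Ctx} (φ ψ : Tm Γ Ty.prop) : Tm Γ Ty.prop
  | all {Γ : Ctx} {A : Ty} (φ : Tm (A :: Γ) Ty.prop) : Tm Γ Ty.prop
  | ex {Γ : Ctx} {A : Ty} (φ : Tm (A :: Γ) Ty.prop) : Tm Γ Ty.prop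

/-- Formulas in context. -/
abbrev Fm (Γ : Ctx) := Tm Γ Ty.prop

/-- Renamings of variables. -/
abbrev Ren (Γ Δ : Ctx) := ∀ {A : Ty}, Var Γ A → Var Δ A

/-- Lifting of a renaming under a binder. -/
def Ren.lift {Γ Δ : Ctx} (ρ : Ren Γ Δ) {B : Ty} : Ren (B :: Γ) (B :: Δ)
  | _, .here => .here
  | _, .there x => .there (ρ x)

/-- Renaming of terms. -/
def Tm.ren : {Γ Δ : Ctx} → {A : Ty} → Ren Γ Δ → Tm Γ A → Tm Δ A
  | _, _, _, ρ, .var x => .var (ρ x)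
  | _, _, _, ρ, .lam t => .lam (t.ren (Ren.lift ρ))
  | _, _, _, ρ, .app f t => .app (f.ren ρ) (t.ren ρ)
  | _, _, _, ρ, .pair s t => .pair (s.ren ρ) (t.ren ρ)
  | _, _, _, ρ, .fst t => .fst (t.ren ρ)
  | _, _, _, ρ, .snd t => .snd (t.ren ρ)
  | _, _, _, _, .zero => .zero
  | _, _, _, ρ, .succ n => .succ (n.ren ρ)
  | _, _, _, ρ, .natrec z s n => .natrec (z.ren ρ) (s.ren ρ) (n.ren ρ)
  | _, _, _, ρ, .eq s t => .eq (s.ren ρ) (t.ren ρ)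
  | _, _, _, _, .bot => .bot
  | _, _, _, ρ, .and φ ψ => .and (φ.ren ρ) (ψ.ren ρ)
  | _, _, _, ρ, .or φ ψ => .or (φ.ren ρ) (ψ.ren ρ)
  | _, _, _, ρ, .imp φ ψ => .imp (φ.ren ρ) (ψ.ren ρ)
  | _, _, _, ρ, .all φ => .all (φ.ren (Ren.lift ρ))
  | _, _, _, ρ, .ex φ => .ex (φ.ren (Ren.lift ρ))

/-- Weakening by one fresh variable. -/
def Tm.wk {Γ : Ctx} {A B : Ty} (t : Tm Γ A) : Tm (B :: Γ) A := t.ren (fun x => .there x)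

postfix:max "↟" => Tm.wk

/-- Simultaneous substitutions. -/
abbrev Sub (Γ Δ : Ctx) := ∀ {A : Ty}, Var Γ A → Tm Δ A

/-- Lifting of a substitution under a binder. -/
def Sub.lift {Γ Δ : Ctx} (σ : Sub Γ Δ) {B : Ty} : Sub (B :: Γ) (B :: Δ)
  | _, .here => .var .here
  | _, .there x => (σ x)↟

/-- Capture-free simultaneous substitution. -/
def Tm.sub : {Γ Δ : Ctx} → {A : Ty} → Sub Γ Δ → Tm Γ A → Tm Δ A
  | _, _, _, σ, .var x => σ x
  | _, _, _, σ, .lam t => .lam (t.sub (Sub.lift σ))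
  | _, _, _, σ, .app f t => .app (f.sub σ) (t.sub σ)
  | _, _, _, σ, .pair s t => .pair (s.sub σ) (t.sub σ)
  | _, _, _, σ, .fst t => .fst (t.sub σ)
  | _, _, _, σ, .snd t => .snd (t.sub σ)
  | _, _, _, _, .zero => .zero
  | _, _, _, σ, .succ n => .succ (n.sub σ)
  | _, _, _, σ, .natrec z s n => .natrec (z.sub σ) (s.sub σ) (n.sub σ)
  | _, _, _, σ, .eq s t => .eq (s.sub σ) (t.sub σ)
  | _, _, _, _, .bot => .bot
  | _, _, _, σ, .and φ ψ => .and (φ.sub σ) (ψ.sub σ)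
  | _, _, _, σ, .or φ ψ => .or (φ.sub σ) (ψ.sub σ)
  | _, _, _, σ, .imp φ ψ => .imp (φ.sub σ) (ψ.sub σ)
  | _, _, _, σ, .all φ => .all (φ.sub (Sub.lift σ))
  | _, _, _, σ, .ex φ => .ex (φ.sub (Sub.lift σ))

/-- The substitution that replaces the last variable by `s` and fixes the others. -/
def Sub.single {Γ : Ctx} {B : Ty} (s : Tm Γ B) : Sub (B :: Γ) Γ
  | _, .here => s
  | _, .there x => .var x

/-- `t.inst s` is `t` with its last variable replaced by `s`. -/
def Tm.inst {Γ : Ctx} {A B : Ty} (t : Tm (B :: Γ) A) (s : Tm Γ B) : Tm Γ A :=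
  t.sub (Sub.single s)

/-- The unique renaming from the empty context. -/
def Ren.empty {Γ : Ctx} : Ren [] Γ := fun {_} x => nomatch x

/-- A closed term, regarded as a term in an arbitrary context. -/
def Tm.closed {Γ : Ctx} {A : Ty} (t : Tm [] A) : Tm Γ A := t.ren Ren.empty

/-! ### Notation for formulas -/

infix:50 " =ₒ " => Tm.eq
infixr:35 " ∧ₒ " => Tm.and
infixr:30 " ∨ₒ " => Tm.or
infixr:25 " →ₒ " => Tm.imp
infixl:90 " ⬝ " => Tm.app

/-- `λ x : A, t x`; the bound variable is passed to the Lean function as a term. -/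
abbrev lam_ {Γ : Ctx} (A : Ty) {B : Ty} (t : Tm (A :: Γ) A → Tm (A :: Γ) B) : Tm Γ (A ⇒ₜ B) :=
  .lam (t (.var .here))

/-- `∀ x : A, φ x`. -/
abbrev all_ {Γ : Ctx} (A : Ty) (φ : Tm (A :: Γ) A → Fm (A :: Γ)) : Fm Γ := .all (φ (.var .here))

/-- `∃ x : A, φ x`. -/
abbrev ex_ {Γ : Ctx} (A : Ty) (φ : Tm (A :: Γ) A → Fm (A :: Γ)) : Fm Γ := .ex (φ (.var .here))

/-- Negation. -/
abbrev not_ {Γ : Ctx} (φ : Fm Γ) : Fm Γ := φ →ₒ .bot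

/-- Equivalence. -/
abbrev iff_ {Γ : Ctx} (φ ψ : Fm Γ) : Fm Γ := (φ →ₒ ψ) ∧ₒ (ψ →ₒ φ)

/-! ### Derivability -/

/-- `Derivable T Φ φ`: the formula `φ` in context `Γ` is derivable, in intuitionistic higher-order
logic with natural numbers, from the hypotheses `Φ` and the closed postulates `T`.  The rules are
those of intuitionistic natural deduction, equality, `β` and extensionality for functions, pairs
and truth values, Peano arithmetic with primitive recursion in all types, and the principle that
a functional relation is the graph of a function. -/
inductive Derivable (T : Set (Fm [])) : {Γ : Ctx} → List (Fm Γ) → Fm Γ → Prop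
  | hyp {Γ : Ctx} {Φ : List (Fm Γ)} {φ : Fm Γ} : φ ∈ Φ → Derivable T Φ φ
  | postulate {Γ : Ctx} {Φ : List (Fm Γ)} {φ : Fm []} : φ ∈ T → Derivable T Φ φ.closed
  -- connectives
  | botE {Γ : Ctx} {Φ : List (Fm Γ)} {φ : Fm Γ} : Derivable T Φ .bot → Derivable T Φ φ
  | andI {Γ : Ctx} {Φ : List (Fm Γ)} {φ ψ : Fm Γ} :
      Derivable T Φ φ → Derivable T Φ ψ → Derivable T Φ (φ ∧ₒ ψ)
  | andE₁ {Γ : Ctx} {Φ : List (Fm Γ)} {φ ψ : Fm Γ} : Derivable T Φ (φ ∧ₒ ψ) → Derivable T Φ φ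
  | andE₂ {Γ : Ctx} {Φ : List (Fm Γ)} {φ ψ : Fm Γ} : Derivable T Φ (φ ∧ₒ ψ) → Derivable T Φ ψ
  | orI₁ {Γ : Ctx} {Φ : List (Fm Γ)} {φ ψ : Fm Γ} : Derivable T Φ φ → Derivable T Φ (φ ∨ₒ ψ)
  | orI₂ {Γ : Ctx} {Φ : List (Fm Γ)} {φ ψ : Fm Γ} : Derivable T Φ ψ → Derivable T Φ (φ ∨ₒ ψ)
  | orE {Γ : Ctx} {Φ : List (Fm Γ)} {φ ψ χ : Fm Γ} : Derivable T Φ (φ ∨ₒ ψ) →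
      Derivable T (φ :: Φ) χ → Derivable T (ψ :: Φ) χ → Derivable T Φ χ
  | impI {Γ : Ctx} {Φ : List (Fm Γ)} {φ ψ : Fm Γ} :
      Derivable T (φ :: Φ) ψ → Derivable T Φ (φ →ₒ ψ)
  | impE {Γ : Ctx} {Φ : List (Fm Γ)} {φ ψ : Fm Γ} :
      Derivable T Φ (φ →ₒ ψ) → Derivable T Φ φ → Derivable T Φ ψ
  -- quantifiers
  | allI {Γ : Ctx} {Φ : List (Fm Γ)} {A : Ty} {φ : Fm (A :: Γ)} :
      Derivable T (Φ.map Tm.wk) φ → Derivable T Φ (.all φ)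
  | allE {Γ : Ctx} {Φ : List (Fm Γ)} {A : Ty} {φ : Fm (A :: Γ)} (t : Tm Γ A) :
      Derivable T Φ (.all φ) → Derivable T Φ (φ.inst t)
  | exI {Γ : Ctx} {Φ : List (Fm Γ)} {A : Ty} {φ : Fm (A :: Γ)} (t : Tm Γ A) :
      Derivable T Φ (φ.inst t) → Derivable T Φ (.ex φ)
  | exE {Γ : Ctx} {Φ : List (Fm Γ)} {A : Ty} {φ : Fm (A :: Γ)} {χ : Fm Γ} :
      Derivable T Φ (.ex φ) → Derivable T (φ :: Φ.map Tm.wk) χ↟ → Derivable T Φ χ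
  -- equality
  | eqI {Γ : Ctx} {Φ : List (Fm Γ)} {A : Ty} (t : Tm Γ A) : Derivable T Φ (t =ₒ t)
  | eqE {Γ : Ctx} {Φ : List (Fm Γ)} {A : Ty} {s t : Tm Γ A} (φ : Fm (A :: Γ)) :
      Derivable T Φ (s =ₒ t) → Derivable T Φ (φ.inst s) → Derivable T Φ (φ.inst t)
  -- functions, pairs, truth values
  | beta {Γ : Ctx} {Φ : List (Fm Γ)} {A B : Ty} (t : Tm (A :: Γ) B) (s : Tm Γ A) :
      Derivable T Φ (.lam t ⬝ s =ₒ t.inst s)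
  | funext {Γ : Ctx} {Φ : List (Fm Γ)} {A B : Ty} {f g : Tm Γ (A ⇒ₜ B)} :
      Derivable T Φ (all_ A fun x => f↟ ⬝ x =ₒ g↟ ⬝ x) → Derivable T Φ (f =ₒ g)
  | fstPair {Γ : Ctx} {Φ : List (Fm Γ)} {A B : Ty} (s : Tm Γ A) (t : Tm Γ B) :
      Derivable T Φ (.fst (.pair s t) =ₒ s)
  | sndPair {Γ : Ctx} {Φ : List (Fm Γ)} {A B : Ty} (s : Tm Γ A) (t : Tm Γ B) :
      Derivable T Φ (.snd (.pair s t) =ₒ t)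
  | pairEta {Γ : Ctx} {Φ : List (Fm Γ)} {A B : Ty} (t : Tm Γ (A ×ₜ B)) :
      Derivable T Φ (.pair (.fst t) (.snd t) =ₒ t)
  | propext {Γ : Ctx} {Φ : List (Fm Γ)} {φ ψ : Fm Γ} :
      Derivable T Φ (iff_ φ ψ) → Derivable T Φ (φ =ₒ ψ)
  -- natural numbers
  | succNeZero {Γ : Ctx} {Φ : List (Fm Γ)} (n : Tm Γ Ty.nat) :
      Derivable T Φ (not_ (.succ n =ₒ .zero))
  | succInj {Γ : Ctx} {Φ : List (Fm Γ)} {m n : Tm Γ Ty.nat} :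
      Derivable T Φ (.succ m =ₒ .succ n) → Derivable T Φ (m =ₒ n)
  | induction {Γ : Ctx} {Φ : List (Fm Γ)} {P : Tm Γ (Ty.nat ⇒ₜ Ty.prop)} :
      Derivable T Φ (P ⬝ .zero) → Derivable T Φ (all_ Ty.nat fun n => P↟ ⬝ n →ₒ P↟ ⬝ .succ n) →
      Derivable T Φ (all_ Ty.nat fun n => P↟ ⬝ n)
  | natrecZero {Γ : Ctx} {Φ : List (Fm Γ)} {A : Ty} (z : Tm Γ A) (s : Tm Γ (Ty.nat ⇒ₜ A ⇒ₜ A)) :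
      Derivable T Φ (.natrec z s .zero =ₒ z)
  | natrecSucc {Γ : Ctx} {Φ : List (Fm Γ)} {A : Ty} (z : Tm Γ A) (s : Tm Γ (Ty.nat ⇒ₜ A ⇒ₜ A))
      (n : Tm Γ Ty.nat) : Derivable T Φ (.natrec z s (.succ n) =ₒ s ⬝ n ⬝ .natrec z s n)
  -- a functional relation is the graph of a function
  | uniqueChoice {Γ : Ctx} {Φ : List (Fm Γ)} {A B : Ty} {R : Tm Γ (A ⇒ₜ B ⇒ₜ Ty.prop)} :
      Derivable T Φ (all_ A fun x => ex_ B fun y =>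
        R↟↟ ⬝ x↟ ⬝ y ∧ₒ all_ B fun z => R↟↟↟ ⬝ x↟↟ ⬝ z →ₒ z =ₒ y↟) →
      Derivable T Φ (ex_ (A ⇒ₜ B) fun f => all_ A fun x => R↟↟ ⬝ x ⬝ (f↟ ⬝ x))

/-! ### Natural numbers and rational numbers inside the logic -/

section Vocabulary

variable {Γ : Ctx}

/-- `m + n`. -/
def natAdd (m n : Tm Γ Ty.nat) : Tm Γ Ty.nat :=
  .natrec m (lam_ Ty.nat fun _ => lam_ Ty.nat fun r => .succ r) n

/-- `m * n`. -/
def natMul (m n : Tm Γ Ty.nat) : Tm Γ Ty.nat :=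
  .natrec .zero (lam_ Ty.nat fun _ => lam_ Ty.nat fun r => natAdd r m↟↟) n

/-- `m ≤ n`. -/
def natLe (m n : Tm Γ Ty.nat) : Fm Γ := ex_ Ty.nat fun k => natAdd m↟ k =ₒ n↟

/-- `m < n`. -/
def natLt (m n : Tm Γ Ty.nat) : Fm Γ := natLe (.succ m) n

/-- Fractions: the triple `(a, b, c)` represents the rational number `(a - b) / (c + 1)`. -/
abbrev rat : Ty := Ty.nat ×ₜ Ty.nat ×ₜ Ty.nat

/-- The part `a` of the fraction `(a - b) / (c + 1)`. -/
def ratPos (q : Tm Γ rat) : Tm Γ Ty.nat := .fst q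

/-- The part `b` of the fraction `(a - b) / (c + 1)`. -/
def ratNeg (q : Tm Γ rat) : Tm Γ Ty.nat := .fst (.snd q)

/-- The denominator `c + 1` of the fraction `(a - b) / (c + 1)`. -/
def ratDen (q : Tm Γ rat) : Tm Γ Ty.nat := .succ (.snd (.snd q))

/-- `0`. -/
def ratZero : Tm Γ rat := .pair .zero (.pair .zero .zero)

/-- `q < r`. -/
def ratLt (q r : Tm Γ rat) : Fm Γ :=
  natLt (natAdd (natMul (ratPos q) (ratDen r)) (natMul (ratNeg r) (ratDen q)))
    (natAdd (natMul (ratPos r) (ratDen q)) (natMul (ratNeg q) (ratDen r)))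

/-- `q + r`; note that `(c + 1) * (c' + 1) = (c * c' + (c + c')) + 1`. -/
def ratAdd (q r : Tm Γ rat) : Tm Γ rat :=
  .pair (natAdd (natMul (ratPos q) (ratDen r)) (natMul (ratPos r) (ratDen q)))
    (.pair (natAdd (natMul (ratNeg q) (ratDen r)) (natMul (ratNeg r) (ratDen q)))
      (natAdd (natMul (.snd (.snd q)) (.snd (.snd r)))
        (natAdd (.snd (.snd q)) (.snd (.snd r)))))

/-! ### Real numbers inside the logic -/

/-- Pairs of sets of rationals. -/
abbrev cut : Ty := (rat ⇒ₜ Ty.prop) ×ₜ (rat ⇒ₜ Ty.prop)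

/-- `q` lies in the lower set of `x`. -/
def below (x : Tm Γ cut) (q : Tm Γ rat) : Fm Γ := .fst x ⬝ q

/-- `q` lies in the upper set of `x`. -/
def above (x : Tm Γ cut) (q : Tm Γ rat) : Fm Γ := .snd x ⬝ q

/-- `x` is a real number, i.e. a two-sided Dedekind cut: inhabited, rounded, disjoint, located. -/
def IsReal (x : Tm Γ cut) : Fm Γ :=
  (ex_ rat fun q => below x↟ q) ∧ₒ
  (ex_ rat fun q => above x↟ q) ∧ₒ
  (all_ rat fun q => iff_ (below x↟ q) (ex_ rat fun r => ratLt q↟ r ∧ₒ below x↟↟ r)) ∧ₒ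
  (all_ rat fun q => iff_ (above x↟ q) (ex_ rat fun r => ratLt r q↟ ∧ₒ above x↟↟ r)) ∧ₒ
  (all_ rat fun q => not_ (below x↟ q ∧ₒ above x↟ q)) ∧ₒ
  (all_ rat fun q => all_ rat fun r => ratLt q↟ r →ₒ below x↟↟ q↟ ∨ₒ above x↟↟ r)

/-- The real number `0`. -/
def realZero : Tm Γ cut :=
  .pair (lam_ rat fun q => ratLt q ratZero) (lam_ rat fun q => ratLt ratZero q)

/-- `x + y` for real numbers. -/
def realAdd (x y : Tm Γ cut) : Tm Γ cut :=
  .pair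
    (lam_ rat fun q => ex_ rat fun r => ex_ rat fun s =>
      below x↟↟↟ r↟ ∧ₒ below y↟↟↟ s ∧ₒ ratLt q↟↟ (ratAdd r↟ s))
    (lam_ rat fun q => ex_ rat fun r => ex_ rat fun s =>
      above x↟↟↟ r↟ ∧ₒ above y↟↟↟ s ∧ₒ ratLt (ratAdd r↟ s) q↟↟)

/-- `x < y` for real numbers. -/
def realLt (x y : Tm Γ cut) : Fm Γ := ex_ rat fun q => above x↟ q ∧ₒ below y↟ q

/-- `x ≤ y` for real numbers. -/
def realLe (x y : Tm Γ cut) : Fm Γ := all_ rat fun q => below x↟ q →ₒ below y↟ q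

/-- `x` is a positive real number. -/
def IsPosReal (x : Tm Γ cut) : Fm Γ := IsReal x ∧ₒ realLt realZero x

/-! ### Metric spaces inside the logic -/

variable {A B : Ty}

/-- `d` is a metric on the set `A`. -/
def IsMetric (d : Tm Γ (A ⇒ₜ A ⇒ₜ cut)) : Fm Γ :=
  (all_ A fun x => all_ A fun y => IsReal (d↟↟ ⬝ x↟ ⬝ y)) ∧ₒ
  (all_ A fun x => all_ A fun y => iff_ (d↟↟ ⬝ x↟ ⬝ y =ₒ realZero) (x↟ =ₒ y)) ∧ₒ
  (all_ A fun x => all_ A fun y => d↟↟ ⬝ x↟ ⬝ y =ₒ d↟↟ ⬝ y ⬝ x↟) ∧ₒ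
  (all_ A fun x => all_ A fun y => all_ A fun z =>
    realLe (d↟↟↟ ⬝ x↟↟ ⬝ z) (realAdd (d↟↟↟ ⬝ x↟↟ ⬝ y↟) (d↟↟↟ ⬝ y↟ ⬝ z)))

/-- `s` is a Cauchy sequence. -/
def IsCauchySeq (d : Tm Γ (A ⇒ₜ A ⇒ₜ cut)) (s : Tm Γ (Ty.nat ⇒ₜ A)) : Fm Γ :=
  all_ cut fun ε => IsPosReal ε →ₒ ex_ Ty.nat fun k => all_ Ty.nat fun m => all_ Ty.nat fun n =>
    natLe k↟↟ m↟ ∧ₒ natLe k↟↟ n →ₒ realLt (d↟↟↟↟ ⬝ (s↟↟↟↟ ⬝ m↟) ⬝ (s↟↟↟↟ ⬝ n)) ε↟↟↟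

/-- The sequence `s` converges to `x`. -/
def ConvergesTo (d : Tm Γ (A ⇒ₜ A ⇒ₜ cut)) (s : Tm Γ (Ty.nat ⇒ₜ A)) (x : Tm Γ A) : Fm Γ :=
  all_ cut fun ε => IsPosReal ε →ₒ ex_ Ty.nat fun k => all_ Ty.nat fun n =>
    natLe k↟ n →ₒ realLt (d↟↟↟ ⬝ (s↟↟↟ ⬝ n) ⬝ x↟↟↟) ε↟↟

/-- Every Cauchy sequence converges. -/
def IsComplete (d : Tm Γ (A ⇒ₜ A ⇒ₜ cut)) : Fm Γ :=
  all_ (Ty.nat ⇒ₜ A) fun s => IsCauchySeq d↟ s →ₒ ex_ A fun x => ConvergesTo d↟↟ s↟ x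

/-- There is a dense sequence. -/
def IsSeparable (d : Tm Γ (A ⇒ₜ A ⇒ₜ cut)) : Fm Γ :=
  ex_ (Ty.nat ⇒ₜ A) fun a => all_ A fun x => all_ cut fun ε => IsPosReal ε →ₒ
    ex_ Ty.nat fun n => realLt (d↟↟↟↟ ⬝ x↟↟ ⬝ (a↟↟↟ ⬝ n)) ε↟

/-- `x` lies in the open ball with centre `c` and radius `r`. -/
def InBall (d : Tm Γ (A ⇒ₜ A ⇒ₜ cut)) (c : Tm Γ A) (r : Tm Γ cut) (x : Tm Γ A) : Fm Γ :=
  realLt (d ⬝ c ⬝ x) r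

/-- The subset `U` is pointwise open with respect to the family of open balls: every point of `U`
lies in an open ball contained in `U`. -/
def IsPointwiseOpen (d : Tm Γ (A ⇒ₜ A ⇒ₜ cut)) (U : Tm Γ (A ⇒ₜ Ty.prop)) : Fm Γ :=
  all_ A fun x => U↟ ⬝ x →ₒ ex_ A fun c => ex_ cut fun r => IsPosReal r ∧ₒ
    InBall d↟↟↟ c↟ r x↟↟ ∧ₒ all_ A fun y => InBall d↟↟↟↟ c↟↟ r↟ y →ₒ U↟↟↟↟ ⬝ y

/-- Inverse images along `f` of pointwise open sets are pointwise open. -/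
def IsPointwiseContinuous (d : Tm Γ (A ⇒ₜ A ⇒ₜ cut)) (e : Tm Γ (B ⇒ₜ B ⇒ₜ cut))
    (f : Tm Γ (A ⇒ₜ B)) : Fm Γ :=
  all_ (B ⇒ₜ Ty.prop) fun V => IsPointwiseOpen e↟ V →ₒ
    IsPointwiseOpen d↟ (lam_ A fun x => V↟ ⬝ (f↟↟ ⬝ x))

/-! ### The postulates of synthetic computability -/

/-- `f` is a binary sequence. -/
def IsBinary (f : Tm Γ (Ty.nat ⇒ₜ Ty.nat)) : Fm Γ :=
  all_ Ty.nat fun n => f↟ ⬝ n =ₒ .zero ∨ₒ f↟ ⬝ n =ₒ .succ .zero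

/-- The truth value `p` is semidecidable: it is equivalent to `∃ n, f n = 1` for some binary
sequence `f`. -/
def IsSemidec (p : Fm Γ) : Fm Γ :=
  ex_ (Ty.nat ⇒ₜ Ty.nat) fun f => IsBinary f ∧ₒ
    iff_ p↟ (ex_ Ty.nat fun n => f↟ ⬝ n =ₒ .succ .zero)

/-- `S` is a semidecidable subset of `A`. -/
def IsSemidecSet (S : Tm Γ (A ⇒ₜ Ty.prop)) : Fm Γ := all_ A fun x => IsSemidec (S↟ ⬝ x)

end Vocabulary

/-- Dependent Choice, for the subsets `S` of the set `A`: if `R` is a total relation on `S`, then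
through every point of `S` there is a sequence in `S` with consecutive terms related by `R`. -/
def dependentChoice (A : Ty) : Fm [] :=
  all_ (A ⇒ₜ Ty.prop) fun S => all_ (A ⇒ₜ A ⇒ₜ Ty.prop) fun R =>
    (all_ A fun x => S↟↟ ⬝ x →ₒ ex_ A fun y => S↟↟↟ ⬝ y ∧ₒ R↟↟ ⬝ x↟ ⬝ y) →ₒ
    all_ A fun a => S↟↟ ⬝ a →ₒ ex_ (Ty.nat ⇒ₜ A) fun s => s ⬝ .zero =ₒ a↟ ∧ₒ
      all_ Ty.nat fun n => S↟↟↟↟ ⬝ (s↟ ⬝ n) ∧ₒ R↟↟↟ ⬝ (s↟ ⬝ n) ⬝ (s↟ ⬝ .succ n)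

/-- Markov principle: if not all terms of a binary sequence are zero, it contains a one. -/
def markovPrinciple : Fm [] :=
  all_ (Ty.nat ⇒ₜ Ty.nat) fun f => IsBinary f →ₒ
    not_ (all_ Ty.nat fun n => f↟ ⬝ n =ₒ .zero) →ₒ ex_ Ty.nat fun n => f↟ ⬝ n =ₒ .succ .zero

/-- Enumerability: there is a sequence that enumerates the semidecidable (equivalently, the
countable) subsets of the natural numbers. -/
def enumerability : Fm [] :=
  ex_ (Ty.nat ⇒ₜ Ty.nat ⇒ₜ Ty.prop) fun W =>
    (all_ Ty.nat fun n => IsSemidecSet (W↟ ⬝ n)) ∧ₒ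
    (all_ (Ty.nat ⇒ₜ Ty.prop) fun S => IsSemidecSet S →ₒ ex_ Ty.nat fun n => W↟↟ ⬝ n =ₒ S↟)

/-- Stable subspaces: if `X` is a `¬¬`-stable subset of the natural numbers, then every
semidecidable subset of `X` is the restriction to `X` of a semidecidable subset of the natural
numbers. -/
def stableSubspace : Fm [] :=
  all_ (Ty.nat ⇒ₜ Ty.prop) fun X => (all_ Ty.nat fun n => not_ (not_ (X↟ ⬝ n)) →ₒ X↟ ⬝ n) →ₒ
    all_ (Ty.nat ⇒ₜ Ty.prop) fun S => (all_ Ty.nat fun n => X↟↟ ⬝ n →ₒ IsSemidec (S↟ ⬝ n)) →ₒ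
      ex_ (Ty.nat ⇒ₜ Ty.prop) fun V => IsSemidecSet V ∧ₒ
        all_ Ty.nat fun n => X↟↟↟ ⬝ n →ₒ iff_ (V↟ ⬝ n) (S↟↟ ⬝ n)

/-- The postulates of synthetic computability, on top of intuitionistic higher-order logic. -/
inductive Postulate : Fm [] → Prop
  | dependentChoice (A : Ty) : Postulate (dependentChoice A)
  | markovPrinciple : Postulate markovPrinciple
  | enumerability : Postulate enumerability
  | stableSubspace : Postulate stableSubspace

/-- `φ` is a theorem of synthetic computability. -/
def Provable (φ : Fm []) : Prop := Derivable {ψ | Postulate ψ} [] φ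

/-- The formula saying that, whenever `d` is a metric for which `A` is complete and separable and
`e` is a metric on `B`, every map `f` from `A` to `B` is pointwise continuous. -/
def everyMapPointwiseContinuous (A B : Ty) : Fm [] :=
  all_ (A ⇒ₜ A ⇒ₜ cut) fun d => all_ (B ⇒ₜ B ⇒ₜ cut) fun e =>
    IsMetric d↟ ∧ₒ IsComplete d↟ ∧ₒ IsSeparable d↟ ∧ₒ IsMetric e →ₒ
      all_ (A ⇒ₜ B) fun f => IsPointwiseContinuous d↟↟ e↟ f

end SynthComp

namespace SynthComp

/-! ### Substitution calculus -/

/-! There are two tasks: the Kreisel–Lacombe–Shoenfield–Tseitin argument itself, and the fact that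
it is derivable in the calculus.

Derivability. Explicit derivation trees are avoided by means of a generic model. Over a base context
`Γ₀`, infinitely many fresh variables of every inhabited type are adjoined; terms up to provable
equality are the elements, and `p ⊩ a` means that `p → a` is derivable. Inhabitedness makes the
extension conservative (`pf_lift`); freshness makes the variables generic, so that a universal
formula is derivable once all its instances in the model are (`tr_all`). Hence forcing obeys a
clause for each connective (`forces_imp`, `forces_all`, `forces_ex`, `forces_or`), with ∃ and ∨ in
impredicative form: whatever follows from each witness, after strengthening `p`, already holds at
`p`. The informal proof can then be run on forced statements, and what every `p` forces is derivable
(`tr_of_forces`). Only the arithmetic of fractions is done differently: an entailment may be tested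
at prime filters of truth values, where the natural numbers become a linearly ordered semiring
(`forces_of_point`).

Diagonal lemma (`exists_not_of_semidec_vanishing`). Let `Q ⊆ ℕ` be ¬¬-stable, and suppose that "f
vanishes" is semidecidable for every binary `f` whose first one, if any, lies in `Q`. Let `g n` be a
binary sequence witnessing `n ∈ W n`, and let `X` be the stable set of those `n` for which the first
one of `g n`, if any, lies in `Q`. On `X`, `n ∉ W n` is semidecidable, so by the Stable Subspace
Axiom it agrees there with some `W v`. Diagonalisation gives `v ∉ X`; by Markov `g v` has a first
one, and its position is not in `Q`.

Metric lemma (`exists_not_of_near`). Let `P` be semidecidable with `x ∈ P`, and let each `i ∈ Q`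
yield a point within `1/(i+1)` of `x` outside `P`. For `f` as above, the sequence that stays at `x`
until the first one of `f`, at `i`, and then stays at the point given for `i`, converges to some `z`
by completeness. Now `z ∈ P` exactly if `f` vanishes, so the diagonal lemma gives an `i ∉ Q`.

Continuity (`forces_isPointwiseOpen_preimage`). Let `f x` lie in a ball about `c` inside `V`, and
choose `t' < t` strictly between `e(c, f x)` and the radius. The metric lemma for `{z | e(c, f z) <
t'}` yields an `i` such that no point of the dense sequence within `1/(i+1)` of `x` has `e(c, f z) >
t'`. If `y` is in that ball, then `e(c, f y) < t`, or `e(c, f y) > t'`. The latter is refuted by the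
metric lemma for `{z | e(c, f z) > t'}` at `y`, since dense points arbitrarily close to `y` avoid
this set. -/

theorem Ren.lift_comp {Γ Δ Θ : Ctx} (ρ : Ren Γ Δ) (τ : Ren Δ Θ) {B A : Ty} (x : Var (B :: Γ) A) :
    Ren.lift τ (Ren.lift ρ x) = Ren.lift (fun y => τ (ρ y)) x := by
  cases x <;> rfl

theorem Tm.ren_ext {Γ Δ : Ctx} {A : Ty} {ρ τ : Ren Γ Δ} (h : ∀ {A} (x : Var Γ A), ρ x = τ x)
    (t : Tm Γ A) : t.ren ρ = t.ren τ := by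
  have : @ρ = @τ := by funext A x; exact h x
  rw [this]

theorem Tm.sub_ext {Γ Δ : Ctx} {A : Ty} {σ τ : Sub Γ Δ} (h : ∀ {A} (x : Var Γ A), σ x = τ x)
    (t : Tm Γ A) : t.sub σ = t.sub τ := by
  have : @σ = @τ := by funext A x; exact h x
  rw [this]

theorem Tm.ren_ren {Γ Δ Θ : Ctx} {A : Ty} (ρ : Ren Γ Δ) (τ : Ren Δ Θ) (t : Tm Γ A) :
    (t.ren ρ).ren τ = t.ren (fun x => τ (ρ x)) := by
  induction t generalizing Δ Θ <;> simp only [Tm.ren, *]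
  all_goals congr 1; exact Tm.ren_ext (fun x => Ren.lift_comp ρ τ x) _

theorem Tm.sub_ren {Γ Δ Θ : Ctx} {A : Ty} (ρ : Ren Γ Δ) (σ : Sub Δ Θ) (t : Tm Γ A) :
    (t.ren ρ).sub σ = t.sub (fun x => σ (ρ x)) := by
  induction t generalizing Δ Θ <;> simp only [Tm.ren, Tm.sub, *]
  all_goals congr 1; exact Tm.sub_ext (fun x => by cases x <;> rfl) _

theorem Tm.ren_sub {Γ Δ Θ : Ctx} {A : Ty} (σ : Sub Γ Δ) (ρ : Ren Δ Θ) (t : Tm Γ A) :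
    (t.sub σ).ren ρ = t.sub (fun x => (σ x).ren ρ) := by
  induction t generalizing Δ Θ <;> simp only [Tm.ren, Tm.sub, *]
  all_goals congr 1; exact Tm.sub_ext (fun x => by
    cases x
    · rfl
    · simp [Sub.lift, Tm.wk, Tm.ren_ren, Ren.lift]) _

@[simp] theorem Tm.wk_sub_lift {Γ Δ : Ctx} {A B : Ty} (σ : Sub Γ Δ) (t : Tm Γ A) :
    (t.wk (B := B)).sub (Sub.lift σ) = (t.sub σ).wk := by
  simp [Tm.wk, Tm.sub_ren, Tm.ren_sub, Sub.lift]

theorem Tm.sub_sub {Γ Δ Θ : Ctx} {A : Ty} (σ : Sub Γ Δ) (τ : Sub Δ Θ) (t : Tm Γ A) :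
    (t.sub σ).sub τ = t.sub (fun x => (σ x).sub τ) := by
  induction t generalizing Δ Θ <;> simp only [Tm.sub, *]
  all_goals congr 1; exact Tm.sub_ext (fun x => by
    cases x
    · rfl
    · simp [Sub.lift]) _

theorem Tm.ren_eq_sub {Γ Δ : Ctx} {A : Ty} (ρ : Ren Γ Δ) (t : Tm Γ A) :
    t.ren ρ = t.sub (fun x => .var (ρ x)) := by
  induction t generalizing Δ <;> simp only [Tm.ren, Tm.sub, *]
  all_goals congr 1; exact Tm.sub_ext (fun x => by cases x <;> rfl) _

@[simp] theorem Tm.sub_var {Γ : Ctx} {A : Ty} (t : Tm Γ A) : t.sub (fun x => .var x) = t := by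
  induction t <;> simp only [Tm.sub, *]
  all_goals
    congr 1
    refine (Tm.sub_ext (fun x => ?_) _).trans ‹_›
    cases x <;> rfl

@[simp] theorem Tm.wk_inst {Γ : Ctx} {A B : Ty} (t : Tm Γ A) (s : Tm Γ B) : t.wk.inst s = t := by
  simp [Tm.wk, Tm.inst, Tm.sub_ren, Sub.single]

theorem Tm.inst_sub {Γ Δ : Ctx} {A B : Ty} (σ : Sub Γ Δ) (t : Tm (B :: Γ) A) (s : Tm Γ B) :
    (t.inst s).sub σ = (t.sub (Sub.lift σ)).inst (s.sub σ) := by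
  simp only [Tm.inst, Tm.sub_sub]
  exact Tm.sub_ext (fun x => by
    cases x
    · rfl
    · have := Tm.wk_inst (B := B) (σ ‹_›) (s.sub σ)
      simp only [Tm.inst] at this
      simp [Sub.single, Sub.lift, this, Tm.sub]) _

@[simp] theorem Tm.closed_sub {Γ Δ : Ctx} {A : Ty} (σ : Sub Γ Δ) (t : Tm [] A) :
    (t.closed).sub σ = t.closed := by
  rw [Tm.closed, Tm.sub_ren, Tm.closed, Tm.ren_eq_sub]
  exact Tm.sub_ext (fun {_} (x : Var [] _) => nomatch x) _

/-- Induction on the derivation. Asking only for membership in `Ψ` lets weakening, renaming and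
substitution for fresh variables all be special cases; the postulates survive because they are
closed. -/
theorem Derivable.sub {T : Set (Fm [])} {Γ Δ : Ctx} {Φ : List (Fm Γ)} {φ : Fm Γ} (σ : Sub Γ Δ)
    (h : Derivable T Φ φ) {Ψ : List (Fm Δ)} (hΨ : ∀ ψ ∈ Φ, ψ.sub σ ∈ Ψ) :
    Derivable T Ψ (φ.sub σ) := by
  have cons : ∀ {Γ Δ : Ctx} {Φ : List (Fm Γ)} {Ψ : List (Fm Δ)} {σ : Sub Γ Δ} (θ : Fm Γ),
      (∀ ψ ∈ Φ, ψ.sub σ ∈ Ψ) → ∀ ψ ∈ θ :: Φ, ψ.sub σ ∈ θ.sub σ :: Ψ := by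
    intro Γ Δ Φ Ψ σ θ h ψ hψ
    rcases List.mem_cons.1 hψ with rfl | hψ
    · simp
    · exact List.mem_cons_of_mem _ (h _ hψ)
  have wk : ∀ {Γ Δ : Ctx} {Φ : List (Fm Γ)} {Ψ : List (Fm Δ)} {σ : Sub Γ Δ} (B : Ty),
      (∀ ψ ∈ Φ, ψ.sub σ ∈ Ψ) → ∀ ψ ∈ Φ.map (Tm.wk (B := B)), ψ.sub (Sub.lift σ) ∈
        Ψ.map (Tm.wk (B := B)) := by
    intro Γ Δ Φ Ψ σ B h ψ hψ
    obtain ⟨θ, hθ, rfl⟩ := List.mem_map.1 hψ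
    rw [Tm.wk_sub_lift]
    exact List.mem_map_of_mem (h _ hθ)
  induction h generalizing Δ with
  | hyp h => exact .hyp (hΨ _ h)
  | postulate h => rw [Tm.closed_sub]; exact .postulate h
  | botE _ ih => exact .botE (ih σ hΨ)
  | andI _ _ ih₁ ih₂ => exact .andI (ih₁ σ hΨ) (ih₂ σ hΨ)
  | andE₁ _ ih => exact .andE₁ (ih σ hΨ)
  | andE₂ _ ih => exact .andE₂ (ih σ hΨ)
  | orI₁ _ ih => exact .orI₁ (ih σ hΨ)
  | orI₂ _ ih => exact .orI₂ (ih σ hΨ)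
  | orE _ _ _ ih ih₁ ih₂ => exact .orE (ih σ hΨ) (ih₁ σ (cons _ hΨ)) (ih₂ σ (cons _ hΨ))
  | impI _ ih => exact .impI (ih σ (cons _ hΨ))
  | impE _ _ ih₁ ih₂ => exact .impE (ih₁ σ hΨ) (ih₂ σ hΨ)
  | allI _ ih => exact .allI (ih (Sub.lift σ) (wk _ hΨ))
  | allE t _ ih => rw [Tm.inst_sub]; exact .allE _ (ih σ hΨ)
  | exI t _ ih =>
    refine .exI (t.sub σ) ?_
    have := ih σ hΨ
    rwa [Tm.inst_sub] at this
  | exE _ _ ih₁ ih₂ =>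
    refine .exE (ih₁ σ hΨ) ?_
    have := ih₂ (Sub.lift σ) (cons _ (wk _ hΨ))
    rwa [Tm.wk_sub_lift] at this
  | eqI t => exact .eqI _
  | eqE φ _ _ ih₁ ih₂ =>
    have h₁ := ih₁ σ hΨ
    have h₂ := ih₂ σ hΨ
    rw [Tm.inst_sub] at h₂ ⊢
    exact .eqE _ h₁ h₂
  | beta t s =>
    rw [show (Tm.eq _ (t.inst s)).sub σ = Tm.eq _ ((t.inst s).sub σ) from rfl, Tm.inst_sub]
    exact .beta _ _
  | funext _ ih =>
    refine .funext ?_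
    have := ih σ hΨ
    simpa [Tm.sub, Sub.lift] using this
  | fstPair s t => exact .fstPair _ _
  | sndPair s t => exact .sndPair _ _
  | pairEta t => exact .pairEta _
  | propext _ ih => exact .propext (ih σ hΨ)
  | succNeZero n => exact .succNeZero _
  | succInj _ ih => exact .succInj (ih σ hΨ)
  | induction _ _ ih₁ ih₂ =>
    have h₂ := ih₂ σ hΨ
    simp only [Tm.sub, Tm.wk_sub_lift, Sub.lift] at h₂ ⊢
    exact .induction (ih₁ σ hΨ) h₂
  | natrecZero z s => exact .natrecZero _ _
  | natrecSucc z s n => exact .natrecSucc _ _ _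
  | uniqueChoice _ ih =>
    have h := ih σ hΨ
    simp only [Tm.sub, Tm.wk_sub_lift, Sub.lift] at h ⊢
    exact .uniqueChoice h

theorem Derivable.mono {T : Set (Fm [])} {Γ : Ctx} {Φ Ψ : List (Fm Γ)} {φ : Fm Γ}
    (h : Derivable T Φ φ) (hΨ : ∀ ψ ∈ Φ, ψ ∈ Ψ) : Derivable T Ψ φ := by
  have := h.sub (fun x => .var x) (Ψ := Ψ) (fun ψ hψ => by simpa using hΨ ψ hψ)
  simpa using this

theorem Derivable.ren {T : Set (Fm [])} {Γ Δ : Ctx} {φ : Fm Γ} (ρ : Ren Γ Δ)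
    (h : Derivable T [] φ) : Derivable T [] (φ.ren ρ) := by
  rw [Tm.ren_eq_sub]
  exact h.sub _ (by simp)

end SynthComp

namespace SynthComp

/-! ### A generic model

Over a base context `Γ₀` we adjoin infinitely many fresh variables of every type that is inhabited
by a term over `Γ₀`.  The terms over the resulting contexts, up to provable equality, form a model
with constant domains in which truth is derivability. -/

/-- Derivability from the postulates of synthetic computability. -/
abbrev Pf {Γ : Ctx} (Φ : List (Fm Γ)) (φ : Fm Γ) : Prop := Derivable {ψ | Postulate ψ} Φ φ

/-- An injective numbering of types. -/
def Ty.code : Ty → ℕ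
  | .prop => Nat.pair 0 0
  | .nat => Nat.pair 1 0
  | .sort i => Nat.pair 2 i
  | .prod A B => Nat.pair 3 (Nat.pair A.code B.code)
  | .arr A B => Nat.pair 4 (Nat.pair A.code B.code)

theorem Ty.code_injective : Function.Injective Ty.code := by
  intro A
  induction A with
  | prop | nat | sort => intro B h; cases B <;> simp_all [Ty.code, Nat.pair_eq_pair]
  | prod A₁ A₂ ih₁ ih₂ | arr A₁ A₂ ih₁ ih₂ =>
    intro B h
    cases B <;> simp only [Ty.code, Nat.pair_eq_pair] at h <;> try omega
    rw [ih₁ h.2.1, ih₂ h.2.2]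

/-- The type `C` has a term over `Γ₀`. -/
class Inhab (Γ₀ : Ctx) (C : Ty) : Prop where
  exists_tm : Nonempty (Tm Γ₀ C)

instance (Γ₀ : Ctx) : Inhab Γ₀ .prop := ⟨⟨.bot⟩⟩
instance (Γ₀ : Ctx) : Inhab Γ₀ .nat := ⟨⟨.zero⟩⟩
instance (Γ₀ : Ctx) (A B : Ty) [hA : Inhab Γ₀ A] [hB : Inhab Γ₀ B] : Inhab Γ₀ (A ×ₜ B) :=
  ⟨hA.1.elim fun s => hB.1.elim fun t => ⟨.pair s t⟩⟩
instance (Γ₀ : Ctx) (A B : Ty) [hB : Inhab Γ₀ B] : Inhab Γ₀ (A ⇒ₜ B) :=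
  ⟨hB.1.elim fun t => ⟨.lam t.wk⟩⟩

open Classical in
/-- The type of the `n`-th fresh variable. -/
noncomputable def genTy (Γ₀ : Ctx) (n : ℕ) : Ty :=
  if h : ∃ C, Inhab Γ₀ C ∧ C.code = n.unpair.1 then h.choose else .nat

instance genTy_inhab (Γ₀ : Ctx) (n : ℕ) : Inhab Γ₀ (genTy Γ₀ n) := by
  unfold genTy
  split
  · next h => exact h.choose_spec.1
  · infer_instance

/-- Pairing the code of `C` with `n` gives an index beyond `n` that decodes to `C`. Thus a variable
of type `C` that is fresh for any prescribed stage is always available. -/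
theorem exists_genTy (Γ₀ : Ctx) (C : Ty) [hC : Inhab Γ₀ C] (n : ℕ) :
    ∃ m, n ≤ m ∧ genTy Γ₀ m = C := by
  refine ⟨Nat.pair C.code n, Nat.right_le_pair _ _, ?_⟩
  have h : ∃ D, Inhab Γ₀ D ∧ D.code = (Nat.pair C.code n).unpair.1 := ⟨C, hC, by simp⟩
  rw [genTy, dif_pos h]
  apply Ty.code_injective
  rw [h.choose_spec.2]
  simp

/-- The base context with the first `n` fresh variables adjoined. -/
noncomputable def stage (Γ₀ : Ctx) : ℕ → Ctx
  | 0 => Γ₀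
  | n + 1 => genTy Γ₀ n :: stage Γ₀ n

variable {Γ₀ : Ctx}

/-- The inclusion of an earlier stage into a later one. -/
noncomputable def emb {n m : ℕ} (h : n ≤ m) : Ren (stage Γ₀ n) (stage Γ₀ m) := fun {A} x =>
  Nat.leRec (motive := fun m _ => Var (stage Γ₀ m) A) x (fun _ _ y => .there y) h

theorem emb_self {n : ℕ} {A : Ty} (x : Var (stage Γ₀ n) A) : emb (le_refl n) x = x :=
  Nat.leRec_self ..

theorem emb_succ {n m : ℕ} (h : n ≤ m) {A : Ty} (x : Var (stage Γ₀ n) A) :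
    emb (h.trans m.le_succ) x = .there (emb h x) := Nat.leRec_succ ..

theorem emb_emb {n m k : ℕ} (h : n ≤ m) (h' : m ≤ k) {A : Ty} (x : Var (stage Γ₀ n) A) :
    emb h' (emb h x) = emb (h.trans h') x := by
  induction k, h' using Nat.le_induction with
  | base => rw [emb_self]
  | succ k h' ih => rw [emb_succ h', ih, ← emb_succ]

/-- A term of some stage, regarded as a term of a later one. -/
noncomputable def lift {n m : ℕ} (h : n ≤ m) {A : Ty} (t : Tm (stage Γ₀ n) A) :
    Tm (stage Γ₀ m) A := t.ren (emb h)

theorem lift_lift {n m k : ℕ} (h : n ≤ m) (h' : m ≤ k) {A : Ty} (t : Tm (stage Γ₀ n) A) :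
    lift h' (lift h t) = lift (h.trans h') t := by
  simp only [lift, Tm.ren_ren, emb_emb]

theorem lift_self {n : ℕ} {A : Ty} (t : Tm (stage Γ₀ n) A) : lift le_rfl t = t := by
  simp only [lift, Tm.ren_eq_sub, emb_self, Tm.sub_var]

theorem lift_succ {n : ℕ} {A : Ty} (t : Tm (stage Γ₀ n) A) : lift n.le_succ t = t.wk := by
  simp only [lift, Tm.wk]
  exact Tm.ren_ext (fun x => by rw [emb_succ le_rfl, emb_self]) _

/-- Each adjoined variable has a type inhabited over `Γ₀`, so it can be substituted away. For a
possibly empty type this would fail, and adjoining a variable would not be conservative. -/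
theorem exists_retraction {n m : ℕ} (h : n ≤ m) :
    ∃ σ : Sub (stage Γ₀ m) (stage Γ₀ n), ∀ {A} (x : Var (stage Γ₀ n) A), σ (emb h x) = .var x := by
  induction m, h using Nat.le_induction with
  | base => exact ⟨fun x => .var x, fun x => by rw [emb_self]⟩
  | succ m h ih =>
    obtain ⟨σ, hσ⟩ := ih
    obtain ⟨t⟩ := (genTy_inhab Γ₀ m).1
    refine ⟨fun {A} x => (show Var (genTy Γ₀ m :: stage Γ₀ m) A → Tm (stage Γ₀ n) A from fun
      | .here => lift (Nat.zero_le n) (show Tm (stage Γ₀ 0) _ from t)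
      | .there y => σ y) x, fun x => ?_⟩
    rw [emb_succ h]
    exact hσ x

theorem pf_lift {n m : ℕ} (h : n ≤ m) {φ : Fm (stage Γ₀ n)} : Pf [] (lift h φ) ↔ Pf [] φ := by
  constructor
  · intro H
    obtain ⟨σ, hσ⟩ := exists_retraction (Γ₀ := Γ₀) h
    have := H.sub σ (Ψ := []) (by simp)
    simpa [lift, Tm.sub_ren, hσ] using this
  · intro H
    exact H.ren _

/-! ### Equational reasoning in the calculus -/

section Equational

variable {Γ : Ctx} {Φ : List (Fm Γ)} {A B : Ty}

@[simp] theorem Tm.inst_here (s : Tm Γ A) : (Tm.var .here).inst s = s := rfl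

@[simp] theorem Tm.inst_eq (s t : Tm (B :: Γ) A) (u : Tm Γ B) :
    (s =ₒ t).inst u = (s.inst u =ₒ t.inst u) := rfl

@[simp] theorem Tm.inst_app {C : Ty} (f : Tm (C :: Γ) (A ⇒ₜ B)) (t : Tm (C :: Γ) A)
    (u : Tm Γ C) : (f ⬝ t).inst u = f.inst u ⬝ t.inst u := rfl

theorem pf_symm {s t : Tm Γ A} (h : Pf Φ (s =ₒ t)) : Pf Φ (t =ₒ s) := by
  have := Derivable.eqE (.var .here =ₒ s.wk) h (by simpa using Derivable.eqI s)
  simpa using this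

theorem pf_trans {s t u : Tm Γ A} (h : Pf Φ (s =ₒ t)) (h' : Pf Φ (t =ₒ u)) : Pf Φ (s =ₒ u) := by
  have := Derivable.eqE (s.wk =ₒ .var .here) h' (by simpa using h)
  simpa using this

theorem pf_eq_mp {φ ψ : Fm Γ} (h : Pf Φ (φ =ₒ ψ)) (h' : Pf Φ φ) : Pf Φ ψ :=
  Derivable.eqE (.var .here) h h'

theorem pf_app {f g : Tm Γ (A ⇒ₜ B)} {s t : Tm Γ A} (h : Pf Φ (f =ₒ g)) (h' : Pf Φ (s =ₒ t)) :
    Pf Φ (f ⬝ s =ₒ g ⬝ t) := by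
  have h₁ := Derivable.eqE (f.wk ⬝ s.wk =ₒ .var .here ⬝ s.wk) h
    (by simpa using Derivable.eqI (f ⬝ s))
  have h₂ := Derivable.eqE (f.wk ⬝ s.wk =ₒ g.wk ⬝ .var .here) h' (by simpa using h₁)
  simpa using h₂

/-- Induction on the context, not on the term: the last variable is abstracted, β turns the
substitution into an application, and congruence of application finishes. So binders inside `t` need
no attention. -/
theorem pf_sub_congr {Δ : Ctx} {Ψ : List (Fm Δ)} {σ τ : Sub Γ Δ}
    (h : ∀ {A} (x : Var Γ A), Pf Ψ (σ x =ₒ τ x)) (t : Tm Γ A) : Pf Ψ (t.sub σ =ₒ t.sub τ) := by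
  induction Γ generalizing A with
  | nil =>
    rw [Tm.sub_ext (σ := σ) (τ := τ) (fun x => nomatch x)]
    exact .eqI _
  | cons B Γ ih =>
    have key : ∀ σ : Sub (B :: Γ) Δ,
        Pf Ψ (((Tm.lam t).sub (fun x => σ (.there x))) ⬝ σ .here =ₒ t.sub σ) := by
      intro σ
      have := Derivable.beta (T := {ψ | Postulate ψ}) (Φ := Ψ)
        (t.sub (Sub.lift fun x => σ (.there x))) (σ .here)
      rw [Tm.inst, Tm.sub_sub, Tm.sub_ext (τ := σ)] at this
      · exact this
      · intro A x
        cases x with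
        | here => rfl
        | there x => exact Tm.wk_inst _ _
    exact pf_trans (pf_symm (key σ)) (pf_trans (pf_app (ih (fun x => h (.there x)) _) (h .here))
      (key τ))

end Equational

/-! ### The domains of the model -/

theorem lift_eq {n m : ℕ} (h : n ≤ m) {A : Ty} (s t : Tm (stage Γ₀ n) A) :
    lift h (s =ₒ t) = (lift h s =ₒ lift h t) := rfl

theorem lift_sub {n m : ℕ} (h : n ≤ m) {Γ : Ctx} {A : Ty} (σ : Sub Γ (stage Γ₀ n)) (t : Tm Γ A) :
    lift h (t.sub σ) = t.sub (fun x => lift h (σ x)) := Tm.ren_sub ..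

/-- Two terms of possibly different stages are provably equal. -/
def stageEq (Γ₀ : Ctx) (A : Ty) (s t : Σ n, Tm (stage Γ₀ n) A) : Prop :=
  ∃ k, ∃ (h : s.1 ≤ k) (h' : t.1 ≤ k), Pf [] (lift h s.2 =ₒ lift h' t.2)

theorem stageEq.pf {A : Ty} {s t : Σ n, Tm (stage Γ₀ n) A} (H : stageEq Γ₀ A s t) {k : ℕ}
    (h : s.1 ≤ k) (h' : t.1 ≤ k) : Pf [] (lift h s.2 =ₒ lift h' t.2) := by
  obtain ⟨l, hs, ht, H⟩ := H
  have H := (pf_lift (le_max_left l k)).2 H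
  rw [lift_eq, lift_lift, lift_lift] at H
  rw [← pf_lift (le_max_right l k), lift_eq, lift_lift, lift_lift]
  exact H

/-- Provable equality of terms of all stages. -/
def stageSetoid (Γ₀ : Ctx) (A : Ty) : Setoid (Σ n, Tm (stage Γ₀ n) A) where
  r := stageEq Γ₀ A
  iseqv :=
    { refl := fun s => ⟨s.1, le_rfl, le_rfl, .eqI _⟩
      symm := fun ⟨k, h, h', H⟩ => ⟨k, h', h, pf_symm H⟩
      trans := fun {s t u} H H' => by
        have hs : s.1 ≤ max s.1 (max t.1 u.1) := by simp
        have ht : t.1 ≤ max s.1 (max t.1 u.1) := by simp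
        have hu : u.1 ≤ max s.1 (max t.1 u.1) := by simp
        exact ⟨_, hs, hu, pf_trans (H.pf hs ht) (H'.pf ht hu)⟩ }

/-- The domain of the model at the type `A`. -/
def Dom (Γ₀ : Ctx) (A : Ty) : Type := Quotient (stageSetoid Γ₀ A)

/-- The element of the model named by a term. -/
def mk (n : ℕ) {A : Ty} (t : Tm (stage Γ₀ n) A) : Dom Γ₀ A :=
  Quotient.mk (stageSetoid Γ₀ A) ⟨n, t⟩

theorem mk_lift {n m : ℕ} (h : n ≤ m) {A : Ty} (t : Tm (stage Γ₀ n) A) :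
    mk m (lift h t) = mk n t :=
  Quotient.sound (s := stageSetoid Γ₀ A) ⟨m, le_rfl, h, by
    dsimp only
    rw [lift_self]
    exact .eqI _⟩

theorem mk_eq_mk {n : ℕ} {A : Ty} {s t : Tm (stage Γ₀ n) A} :
    mk n s = mk n t ↔ Pf [] (s =ₒ t) := by
  constructor
  · intro h
    have : stageEq Γ₀ A ⟨n, s⟩ ⟨n, t⟩ := Quotient.exact (s := stageSetoid Γ₀ A) h
    simpa [lift_self] using this.pf le_rfl le_rfl
  · intro h
    refine Quotient.sound (s := stageSetoid Γ₀ A) ⟨n, le_rfl, le_rfl, ?_⟩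
    simpa [lift_self] using h

theorem exists_mk {A : Ty} (x : Dom Γ₀ A) : ∃ n, ∃ t : Tm (stage Γ₀ n) A, mk n t = x := by
  induction x using Quotient.ind with
  | _ a => exact ⟨a.1, a.2, rfl⟩

/-- Assignments of elements of the model to the variables of a context. -/
def Env (Γ₀ Γ : Ctx) : Type := ∀ A, Var Γ A → Dom Γ₀ A

/-- The empty assignment. -/
def Env.nil : Env Γ₀ [] := fun _ x => nomatch x

/-- Extension of an assignment. -/
def Env.cons {Γ : Ctx} {B : Ty} (b : Dom Γ₀ B) (ρ : Env Γ₀ Γ) : Env Γ₀ (B :: Γ)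
  | _, .here => b
  | _, .there x => ρ _ x

infixr:67 " ∷ " => Env.cons

/-- A context is finite, so the names of all assigned elements fit into one stage. By `pf_sub_congr`
the choice of names does not affect values (`eval_eq`). -/
theorem Env.exists_rep {Γ : Ctx} (ρ : Env Γ₀ Γ) :
    ∃ n, ∃ σ : Sub Γ (stage Γ₀ n), ∀ {A} (x : Var Γ A), mk n (σ x) = ρ A x := by
  induction Γ with
  | nil => exact ⟨0, @fun A x => (show Var [] A → Tm (stage Γ₀ 0) A from fun y => nomatch y) x,
      @fun A x => nomatch x⟩
  | cons B Γ ih =>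
    obtain ⟨n, σ, hσ⟩ := ih (fun A x => ρ A (.there x))
    obtain ⟨m, t, ht⟩ := exists_mk (ρ B .here)
    refine ⟨max n m, fun {A} x => (show Var (B :: Γ) A → Tm (stage Γ₀ (max n m)) A from fun
      | .here => lift (le_max_right n m) t
      | .there y => lift (le_max_left n m) (σ y)) x, fun {A} x => ?_⟩
    cases x with
    | here => exact (mk_lift _ _).trans ht
    | there y => exact (mk_lift _ _).trans (hσ y)

/-- The value of a term under an assignment. -/
noncomputable def eval {Γ : Ctx} {A : Ty} (t : Tm Γ A) (ρ : Env Γ₀ Γ) : Dom Γ₀ A :=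
  mk ρ.exists_rep.choose (t.sub ρ.exists_rep.choose_spec.choose)

theorem mk_sub_eq {Γ : Ctx} {A : Ty} (t : Tm Γ A) (ρ : Env Γ₀ Γ) {m n : ℕ}
    (τ : Sub Γ (stage Γ₀ m)) (σ : Sub Γ (stage Γ₀ n)) (hτ : ∀ {A} (x : Var Γ A), mk m (τ x) = ρ A x)
    (hσ : ∀ {A} (x : Var Γ A), mk n (σ x) = ρ A x) : mk m (t.sub τ) = mk n (t.sub σ) := by
  rw [← mk_lift (le_max_left m n), ← mk_lift (le_max_right m n), mk_eq_mk, lift_sub, lift_sub]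
  refine pf_sub_congr (fun x => ?_) t
  rw [← mk_eq_mk, mk_lift, mk_lift, hσ, hτ]

theorem eval_eq {Γ : Ctx} {A : Ty} (t : Tm Γ A) (ρ : Env Γ₀ Γ) {n : ℕ} (σ : Sub Γ (stage Γ₀ n))
    (hσ : ∀ {A} (x : Var Γ A), mk n (σ x) = ρ A x) : eval t ρ = mk n (t.sub σ) :=
  mk_sub_eq t ρ _ σ (@ρ.exists_rep.choose_spec.choose_spec) hσ

@[simp] theorem eval_sub {Γ Δ : Ctx} {A : Ty} (t : Tm Γ A) (σ : Sub Γ Δ) (ρ : Env Γ₀ Δ) :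
    eval (t.sub σ) ρ = eval t (fun _ x => eval (σ x) ρ) := by
  obtain ⟨n, τ, hτ⟩ := ρ.exists_rep
  rw [eval_eq _ _ τ hτ, Tm.sub_sub]
  exact (eval_eq _ _ _ (fun x => (eval_eq _ _ τ hτ).symm)).symm

@[simp] theorem eval_var {Γ : Ctx} {A : Ty} (x : Var Γ A) (ρ : Env Γ₀ Γ) :
    eval (.var x) ρ = ρ A x := by
  obtain ⟨n, τ, hτ⟩ := ρ.exists_rep
  rw [eval_eq _ _ τ hτ]
  exact hτ x

@[simp] theorem Env.cons_here {Γ : Ctx} {B : Ty} (b : Dom Γ₀ B) (ρ : Env Γ₀ Γ) :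
    (b ∷ ρ) B .here = b := rfl

@[simp] theorem Env.cons_there {Γ : Ctx} {A B : Ty} (b : Dom Γ₀ B) (ρ : Env Γ₀ Γ) (x : Var Γ A) :
    (b ∷ ρ) A (.there x) = ρ A x := rfl

@[simp] theorem eval_wk {Γ : Ctx} {A B : Ty} (t : Tm Γ A) (b : Dom Γ₀ B) (ρ : Env Γ₀ Γ) :
    eval t.wk (b ∷ ρ) = eval t ρ := by
  rw [Tm.wk, Tm.ren_eq_sub, eval_sub]
  simp

theorem eval_inst {Γ : Ctx} {A B : Ty} (t : Tm (B :: Γ) A) (s : Tm Γ B) (ρ : Env Γ₀ Γ) :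
    eval (t.inst s) ρ = eval t (eval s ρ ∷ ρ) := by
  rw [Tm.inst, eval_sub]
  congr 1
  funext A x
  cases x
  · rfl
  · exact eval_var _ _

/-- A truth value of the model that is derivable. -/
def Tr (a : Dom Γ₀ .prop) : Prop := ∃ n, ∃ φ : Fm (stage Γ₀ n), mk n φ = a ∧ Pf [] φ

theorem tr_mk {n : ℕ} {φ : Fm (stage Γ₀ n)} : Tr (mk n φ) ↔ Pf [] φ := by
  refine ⟨fun ⟨m, ψ, h, H⟩ => ?_, fun h => ⟨n, φ, rfl, h⟩⟩
  rw [← mk_lift (le_max_left m n), ← mk_lift (le_max_right m n) φ, mk_eq_mk] at h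
  exact (pf_lift (le_max_right m n)).1 (pf_eq_mp h ((pf_lift _).2 H))

/-- Derivations are sound in the model. -/
theorem tr_of_pf {Γ : Ctx} {φ : Fm Γ} (h : Pf [] φ) (ρ : Env Γ₀ Γ) : Tr (eval φ ρ) := by
  obtain ⟨n, σ, hσ⟩ := ρ.exists_rep
  rw [eval_eq _ _ σ hσ, tr_mk]
  exact h.sub σ (by simp)

theorem tr_imp {Γ : Ctx} {φ ψ : Fm Γ} {ρ : Env Γ₀ Γ} (h : Tr (eval (φ →ₒ ψ) ρ))
    (h' : Tr (eval φ ρ)) : Tr (eval ψ ρ) := by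
  obtain ⟨n, σ, hσ⟩ := ρ.exists_rep
  rw [eval_eq _ _ σ hσ, tr_mk] at *
  exact .impE h h'

/-- The fresh variables are generic. -/
theorem tr_all {Γ : Ctx} {C : Ty} [Inhab Γ₀ C] {φ : Fm (C :: Γ)} {ρ : Env Γ₀ Γ} :
    Tr (eval (.all φ) ρ) ↔ ∀ x, Tr (eval φ (x ∷ ρ)) := by
  constructor
  · intro h x
    have : Pf [] ((Tm.all φ).wk (B := C) →ₒ φ) := by
      refine .impI ?_
      have := Derivable.allE (T := {ψ | Postulate ψ}) (Φ := [(Tm.all φ).wk (B := C)])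
        (φ := φ.ren (Ren.lift fun x => .there x)) (.var .here) (.hyp (by simp [Tm.wk, Tm.ren]))
      rwa [Tm.inst, Tm.sub_ren, Tm.sub_ext (τ := fun x => .var x) (fun x => by cases x <;> rfl),
        Tm.sub_var] at this
    refine tr_imp (tr_of_pf this (x ∷ ρ)) ?_
    rwa [eval_wk]
  · intro h
    obtain ⟨n, σ, hσ⟩ := ρ.exists_rep
    -- The `m`-th fresh variable has type `C` and does not occur in the names used by `σ`. The
    -- hypothesis at this one element is therefore a derivation with an eigenvariable, to which
    -- ∀-introduction applies.
    obtain ⟨m, hnm, rfl⟩ := exists_genTy Γ₀ C n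
    rw [eval_eq _ _ (fun x => lift hnm (σ x)) (fun x => by rw [mk_lift, hσ]), tr_mk]
    refine .allI ?_
    have := h (mk (m + 1) (show Tm (stage Γ₀ (m + 1)) (genTy Γ₀ m) from .var .here))
    rwa [eval_eq (n := m + 1) _ _ (Sub.lift fun x => lift hnm (σ x)), tr_mk] at this
    intro A x
    cases x with
    | here => rfl
    | there x =>
      refine (congrArg (mk (m + 1)) (lift_succ _).symm).trans ?_
      rw [mk_lift, mk_lift, hσ]
      rfl

/-- Elements are classes of terms modulo provable equality, so the equational rules of the calculus
turn into genuine equations between elements. -/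
theorem eval_ext {Γ : Ctx} {A : Ty} {s t : Tm Γ A} {ρ : Env Γ₀ Γ} :
    eval s ρ = eval t ρ ↔ Tr (eval (s =ₒ t) ρ) := by
  obtain ⟨n, σ, hσ⟩ := ρ.exists_rep
  rw [eval_eq _ _ σ hσ, eval_eq _ _ σ hσ, eval_eq _ _ σ hσ, mk_eq_mk, tr_mk]
  rfl

theorem eval_of_pf {Γ : Ctx} {A : Ty} {s t : Tm Γ A} (h : Pf [] (s =ₒ t)) (ρ : Env Γ₀ Γ) :
    eval s ρ = eval t ρ := eval_ext.2 (tr_of_pf h ρ)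

end SynthComp

namespace SynthComp

/-! ### Operations of the model -/

abbrev v0 {Γ : Ctx} {A : Ty} : Tm (A :: Γ) A := .var .here
abbrev v1 {Γ : Ctx} {A B : Ty} : Tm (B :: A :: Γ) A := .var (.there .here)
abbrev v2 {Γ : Ctx} {A B C : Ty} : Tm (C :: B :: A :: Γ) A := .var (.there (.there .here))
abbrev v3 {Γ : Ctx} {A B C D : Ty} : Tm (D :: C :: B :: A :: Γ) A :=
  .var (.there (.there (.there .here)))
abbrev v4 {Γ : Ctx} {A B C D E : Ty} : Tm (E :: D :: C :: B :: A :: Γ) A :=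
  .var (.there (.there (.there (.there .here))))
abbrev v5 {Γ : Ctx} {A B C D E F : Ty} : Tm (F :: E :: D :: C :: B :: A :: Γ) A :=
  .var (.there (.there (.there (.there (.there .here)))))

/-- The empty substitution. -/
def Sub.nil {Δ : Ctx} : Sub [] Δ := fun x => nomatch x

/-- Extension of a substitution. -/
def Sub.cons {Γ Δ : Ctx} {B : Ty} (s : Tm Δ B) (σ : Sub Γ Δ) : Sub (B :: Γ) Δ
  | _, .here => s
  | _, .there x => σ x

variable {Γ₀ Γ : Ctx} {A B C : Ty}

theorem Env.eq_nil (ρ : Env Γ₀ []) : ρ = Env.nil := by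
  funext A x
  exact nomatch x

theorem eval_sub_nil (t : Tm [] C) (ρ : Env Γ₀ Γ) : eval (t.sub Sub.nil) ρ = eval t Env.nil := by
  rw [eval_sub, Env.eq_nil fun _ _ => _]

theorem eval_closed (t : Tm [] A) (ρ : Env Γ₀ Γ) : eval t.closed ρ = eval t Env.nil := by
  rw [Tm.closed, Tm.ren_eq_sub, eval_sub, Env.eq_nil fun _ _ => _]

theorem env_sub_cons {Δ : Ctx} (s : Tm Δ B) (σ : Sub Γ Δ) (ρ : Env Γ₀ Δ) :
    (fun _ x => eval (Sub.cons s σ x) ρ : Env Γ₀ (B :: Γ)) =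
      eval s ρ ∷ (fun _ x => eval (σ x) ρ) := by
  funext A x
  cases x <;> rfl

theorem eval_sub₁ (t : Tm [B] A) (s : Tm Γ B) (ρ : Env Γ₀ Γ) :
    eval (t.sub (Sub.cons s Sub.nil)) ρ = eval t (eval s ρ ∷ Env.nil) := by
  rw [eval_sub, env_sub_cons, Env.eq_nil fun _ _ => _]

theorem eval_sub₂ {B₁ B₂ : Ty} (t : Tm [B₂, B₁] A) (s₁ : Tm Γ B₁) (s₂ : Tm Γ B₂) (ρ : Env Γ₀ Γ) :
    eval (t.sub (Sub.cons s₂ (Sub.cons s₁ Sub.nil))) ρ =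
      eval t (eval s₂ ρ ∷ eval s₁ ρ ∷ Env.nil) := by
  rw [eval_sub, env_sub_cons, env_sub_cons, Env.eq_nil fun _ _ => _]

theorem eval_sub₃ {B₁ B₂ B₃ : Ty} (t : Tm [B₃, B₂, B₁] A) (s₁ : Tm Γ B₁) (s₂ : Tm Γ B₂)
    (s₃ : Tm Γ B₃) (ρ : Env Γ₀ Γ) :
    eval (t.sub (Sub.cons s₃ (Sub.cons s₂ (Sub.cons s₁ Sub.nil)))) ρ =
      eval t (eval s₃ ρ ∷ eval s₂ ρ ∷ eval s₁ ρ ∷ Env.nil) := by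
  rw [eval_sub, env_sub_cons, env_sub_cons, env_sub_cons, Env.eq_nil fun _ _ => _]

namespace Dom

/-- Application. -/
noncomputable def app (f : Dom Γ₀ (A ⇒ₜ B)) (x : Dom Γ₀ A) : Dom Γ₀ B :=
  eval (v1 ⬝ v0) (x ∷ f ∷ Env.nil)

/-- Pairing. -/
noncomputable def pair (x : Dom Γ₀ A) (y : Dom Γ₀ B) : Dom Γ₀ (A ×ₜ B) :=
  eval (.pair v1 v0) (y ∷ x ∷ Env.nil)

/-- First projection. -/
noncomputable def fst (x : Dom Γ₀ (A ×ₜ B)) : Dom Γ₀ A := eval (.fst v0) (x ∷ Env.nil)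

/-- Second projection. -/
noncomputable def snd (x : Dom Γ₀ (A ×ₜ B)) : Dom Γ₀ B := eval (.snd v0) (x ∷ Env.nil)

/-- Zero. -/
noncomputable def zero : Dom Γ₀ .nat := eval .zero Env.nil

/-- Successor. -/
noncomputable def succ (x : Dom Γ₀ .nat) : Dom Γ₀ .nat := eval (.succ v0) (x ∷ Env.nil)

/-- Primitive recursion. -/
noncomputable def natrec (z : Dom Γ₀ A) (s : Dom Γ₀ (.nat ⇒ₜ A ⇒ₜ A)) (n : Dom Γ₀ .nat) :
    Dom Γ₀ A := eval (.natrec v2 v1 v0) (n ∷ s ∷ z ∷ Env.nil)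

/-- Internal equality. -/
noncomputable def eq (x y : Dom Γ₀ A) : Dom Γ₀ .prop := eval (v1 =ₒ v0) (y ∷ x ∷ Env.nil)

/-- Falsity. -/
noncomputable def bot : Dom Γ₀ .prop := eval .bot Env.nil

/-- Conjunction. -/
noncomputable def and (x y : Dom Γ₀ .prop) : Dom Γ₀ .prop := eval (v1 ∧ₒ v0) (y ∷ x ∷ Env.nil)

/-- Disjunction. -/
noncomputable def or (x y : Dom Γ₀ .prop) : Dom Γ₀ .prop := eval (v1 ∨ₒ v0) (y ∷ x ∷ Env.nil)

/-- Implication. -/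
noncomputable def imp (x y : Dom Γ₀ .prop) : Dom Γ₀ .prop := eval (v1 →ₒ v0) (y ∷ x ∷ Env.nil)

/-- Negation. -/
noncomputable abbrev not (x : Dom Γ₀ .prop) : Dom Γ₀ .prop := imp x bot

end Dom

infixl:90 " ⬝ᵈ " => Dom.app
infix:50 " ≐ " => Dom.eq
infixr:40 " ∧ᵈ " => Dom.and
infixr:39 " ∨ᵈ " => Dom.or
infixr:38 " ⇨ᵈ " => Dom.imp

section

variable (ρ : Env Γ₀ Γ)

@[simp] theorem eval_app (f : Tm Γ (A ⇒ₜ B)) (t : Tm Γ A) :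
    eval (f ⬝ t) ρ = eval f ρ ⬝ᵈ eval t ρ := eval_sub₂ (v1 ⬝ v0) f t ρ

@[simp] theorem eval_pair (s : Tm Γ A) (t : Tm Γ B) :
    eval (.pair s t) ρ = .pair (eval s ρ) (eval t ρ) := eval_sub₂ (.pair v1 v0) s t ρ

@[simp] theorem eval_fst (t : Tm Γ (A ×ₜ B)) : eval (.fst t) ρ = (eval t ρ).fst :=
  eval_sub₁ (.fst v0) t ρ

@[simp] theorem eval_snd (t : Tm Γ (A ×ₜ B)) : eval (.snd t) ρ = (eval t ρ).snd :=
  eval_sub₁ (.snd v0) t ρ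

@[simp] theorem eval_zero : eval .zero ρ = Dom.zero := eval_sub_nil .zero ρ

@[simp] theorem eval_succ (t : Tm Γ .nat) : eval (.succ t) ρ = (eval t ρ).succ :=
  eval_sub₁ (.succ v0) t ρ

@[simp] theorem eval_natrec (z : Tm Γ A) (s : Tm Γ (.nat ⇒ₜ A ⇒ₜ A)) (n : Tm Γ .nat) :
    eval (.natrec z s n) ρ = .natrec (eval z ρ) (eval s ρ) (eval n ρ) :=
  eval_sub₃ (.natrec v2 v1 v0) z s n ρ

@[simp] theorem eval_eqₒ (s t : Tm Γ A) : eval (s =ₒ t) ρ = (eval s ρ ≐ eval t ρ) :=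
  eval_sub₂ (v1 =ₒ v0) s t ρ

@[simp] theorem eval_bot : eval .bot ρ = Dom.bot := eval_sub_nil .bot ρ

@[simp] theorem eval_and (φ ψ : Fm Γ) : eval (φ ∧ₒ ψ) ρ = (eval φ ρ ∧ᵈ eval ψ ρ) :=
  eval_sub₂ (v1 ∧ₒ v0) φ ψ ρ

@[simp] theorem eval_or (φ ψ : Fm Γ) : eval (φ ∨ₒ ψ) ρ = (eval φ ρ ∨ᵈ eval ψ ρ) :=
  eval_sub₂ (v1 ∨ₒ v0) φ ψ ρ

@[simp] theorem eval_imp (φ ψ : Fm Γ) : eval (φ →ₒ ψ) ρ = (eval φ ρ ⇨ᵈ eval ψ ρ) :=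
  eval_sub₂ (v1 →ₒ v0) φ ψ ρ

@[simp] theorem eval_ren_lift (t : Tm (A :: Γ) B) (x : Dom Γ₀ A) (c : Dom Γ₀ C) :
    eval (t.ren (Ren.lift fun y => .there y)) (x ∷ c ∷ ρ) = eval t (x ∷ ρ) := by
  rw [Tm.ren_eq_sub, eval_sub]
  congr 1
  funext A y
  cases y <;> simp [Ren.lift]

@[simp] theorem app_lam (t : Tm (A :: Γ) B) (x : Dom Γ₀ A) :
    eval (.lam t) ρ ⬝ᵈ x = eval t (x ∷ ρ) := by
  -- The element `x` need not be named by a term over `Γ`, so β is used with a new variable as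
  -- argument, and this variable is assigned the value `x`.
  have := eval_of_pf (Derivable.beta (t.ren (Ren.lift fun y => .there y)) (.var .here)) (x ∷ ρ)
  rw [eval_app, eval_inst] at this
  rwa [show Tm.lam (t.ren (Ren.lift fun y => .there y)) = (Tm.lam t).wk from rfl, eval_wk,
    eval_var, Env.cons_here, eval_ren_lift] at this

end

@[simp] theorem Dom.fst_pair (x : Dom Γ₀ A) (y : Dom Γ₀ B) : (Dom.pair x y).fst = x := by
  simpa using eval_of_pf (Derivable.fstPair v1 v0) (y ∷ x ∷ Env.nil)

@[simp] theorem Dom.snd_pair (x : Dom Γ₀ A) (y : Dom Γ₀ B) : (Dom.pair x y).snd = y := by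
  simpa using eval_of_pf (Derivable.sndPair v1 v0) (y ∷ x ∷ Env.nil)

@[simp] theorem Dom.pair_eta (x : Dom Γ₀ (A ×ₜ B)) : Dom.pair x.fst x.snd = x := by
  simpa using eval_of_pf (Derivable.pairEta v0) (x ∷ Env.nil)

@[simp] theorem Dom.natrec_zero (z : Dom Γ₀ A) (s : Dom Γ₀ (.nat ⇒ₜ A ⇒ₜ A)) :
    Dom.natrec z s .zero = z := by
  simpa using eval_of_pf (Derivable.natrecZero v1 v0) (s ∷ z ∷ Env.nil)

@[simp] theorem Dom.natrec_succ (z : Dom Γ₀ A) (s : Dom Γ₀ (.nat ⇒ₜ A ⇒ₜ A)) (n : Dom Γ₀ .nat) :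
    Dom.natrec z s n.succ = s ⬝ᵈ n ⬝ᵈ Dom.natrec z s n := by
  simpa using eval_of_pf (Derivable.natrecSucc v2 v1 v0) (n ∷ s ∷ z ∷ Env.nil)

/-! ### Forcing -/

/-- The truth value `p` entails the truth value `a`. -/
def Forces (p a : Dom Γ₀ .prop) : Prop := Tr (p ⇨ᵈ a)

infix:37 " ⊩ " => Forces

theorem tr_of_pf_list {Φ : List (Fm Γ)} {φ : Fm Γ} (h : Pf Φ φ) {ρ : Env Γ₀ Γ}
    (hΦ : ∀ ψ ∈ Φ, Tr (eval ψ ρ)) : Tr (eval φ ρ) := by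
  induction Φ generalizing φ with
  | nil => exact tr_of_pf h ρ
  | cons ψ Φ ih =>
    simp only [List.forall_mem_cons] at hΦ
    exact tr_imp (ih (.impI h) hΦ.2) hΦ.1

theorem pf_cut {Φ Ψ : List (Fm Γ)} {φ : Fm Γ} (h : Pf Φ φ) (hΦ : ∀ ψ ∈ Φ, Pf Ψ ψ) : Pf Ψ φ := by
  induction Φ generalizing φ with
  | nil => exact h.mono (by simp)
  | cons ψ Φ ih =>
    simp only [List.forall_mem_cons] at hΦ
    exact .impE (ih (.impI h) hΦ.2) hΦ.1

/-- Prefixing hypotheses and conclusion by a propositional variable with value `p` keeps the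
derivation valid. Rules of the calculus are transferred to forcing through this lemma. -/
theorem forces_of_pf {Φ : List (Fm Γ)} {φ : Fm Γ} (h : Pf Φ φ) {ρ : Env Γ₀ Γ} {p : Dom Γ₀ .prop}
    (hΦ : ∀ ψ ∈ Φ, p ⊩ eval ψ ρ) : p ⊩ eval φ ρ := by
  have key : Pf (Φ.map fun ψ => v0 →ₒ ψ.wk) (v0 →ₒ φ.wk (B := .prop)) := by
    refine .impI (pf_cut (Φ := Φ.map Tm.wk) ?_ ?_)
    · rw [Tm.wk, Tm.ren_eq_sub]
      refine h.sub _ (fun ψ hψ => ?_)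
      rw [← Tm.ren_eq_sub]
      exact List.mem_map_of_mem hψ
    · intro ψ hψ
      obtain ⟨θ, hθ, rfl⟩ := List.mem_map.1 hψ
      exact .impE (.hyp (List.mem_cons_of_mem _ (List.mem_map_of_mem hθ))) (.hyp (by simp))
  have := tr_of_pf_list key (ρ := p ∷ ρ) (by
    intro ψ hψ
    obtain ⟨θ, hθ, rfl⟩ := List.mem_map.1 hψ
    simpa [Forces] using hΦ θ hθ)
  simpa [Forces] using this

/-- `r` is a stronger truth value than `p`. -/
class Ext (r p : Dom Γ₀ .prop) : Prop where
  le : r ⊩ p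

theorem forces_refl (p : Dom Γ₀ .prop) : p ⊩ p := by
  simpa [Forces] using tr_of_pf (φ := v0 →ₒ v0) (.impI (.hyp (by simp))) (p ∷ Env.nil)

theorem forces_trans {p q r : Dom Γ₀ .prop} (h : p ⊩ q) (h' : q ⊩ r) : p ⊩ r := by
  have : Pf [v2 →ₒ v1, v1 →ₒ v0] (v2 →ₒ v0 : Fm [.prop, .prop, .prop]) :=
    .impI (.impE (φ := v1) (.hyp (by simp)) (.impE (φ := v2) (.hyp (by simp)) (.hyp (by simp))))
  simpa [Forces] using tr_of_pf_list this (ρ := r ∷ q ∷ p ∷ Env.nil) (by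
    simpa using (show Tr (p ⇨ᵈ q) ∧ Tr (q ⇨ᵈ r) from ⟨h, h'⟩))

instance (p : Dom Γ₀ .prop) : Ext p p := ⟨forces_refl p⟩
-- Transitivity as an instance: successive strengthenings are composed automatically whenever a
-- forced statement is moved along them.
set_option synthInstance.checkSynthOrder false in
instance (priority := low) {p q r : Dom Γ₀ .prop} [h : Ext p q] [h' : Ext q r] : Ext p r :=
  ⟨forces_trans h.le h'.le⟩

theorem Forces.up {r p a : Dom Γ₀ .prop} [h : Ext r p] (ha : p ⊩ a) : r ⊩ a := forces_trans h.le ha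

set_option synthInstance.checkSynthOrder false in
instance {r p a : Dom Γ₀ .prop} [Ext r p] : Coe (p ⊩ a) (r ⊩ a) := ⟨fun h => h.up⟩

/-- Local existence: a witness exists after strengthening `p`, as far as truth values can tell. -/
def LEx (p : Dom Γ₀ .prop) (P : Dom Γ₀ .prop → Dom Γ₀ A → Prop) : Prop :=
  ∀ c, (∀ r (_ : Ext r p) x, P r x → r ⊩ c) → p ⊩ c

/-- Local disjunction. -/
def LOr (p : Dom Γ₀ .prop) (P Q : Dom Γ₀ .prop → Prop) : Prop :=
  ∀ c, (∀ r (_ : Ext r p), P r → r ⊩ c) → (∀ r (_ : Ext r p), Q r → r ⊩ c) → p ⊩ c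

section

variable {p q r a b c : Dom Γ₀ .prop} {ρ : Env Γ₀ Γ}

theorem LEx.elim {P : Dom Γ₀ .prop → Dom Γ₀ A → Prop} (h : LEx p P)
    (k : ∀ r (_ : Ext r p) x, P r x → r ⊩ c) : p ⊩ c := h c k

theorem LEx.intro {P : Dom Γ₀ .prop → Dom Γ₀ A → Prop} (x : Dom Γ₀ A) (h : P p x) : LEx p P :=
  fun _ k => k p inferInstance x h

theorem LEx.bind {P : Dom Γ₀ .prop → Dom Γ₀ A → Prop} {Q : Dom Γ₀ .prop → Dom Γ₀ B → Prop}
    (h : LEx p P) (k : ∀ r (_ : Ext r p) x, P r x → LEx r Q) : LEx p Q :=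
  fun _ l => h.elim fun r hr x hx => (k r hr x hx).elim fun s _ y hy => l s inferInstance y hy

theorem LOr.elim {P Q : Dom Γ₀ .prop → Prop} (h : LOr p P Q)
    (k : ∀ r (_ : Ext r p), P r → r ⊩ c) (l : ∀ r (_ : Ext r p), Q r → r ⊩ c) : p ⊩ c := h c k l

theorem LOr.inl {P Q : Dom Γ₀ .prop → Prop} (h : P p) : LOr p P Q :=
  fun _ k _ => k p inferInstance h

theorem LOr.inr {P Q : Dom Γ₀ .prop → Prop} (h : Q p) : LOr p P Q :=
  fun _ _ k => k p inferInstance h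

theorem LOr.bind {P Q : Dom Γ₀ .prop → Prop} {R : Dom Γ₀ .prop → Dom Γ₀ A → Prop} (h : LOr p P Q)
    (k : ∀ r (_ : Ext r p), P r → LEx r R) (l : ∀ r (_ : Ext r p), Q r → LEx r R) : LEx p R :=
  fun _ m => h.elim (fun r hr h => (k r hr h).elim fun s _ y hy => m s inferInstance y hy)
    (fun r hr h => (l r hr h).elim fun s _ y hy => m s inferInstance y hy)

theorem forces_top : p ⊩ .imp .bot .bot := by
  simpa using forces_of_pf (Γ₀ := Γ₀) (Φ := []) (φ := .bot →ₒ .bot) (.impI (.hyp (by simp)))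
    (ρ := Env.nil) (p := p) (by simp)

@[simp] theorem forces_and : p ⊩ a ∧ᵈ b ↔ p ⊩ a ∧ p ⊩ b := by
  refine ⟨fun h => ⟨?_, ?_⟩, fun h => ?_⟩
  · simpa using forces_of_pf (.andE₁ (.hyp (List.mem_singleton.2 rfl)) : Pf [v1 ∧ₒ v0] v1)
      (ρ := b ∷ a ∷ Env.nil) (p := p) (by simpa using h)
  · simpa using forces_of_pf (.andE₂ (.hyp (List.mem_singleton.2 rfl)) : Pf [v1 ∧ₒ v0] v0)
      (ρ := b ∷ a ∷ Env.nil) (p := p) (by simpa using h)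
  · simpa using forces_of_pf (.andI (.hyp (by simp)) (.hyp (by simp)) : Pf [v1, v0] (v1 ∧ₒ v0))
      (ρ := b ∷ a ∷ Env.nil) (p := p) (by simpa using h)

theorem Forces.mp (h : p ⊩ a ⇨ᵈ b) (h' : p ⊩ a) : p ⊩ b := by
  simpa using forces_of_pf (.impE (φ := v1) (.hyp (by simp)) (.hyp (by simp)) :
    Pf [v1 →ₒ v0, v1] v0) (ρ := b ∷ a ∷ Env.nil) (p := p) (by simpa using And.intro h h')

instance : Ext (p ∧ᵈ a) p := ⟨(forces_and.1 (forces_refl _)).1⟩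

theorem forces_and_right (p a : Dom Γ₀ .prop) : p ∧ᵈ a ⊩ a := (forces_and.1 (forces_refl _)).2

/-- Only `r = p ∧ᵈ a` is consulted: it is the weakest strengthening of `p` at which `a` is forced.
-/
theorem Forces.intro (h : ∀ r (_ : Ext r p), r ⊩ a → r ⊩ b) : p ⊩ a ⇨ᵈ b := by
  have h := h (p ∧ᵈ a) inferInstance (forces_and_right p a)
  have key : Pf [v2 ∧ₒ v1 →ₒ v0] (v2 →ₒ v1 →ₒ v0 : Fm [.prop, .prop, .prop]) :=
    .impI (.impI (.impE (φ := v2 ∧ₒ v1) (.hyp (by simp))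
      (.andI (.hyp (by simp)) (.hyp (by simp)))))
  simpa [Forces] using tr_of_pf_list key (ρ := b ∷ a ∷ p ∷ Env.nil) (by simpa [Forces] using h)

@[simp] theorem forces_imp : p ⊩ a ⇨ᵈ b ↔ ∀ r [Ext r p], r ⊩ a → r ⊩ b :=
  ⟨fun h _ _ h' => h.up.mp h', fun h => .intro fun r _ => h r⟩

-- The formulas `p → ∀ φ` and `∀ (p → φ)` are interderivable, and `tr_all` applies to the second.
-- The domains are constant, so no passage to stronger truth values occurs.
@[simp] theorem forces_all [Inhab Γ₀ C] {φ : Fm (C :: Γ)} :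
    p ⊩ eval (.all φ) ρ ↔ ∀ x, p ⊩ eval φ (x ∷ ρ) := by
  have key : p ⊩ eval (.all φ) ρ ↔ Tr (eval (.all (v1 →ₒ φ.ren (Ren.lift fun x => .there x)))
      (p ∷ ρ)) := by
    have e : (p ⇨ᵈ eval (.all φ) ρ) = eval (v0 →ₒ (Tm.all φ).wk) (p ∷ ρ) := by simp
    rw [Forces, e]
    have inst : ∀ {Γ : Ctx} (φ : Fm (C :: Γ)),
        (φ.ren (Ren.lift fun x => .there x)).inst (.var .here) = φ := by
      intro Γ φ
      rw [Tm.inst, Tm.sub_ren, Tm.sub_ext (τ := fun x => .var x) (fun x => by cases x <;> rfl),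
        Tm.sub_var]
    constructor <;> intro h
    · refine tr_of_pf_list (Φ := [v0 →ₒ (Tm.all φ).wk]) (.allI (.impI ?_)) (by simpa using h)
      have : Pf [v1, (v0 →ₒ (Tm.all φ).wk (B := .prop)).wk (B := C)] (Tm.all φ).wk.wk :=
        .impE (φ := v1) (.hyp (by simp [Tm.wk, Tm.ren])) (.hyp (by simp))
      have := Derivable.allE (T := {ψ | Postulate ψ}) (.var .here) this
      rwa [inst] at this
    · refine tr_of_pf_list (Φ := [Tm.all (v1 →ₒ φ.ren (Ren.lift fun x => .there x))])
        (.impI (.allI ?_)) (by simpa using h)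
      have : Pf ([v0, Tm.all (v1 →ₒ φ.ren (Ren.lift fun x => .there x))].map (Tm.wk (B := C)))
        (v1 →ₒ φ.ren (Ren.lift fun x => .there x)) := by
        have := Derivable.allE (T := {ψ | Postulate ψ}) (.var .here) (.hyp (List.mem_map_of_mem
          (f := Tm.wk (B := C)) (List.mem_cons_of_mem v0 (List.mem_singleton.2
            (rfl : Tm.all (v1 →ₒ φ.ren (Ren.lift fun x => .there x)) = _)))))
        rwa [inst] at this
      exact .impE this (.hyp (by simp [Tm.wk, Tm.ren]))
  rw [key, tr_all]
  simp only [eval_imp, eval_var, Env.cons_there, Env.cons_here, eval_ren_lift, Forces]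

theorem forces_exI {φ : Fm (A :: Γ)} (x : Dom Γ₀ A) (h : p ⊩ eval φ (x ∷ ρ)) :
    p ⊩ eval (.ex φ) ρ := by
  have key : Pf [φ] (Tm.ex φ).wk := by
    refine .exI (.var .here) (.hyp ?_)
    rw [Tm.inst, Tm.sub_ren, Tm.sub_ext (τ := fun x => .var x) (fun x => by cases x <;> rfl),
      Tm.sub_var]
    simp
  simpa using forces_of_pf key (ρ := x ∷ ρ) (p := p) (by simpa using h)

/-- The continuation `k`, taken at all elements, amounts to `p ⊩ ∀ x, φ → c`, from which
∃-elimination yields `c`. No witness is ever extracted; a truth value is the only possible target.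
-/
theorem forces_exE [Inhab Γ₀ A] {φ : Fm (A :: Γ)} (h : p ⊩ eval (.ex φ) ρ)
    (k : ∀ r (_ : Ext r p) x, r ⊩ eval φ (x ∷ ρ) → r ⊩ c) : p ⊩ c := by
  have k' : p ⊩ eval (.all (φ.ren (Ren.lift fun y => .there y) →ₒ v1)) (c ∷ ρ) := by
    rw [forces_all]
    intro x
    rw [eval_imp, eval_ren_lift]
    exact .intro fun r hr h => by simpa using k r hr x h
  have key : Pf [(Tm.ex φ).wk, .all (φ.ren (Ren.lift fun y => .there y) →ₒ v1)]
      (v0 : Fm (.prop :: Γ)) := by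
    refine .exE (A := A) (φ := φ.ren (Ren.lift fun y => .there y)) (.hyp (by simp [Tm.wk, Tm.ren])) ?_
    have := Derivable.allE (T := {ψ | Postulate ψ}) (.var .here) (.hyp (List.mem_cons_of_mem
      (φ.ren (Ren.lift fun y => .there y)) (List.mem_map_of_mem (f := Tm.wk (B := A))
        (List.mem_cons_of_mem (Tm.ex φ).wk (List.mem_singleton.2
        (rfl : Tm.all (φ.ren (Ren.lift fun y => .there y) →ₒ v1) = _))))))
    refine .impE (φ := φ.ren (Ren.lift fun y => .there y)) ?_ (.hyp (by simp))
    simp only [Tm.inst, Tm.sub_ren, Tm.sub, Tm.ren] at this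
    rw [Tm.sub_ext (τ := fun x => .var (Ren.lift (fun y => .there y) x))
      (fun x => by cases x <;> rfl), ← Tm.ren_eq_sub] at this
    exact this
  simpa using forces_of_pf key (ρ := c ∷ ρ) (p := p) (by simpa using And.intro h (by simpa using k'))

@[simp] theorem forces_ex [Inhab Γ₀ A] {φ : Fm (A :: Γ)} :
    p ⊩ eval (.ex φ) ρ ↔ LEx p fun r x => r ⊩ eval φ (x ∷ ρ) :=
  ⟨fun h _ => forces_exE h, fun h => h.elim fun _ _ x hx => forces_exI x hx⟩

@[simp] theorem forces_or : p ⊩ a ∨ᵈ b ↔ LOr p (fun r => r ⊩ a) (fun r => r ⊩ b) := by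
  constructor
  · intro h c k l
    have key : Pf [v2 ∨ₒ v1, v2 →ₒ v0, v1 →ₒ v0] (v0 : Fm [.prop, .prop, .prop]) :=
      .orE (φ := v2) (ψ := v1) (.hyp (by simp)) (.impE (φ := v2) (.hyp (by simp)) (.hyp (by simp)))
        (.impE (φ := v1) (.hyp (by simp)) (.hyp (by simp)))
    simpa using forces_of_pf key (ρ := c ∷ b ∷ a ∷ Env.nil) (p := p) (by
      simpa only [List.forall_mem_cons, List.not_mem_nil, eval_or, eval_imp, eval_var,
        Env.cons_here, Env.cons_there, false_imp_iff, implies_true, and_true] using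
        And.intro h (And.intro (Forces.intro k) (Forces.intro l)))
  · intro h
    refine h.elim (fun r _ h => ?_) (fun r _ h => ?_)
    · simpa using forces_of_pf (.orI₁ (.hyp (by simp)) : Pf [v1] (v1 ∨ₒ v0))
        (ρ := b ∷ a ∷ Env.nil) (p := r) (by simpa using h)
    · simpa using forces_of_pf (.orI₂ (.hyp (by simp)) : Pf [v0] (v1 ∨ₒ v0))
        (ρ := b ∷ a ∷ Env.nil) (p := r) (by simpa using h)

theorem forces_inl (h : p ⊩ a) : p ⊩ a ∨ᵈ b := forces_or.2 (.inl h)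

theorem forces_inr (h : p ⊩ b) : p ⊩ a ∨ᵈ b := forces_or.2 (.inr h)

theorem Forces.orElim (h : p ⊩ a ∨ᵈ b) (k : ∀ r (_ : Ext r p), r ⊩ a → r ⊩ c)
    (l : ∀ r (_ : Ext r p), r ⊩ b → r ⊩ c) : p ⊩ c := (forces_or.1 h).elim k l

theorem Forces.absurd (h : p ⊩ Dom.bot) : p ⊩ a := by
  simpa using forces_of_pf (.botE (.hyp (by simp)) : Pf [.bot] v0)
    (ρ := a ∷ Env.nil) (p := p) (by simpa using h)

/-! ### Internal equality -/

theorem forces_rfl (x : Dom Γ₀ A) : p ⊩ x ≐ x := by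
  simpa using forces_of_pf (.eqI v0 : Pf [] _) (ρ := x ∷ Env.nil) (p := p) (by simp)

/-- Leibniz's rule is derived once with variables for the predicate and both elements, and then
evaluated at `λ φ`, `x` and `y`, which need not be terms over a common context. -/
theorem forces_subst (φ : Fm (A :: Γ)) (ρ : Env Γ₀ Γ) {x y : Dom Γ₀ A} (h : p ⊩ x ≐ y)
    (hx : p ⊩ eval φ (x ∷ ρ)) : p ⊩ eval φ (y ∷ ρ) := by
  have key : Pf [v1 ⬝ v2 , v2 =ₒ v0] (v1 ⬝ v0 : Fm [A, A ⇒ₜ .prop, A]) := by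
    have := Derivable.eqE (T := {ψ | Postulate ψ}) (Γ := [A, A ⇒ₜ .prop, A])
      (Φ := [v1 ⬝ v2 , v2 =ₒ v0]) (s := v2) (t := v0) (v2 ⬝ v0)
      (.hyp (by simp)) (.hyp (by simp [Tm.inst, Tm.sub, Sub.single]))
    exact this
  simpa using forces_of_pf key (ρ := y ∷ eval (.lam φ) ρ ∷ x ∷ Env.nil) (p := p)
    (by simpa using And.intro hx h)

theorem Forces.symm {x y : Dom Γ₀ A} (h : p ⊩ x ≐ y) : p ⊩ y ≐ x := by
  simpa using forces_subst (v0 =ₒ v1) (x ∷ Env.nil) h (by simpa using forces_rfl x)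

theorem Forces.trans {x y z : Dom Γ₀ A} (h : p ⊩ x ≐ y) (h' : p ⊩ y ≐ z) : p ⊩ x ≐ z := by
  simpa using forces_subst (v1 =ₒ v0) (x ∷ Env.nil) h' (by simpa using h)

/-- Congruence for a definable operation. -/
theorem forces_congr (t : Tm (A :: Γ) B) (ρ : Env Γ₀ Γ) {x y : Dom Γ₀ A} (h : p ⊩ x ≐ y) :
    p ⊩ eval t (x ∷ ρ) ≐ eval t (y ∷ ρ) := by
  simpa using forces_subst (v1 =ₒ t.ren (Ren.lift fun y => .there y)) (eval t (x ∷ ρ) ∷ ρ) h (by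
    simpa using forces_rfl _)

theorem Forces.app_congr {f g : Dom Γ₀ (A ⇒ₜ B)} {x y : Dom Γ₀ A} (h : p ⊩ f ≐ g)
    (h' : p ⊩ x ≐ y) : p ⊩ f ⬝ᵈ x ≐ g ⬝ᵈ y := by
  have h₁ : p ⊩ f ⬝ᵈ x ≐ g ⬝ᵈ x := by
    simpa using forces_subst (v2 ⬝ v1 =ₒ v0 ⬝ v1) (x ∷ f ∷ Env.nil) h
      (by simpa using forces_rfl (f ⬝ᵈ x))
  simpa using forces_subst (v3 ⬝ v1 =ₒ v2 ⬝ v0) (x ∷ g ∷ f ∷ Env.nil) h' (by simpa using h₁)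

theorem Forces.eq_mp (h : p ⊩ a ≐ b) (h' : p ⊩ a) : p ⊩ b := by
  simpa using forces_subst v0 Env.nil h (by simpa using h')

end

theorem tr_of_forces {a : Dom Γ₀ .prop} (h : ∀ p, p ⊩ a) : Tr a := by
  have key : Tr (Dom.imp Dom.bot Dom.bot : Dom Γ₀ .prop) := by
    simpa using tr_of_pf (.impI (.hyp (by simp)) : Pf [] (.bot →ₒ .bot)) (Env.nil (Γ₀ := Γ₀))
  have := tr_imp (φ := v0) (ψ := v1) (ρ := (Dom.imp Dom.bot Dom.bot) ∷ a ∷ Env.nil)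
    (by simpa [Forces] using h (.imp .bot .bot)) (by simpa using key)
  simpa using this

theorem Dom.eq_iff {x y : Dom Γ₀ A} : x = y ↔ ∀ p, p ⊩ x ≐ y := by
  refine ⟨fun h p => h ▸ forces_rfl x, fun h => ?_⟩
  simpa using (eval_ext (s := v1) (t := v0) (ρ := y ∷ x ∷ Env.nil)).2
    (by simpa using tr_of_forces h)

section

variable {p : Dom Γ₀ .prop}

theorem forces_funext [Inhab Γ₀ A] {f g : Dom Γ₀ (A ⇒ₜ B)} (h : ∀ x, p ⊩ f ⬝ᵈ x ≐ g ⬝ᵈ x) :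
    p ⊩ f ≐ g := by
  have key : Pf [all_ A fun x => v2 ⬝ x =ₒ v1 ⬝ x] (v1 =ₒ v0 : Fm [A ⇒ₜ B, A ⇒ₜ B]) :=
    .funext (.hyp (by simp [Tm.wk, Tm.ren]))
  simpa using forces_of_pf key (ρ := g ∷ f ∷ Env.nil) (p := p) (by simpa using h)

theorem forces_propext {a b : Dom Γ₀ .prop} (h : ∀ r (_ : Ext r p), r ⊩ a → r ⊩ b)
    (h' : ∀ r (_ : Ext r p), r ⊩ b → r ⊩ a) : p ⊩ a ≐ b := by
  have key : Pf [iff_ v1 v0] (v1 =ₒ v0 : Fm [.prop, .prop]) := .propext (.hyp (by simp))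
  simpa using forces_of_pf key (ρ := b ∷ a ∷ Env.nil) (p := p) (by
    simp only [List.forall_mem_cons, eval_and, eval_imp, eval_var, Env.cons_here, Env.cons_there,
      forces_and]
    exact ⟨⟨.intro h, .intro h'⟩, by simp⟩)

end

end SynthComp

namespace SynthComp

variable {Γ₀ Γ : Ctx} {A B C : Ty} {p q r a b c : Dom Γ₀ .prop}

/-! ### Natural numbers -/

theorem Dom.prop_ext (h : ∀ p, p ⊩ a ↔ p ⊩ b) : a = b :=
  Dom.eq_iff.2 fun _ => forces_propext (fun r _ => (h r).1) (fun r _ => (h r).2)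

theorem Dom.funext [Inhab Γ₀ A] {f g : Dom Γ₀ (A ⇒ₜ B)} (h : ∀ x, f ⬝ᵈ x = g ⬝ᵈ x) : f = g :=
  Dom.eq_iff.2 fun _ => forces_funext fun x => h x ▸ forces_rfl _

theorem forces_of_eq {x y : Dom Γ₀ A} (h : x = y) : p ⊩ x ≐ y := h ▸ forces_rfl x

/-- Induction for a definable predicate. -/
theorem forces_ind (φ : Fm (.nat :: Γ)) (ρ : Env Γ₀ Γ) (h₀ : p ⊩ eval φ (.zero ∷ ρ))
    (hs : ∀ n r (_ : Ext r p), r ⊩ eval φ (n ∷ ρ) → r ⊩ eval φ (n.succ ∷ ρ)) (n : Dom Γ₀ .nat) :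
    p ⊩ eval φ (n ∷ ρ) := by
  have key : Pf [v0 ⬝ .zero, all_ .nat fun n => v1 ⬝ n →ₒ v1 ⬝ .succ n]
      (all_ .nat fun n => v1 ⬝ n : Fm [.nat ⇒ₜ .prop]) :=
    .induction (P := v0) (.hyp (by simp)) (.hyp (by simp [Tm.wk, Tm.ren]))
  have := forces_of_pf key (ρ := eval (.lam φ) ρ ∷ Env.nil) (p := p) (by
    simp only [List.forall_mem_cons, eval_app, eval_zero, forces_all, eval_imp, eval_succ, eval_var,
      Env.cons_here, Env.cons_there, app_lam]
    exact ⟨h₀, fun n => .intro fun r hr h => hs n r hr h, by simp⟩)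
  simpa using (forces_all.1 this) n

/-- The induction runs inside the logic, so the hypothesis of the step is only a forced equality at
an arbitrary `r`; the conclusion nevertheless is equality of elements, because it is forced
everywhere. -/
theorem Dom.eq_ind (s t : Tm (.nat :: Γ) A) (ρ : Env Γ₀ Γ)
    (h₀ : eval s (.zero ∷ ρ) = eval t (.zero ∷ ρ))
    (hs : ∀ n r, r ⊩ eval s (n ∷ ρ) ≐ eval t (n ∷ ρ) →
      r ⊩ eval s (n.succ ∷ ρ) ≐ eval t (n.succ ∷ ρ)) (n : Dom Γ₀ .nat) :
    eval s (n ∷ ρ) = eval t (n ∷ ρ) := by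
  refine Dom.eq_iff.2 fun p => ?_
  simpa using forces_ind (s =ₒ t) ρ (p := p) (by simpa using forces_of_eq h₀)
    (fun n r _ h => by simpa using hs n r (by simpa using h)) n

theorem Forces.succ {m n : Dom Γ₀ .nat} (h : p ⊩ m ≐ n) : p ⊩ m.succ ≐ n.succ := by
  simpa using forces_congr (.succ v0) Env.nil h

theorem forces_succ_inj {m n : Dom Γ₀ .nat} (h : p ⊩ m.succ ≐ n.succ) : p ⊩ m ≐ n := by
  simpa using forces_of_pf (.succInj (.hyp (by simp)) : Pf [.succ v1 =ₒ .succ v0] (v1 =ₒ v0))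
    (ρ := n ∷ m ∷ Env.nil) (p := p) (by simpa using h)

theorem forces_succ_ne_zero {n : Dom Γ₀ .nat} (h : p ⊩ n.succ ≐ .zero) : p ⊩ a := by
  have := forces_of_pf (.succNeZero v0 : Pf [] _) (ρ := n ∷ Env.nil) (p := p) (by simp)
  simp only [eval_imp, eval_eqₒ, eval_succ, eval_var, Env.cons_here, eval_zero, eval_bot] at this
  exact (this.mp h).absurd

namespace Dom

/-- Addition of natural numbers. -/
noncomputable def nadd (m n : Dom Γ₀ .nat) : Dom Γ₀ .nat := eval (natAdd v1 v0) (n ∷ m ∷ Env.nil)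

/-- Multiplication of natural numbers. -/
noncomputable def nmul (m n : Dom Γ₀ .nat) : Dom Γ₀ .nat := eval (natMul v1 v0) (n ∷ m ∷ Env.nil)

end Dom

theorem eval_natAdd' (s t : Tm Γ .nat) (ρ : Env Γ₀ Γ) :
    eval (natAdd s t) ρ = (eval s ρ).nadd (eval t ρ) := eval_sub₂ (natAdd v1 v0) s t ρ

theorem eval_natMul' (s t : Tm Γ .nat) (ρ : Env Γ₀ Γ) :
    eval (natMul s t) ρ = (eval s ρ).nmul (eval t ρ) := eval_sub₂ (natMul v1 v0) s t ρ

namespace Dom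

theorem nadd_eq (m n : Dom Γ₀ .nat) : m.nadd n =
    .natrec m (eval (.lam (.lam (.succ v0))) Env.nil) n := by
  rw [nadd, natAdd, eval_natrec]
  simp only [eval_var, Env.cons_here, Env.cons_there]
  congr 1
  exact Dom.funext fun x => Dom.funext fun y => by simp

theorem nmul_eq (m n : Dom Γ₀ .nat) : m.nmul n =
    .natrec .zero (eval (.lam (.lam (natAdd v0 v2))) (m ∷ Env.nil)) n := by
  rw [nmul, natMul, eval_natrec]
  simp only [eval_zero, eval_var, Env.cons_here]
  congr 1
  exact Dom.funext fun x => Dom.funext fun y => by simp [eval_natAdd']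

theorem nadd_zero (m : Dom Γ₀ .nat) : m.nadd .zero = m := by simp [nadd_eq]

theorem nadd_succ (m n : Dom Γ₀ .nat) : m.nadd n.succ = (m.nadd n).succ := by simp [nadd_eq]

theorem nmul_zero (m : Dom Γ₀ .nat) : m.nmul .zero = .zero := by simp [nmul_eq]

theorem nmul_succ (m n : Dom Γ₀ .nat) : m.nmul n.succ = (m.nmul n).nadd m := by
  simp [nmul_eq, eval_natAdd']

theorem zero_nadd (m : Dom Γ₀ .nat) : zero.nadd m = m := by
  have := eq_ind (natAdd .zero v0) v0 Env.nil (by simp [eval_natAdd', nadd_zero])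
    (fun n r h => by simpa [eval_natAdd', nadd_succ] using h.succ) m
  simpa [eval_natAdd'] using this

theorem succ_nadd (m n : Dom Γ₀ .nat) : m.succ.nadd n = (m.nadd n).succ := by
  have := eq_ind (natAdd (.succ v1) v0) (.succ (natAdd v1 v0)) (m ∷ Env.nil)
    (by simp [eval_natAdd', nadd_zero])
    (fun n r h => by simpa [eval_natAdd', nadd_succ] using h.succ) n
  simpa [eval_natAdd'] using this

theorem nadd_comm (m n : Dom Γ₀ .nat) : m.nadd n = n.nadd m := by
  have := eq_ind (natAdd v1 v0) (natAdd v0 v1) (m ∷ Env.nil)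
    (by simp [eval_natAdd', nadd_zero, zero_nadd])
    (fun n r h => by simpa [eval_natAdd', nadd_succ, succ_nadd] using h.succ) n
  simpa [eval_natAdd'] using this

theorem nadd_assoc (k m n : Dom Γ₀ .nat) : (k.nadd m).nadd n = k.nadd (m.nadd n) := by
  have := eq_ind (natAdd (natAdd v2 v1) v0) (natAdd v2 (natAdd v1 v0)) (m ∷ k ∷ Env.nil)
    (by simp [eval_natAdd', nadd_zero])
    (fun n r h => by simpa [eval_natAdd', nadd_succ] using h.succ) n
  simpa [eval_natAdd'] using this

theorem nadd_congr {m m' n n' : Dom Γ₀ .nat} (h : p ⊩ m ≐ m') (h' : p ⊩ n ≐ n') :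
    p ⊩ m.nadd n ≐ m'.nadd n' := by
  have h₁ := forces_congr (natAdd v0 v1) (n ∷ Env.nil) h
  have h₂ := forces_congr (natAdd v1 v0) (m' ∷ Env.nil) h'
  simp only [eval_natAdd', eval_var, Env.cons_here, Env.cons_there] at h₁ h₂
  exact h₁.trans h₂

theorem nmul_congr {m m' n n' : Dom Γ₀ .nat} (h : p ⊩ m ≐ m') (h' : p ⊩ n ≐ n') :
    p ⊩ m.nmul n ≐ m'.nmul n' := by
  have h₁ := forces_congr (natMul v0 v1) (n ∷ Env.nil) h
  have h₂ := forces_congr (natMul v1 v0) (m' ∷ Env.nil) h'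
  simp only [eval_natMul', eval_var, Env.cons_here, Env.cons_there] at h₁ h₂
  exact h₁.trans h₂

theorem zero_nmul (m : Dom Γ₀ .nat) : zero.nmul m = .zero := by
  have := eq_ind (natMul .zero v0) .zero Env.nil (by simp [eval_natMul', nmul_zero])
    (fun n r h => by simpa [eval_natMul', nmul_succ, nadd_zero] using h) m
  simpa [eval_natMul'] using this

theorem succ_nmul (m n : Dom Γ₀ .nat) : m.succ.nmul n = (m.nmul n).nadd n := by
  have := eq_ind (natMul (.succ v1) v0) (natAdd (natMul v1 v0) v0) (m ∷ Env.nil)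
    (by simp [eval_natMul', eval_natAdd', nadd_zero, nmul_zero])
    (fun n r h => by
      simp only [eval_natMul', eval_natAdd', eval_succ, eval_var, Env.cons_here, Env.cons_there,
        nmul_succ, nadd_succ] at h ⊢
      have := (nadd_congr h (forces_rfl m)).succ
      rwa [nadd_assoc _ n, nadd_comm n m, ← nadd_assoc] at this) n
  simpa [eval_natMul', eval_natAdd'] using this

theorem nmul_comm (m n : Dom Γ₀ .nat) : m.nmul n = n.nmul m := by
  have := eq_ind (natMul v1 v0) (natMul v0 v1) (m ∷ Env.nil)
    (by simp [eval_natMul', nmul_zero, zero_nmul])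
    (fun n r h => by
      simpa [eval_natMul', nmul_succ, succ_nmul] using
        nadd_congr (by simpa [eval_natMul'] using h) (forces_rfl m)) n
  simpa [eval_natMul'] using this

theorem nmul_nadd (k m n : Dom Γ₀ .nat) : k.nmul (m.nadd n) = (k.nmul m).nadd (k.nmul n) := by
  have := eq_ind (natMul v2 (natAdd v1 v0)) (natAdd (natMul v2 v1) (natMul v2 v0))
    (m ∷ k ∷ Env.nil) (by simp [eval_natMul', eval_natAdd', nadd_zero, nmul_zero])
    (fun n r h => by
      simp only [eval_natMul', eval_natAdd', eval_var, Env.cons_here, Env.cons_there, nmul_succ,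
        nadd_succ] at h ⊢
      rw [← nadd_assoc]
      exact nadd_congr h (forces_rfl k)) n
  simpa [eval_natMul', eval_natAdd'] using this

theorem nmul_assoc (k m n : Dom Γ₀ .nat) : (k.nmul m).nmul n = k.nmul (m.nmul n) := by
  have := eq_ind (natMul (natMul v2 v1) v0) (natMul v2 (natMul v1 v0)) (m ∷ k ∷ Env.nil)
    (by simp [eval_natMul', nmul_zero])
    (fun n r h => by
      simp only [eval_natMul', eval_var, Env.cons_here, Env.cons_there, nmul_succ, nmul_nadd] at h ⊢
      exact nadd_congr h (forces_rfl (k.nmul m))) n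
  simpa [eval_natMul'] using this

noncomputable instance : Zero (Dom Γ₀ .nat) := ⟨zero⟩
noncomputable instance : One (Dom Γ₀ .nat) := ⟨succ zero⟩
noncomputable instance : Add (Dom Γ₀ .nat) := ⟨nadd⟩
noncomputable instance : Mul (Dom Γ₀ .nat) := ⟨nmul⟩

/-- The identities of Peano arithmetic hold as equalities of elements, so polynomial identities need
no internal derivation from here on. -/
noncomputable instance : CommSemiring (Dom Γ₀ .nat) where
  add_assoc := nadd_assoc
  zero_add := zero_nadd
  add_zero := nadd_zero
  add_comm := nadd_comm
  nsmul := nsmulRec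
  left_distrib := nmul_nadd
  right_distrib := fun k m n => by
    change nmul (nadd k m) n = nadd (nmul k n) (nmul m n)
    rw [nmul_comm, nmul_nadd, nmul_comm n, nmul_comm n]
  zero_mul := zero_nmul
  mul_zero := nmul_zero
  mul_assoc := nmul_assoc
  one_mul := fun m => by
    change nmul (succ zero) m = m
    rw [succ_nmul, zero_nmul, zero_nadd]
  mul_one := fun m => by
    change nmul m (succ zero) = m
    rw [nmul_succ, nmul_zero, zero_nadd]
  mul_comm := nmul_comm

theorem zero_eq : (zero : Dom Γ₀ .nat) = 0 := rfl

theorem succ_eq (n : Dom Γ₀ .nat) : n.succ = n + 1 := by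
  change n.succ = nadd n (succ zero)
  rw [nadd_succ, nadd_zero]

end Dom

@[simp] theorem eval_natAdd (s t : Tm Γ .nat) (ρ : Env Γ₀ Γ) :
    eval (natAdd s t) ρ = eval s ρ + eval t ρ := eval_natAdd' ..

@[simp] theorem eval_natMul (s t : Tm Γ .nat) (ρ : Env Γ₀ Γ) :
    eval (natMul s t) ρ = eval s ρ * eval t ρ := eval_natMul' ..

theorem Forces.add {m m' n n' : Dom Γ₀ .nat} (h : p ⊩ m ≐ m') (h' : p ⊩ n ≐ n') :
    p ⊩ m + n ≐ m' + n' := Dom.nadd_congr h h'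

theorem Forces.mul {m m' n n' : Dom Γ₀ .nat} (h : p ⊩ m ≐ m') (h' : p ⊩ n ≐ n') :
    p ⊩ m * n ≐ m' * n' := Dom.nmul_congr h h'

end SynthComp

namespace SynthComp

/-! ### Comparison of fractions in ordered semirings -/

section Fractions

variable {R : Type*} [CommSemiring R] [LinearOrder R] [IsStrictOrderedRing R]

/-- With `(P - N) / D` for each fraction, both inequalities are cross-multiplied without
subtraction; scale the first by `D''`, the second by `D`, add, and cancel `D'`. -/
theorem frac_lt_of_le_of_lt {P N D P' N' D' P'' N'' D'' : R} (hD : 0 < D) (hD' : 0 < D')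
    (hD'' : 0 < D'') (h : P * D' + N' * D ≤ P' * D + N * D')
    (h' : P' * D'' + N'' * D' < P'' * D' + N' * D'') : P * D'' + N'' * D < P'' * D + N * D'' := by
  have h₁ := mul_le_mul_of_nonneg_right h hD''.le
  have h₂ := mul_lt_mul_of_pos_right h' hD
  refine lt_of_mul_lt_mul_right ?_ hD'.le
  ring_nf at h₁ h₂ ⊢
  grind

theorem frac_lt_add_inv {P N D n : R} (hD : 0 < D) :
    P * (D * n) + (N * n + 0 * D) * D < (P * n + 1 * D) * D + N * (D * n) := by
  have := mul_pos hD hD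
  ring_nf at this ⊢
  grind

theorem frac_add_ninv_lt {P N D n : R} (hD : 0 < D) :
    (P * n + 0 * D) * D + N * (D * n) < P * (D * n) + (N * n + 1 * D) * D := by
  have := mul_pos hD hD
  ring_nf at this ⊢
  grind

/-- The gap between the fractions is at least `1 / (D * D')`, as the numerators differ by at least
one, and this exceeds `1 / (D * D' + 1)`. -/
theorem frac_add_inv_lt {P N D P' N' D' : R} (hD : 0 < D) (hD' : 0 < D')
    (h : P * D' + N' * D + 1 ≤ P' * D + N * D') :
    (P * (D * D' + 1) + 1 * D) * D' + N' * (D * (D * D' + 1)) <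
      P' * (D * (D * D' + 1)) + (N * (D * D' + 1) + 0 * D) * D' := by
  have := mul_le_mul_of_nonneg_right h (add_pos (mul_pos hD hD') one_pos).le
  have h₁ : (0 : R) < 1 := one_pos
  ring_nf at this ⊢
  grind

theorem frac_lt_add_ninv {P N D P' N' D' : R} (hD : 0 < D) (hD' : 0 < D')
    (h : P * D' + N' * D + 1 ≤ P' * D + N * D') :
    P * (D' * (D * D' + 1)) + (N' * (D * D' + 1) + 1 * D') * D <
      (P' * (D * D' + 1) + 0 * D') * D + N * (D' * (D * D' + 1)) := by
  have := mul_le_mul_of_nonneg_right h (add_pos (mul_pos hD hD') one_pos).le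
  have h₁ : (0 : R) < 1 := one_pos
  ring_nf at this ⊢
  grind

theorem frac_add_lt_add {P N D P' N' D' P₁ N₁ D₁ P₁' N₁' D₁' : R} (hD : 0 < D) (hD' : 0 < D')
    (hD₁ : 0 < D₁) (hD₁' : 0 < D₁') (h : P * D' + N' * D < P' * D + N * D')
    (h' : P₁ * D₁' + N₁' * D₁ < P₁' * D₁ + N₁ * D₁') :
    (P * D₁ + P₁ * D) * (D' * D₁') + (N' * D₁' + N₁' * D') * (D * D₁) <
      (P' * D₁' + P₁' * D') * (D * D₁) + (N * D₁ + N₁ * D) * (D' * D₁') := by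
  have h₁ := mul_lt_mul_of_pos_right h (mul_pos hD₁ hD₁')
  have h₂ := mul_lt_mul_of_pos_right h' (mul_pos hD hD')
  ring_nf at h₁ h₂ ⊢
  grind

theorem frac_add_self_lt {P N D : R} (hD : 0 < D) (h : P * 1 + 0 * D < 0 * D + N * 1) :
    (P * D + P * D) * D + N * (D * D) < P * (D * D) + (N * D + N * D) * D := by
  have := add_lt_add_left (mul_lt_mul_of_pos_right h (mul_pos hD hD))
    (P * (D * D) + N * (D * D))
  convert this using 1 <;> ring

/-- A numerator of at least one makes the fraction at least `1 / D`, hence larger than `1 / (D +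
1)`. -/
theorem frac_inv_lt {P N D : R} (hD : 0 < D) (h : 0 * D + N * 1 + 1 ≤ P * 1 + 0 * D) :
    1 * D + N * (D + 1) < P * (D + 1) + 0 * D := by
  have h₁ := mul_le_mul_of_nonneg_right h (add_pos hD one_pos).le
  have h₂ : (0 : R) < 1 := one_pos
  ring_nf at h₁ h ⊢
  grind

end Fractions

variable {Γ₀ Γ : Ctx} {A B C : Ty} {p q r a b c : Dom Γ₀ .prop}

attribute [simp] Dom.zero_eq Dom.succ_eq

/-! ### Order of the natural numbers -/

/-- `m ≤ n`. -/
noncomputable def Dom.nle (m n : Dom Γ₀ .nat) : Dom Γ₀ .prop :=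
  eval (natLe v1 v0) (n ∷ m ∷ Env.nil)

/-- `m < n`. -/
noncomputable def Dom.nlt (m n : Dom Γ₀ .nat) : Dom Γ₀ .prop := (m + 1).nle n

@[simp] theorem eval_natLe (s t : Tm Γ .nat) (ρ : Env Γ₀ Γ) :
    eval (natLe s t) ρ = (eval s ρ).nle (eval t ρ) := eval_sub₂ (natLe v1 v0) s t ρ

@[simp] theorem eval_natLt (s t : Tm Γ .nat) (ρ : Env Γ₀ Γ) :
    eval (natLt s t) ρ = (eval s ρ).nlt (eval t ρ) := by
  rw [natLt, eval_natLe, eval_succ, Dom.succ_eq, Dom.nlt]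

theorem forces_nle {m n : Dom Γ₀ .nat} : p ⊩ m.nle n ↔ LEx p fun r k => r ⊩ m + k ≐ n := by
  simp [Dom.nle, natLe]

theorem forces_nle_add (m k : Dom Γ₀ .nat) : p ⊩ m.nle (m + k) :=
  forces_nle.2 (.intro k (forces_rfl _))

theorem Forces.nle_congr {m m' n n' : Dom Γ₀ .nat} (h : p ⊩ m ≐ m') (h' : p ⊩ n ≐ n')
    (H : p ⊩ m.nle n) : p ⊩ m'.nle n' :=
  forces_nle.2 ((forces_nle.1 H).bind fun _ _ k hk =>
    .intro k ((Forces.add h.up.symm (forces_rfl k)).trans (hk.trans h'.up)))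

theorem forces_nat_cases (n : Dom Γ₀ .nat) :
    LOr p (fun r => r ⊩ n ≐ 0) (fun r => LEx r fun s m => s ⊩ n ≐ m + 1) := by
  have := forces_ind (v0 =ₒ .zero ∨ₒ ex_ .nat fun m => v1 =ₒ .succ m) Env.nil (p := p)
    (by simpa using .inl (forces_rfl 0))
    (fun n r _ h => by simpa using .inr (.intro n (forces_rfl (n + 1)))) n
  simpa using this

theorem Forces.add_right_cancel {x y z : Dom Γ₀ .nat} (h : p ⊩ x + z ≐ y + z) : p ⊩ x ≐ y := by
  have := forces_ind (natAdd v2 v0 =ₒ natAdd v1 v0 →ₒ v2 =ₒ v1) (y ∷ x ∷ Env.nil) (p := p)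
    (by
      simp only [eval_imp, eval_eqₒ, eval_natAdd, eval_var, Env.cons_here, Env.cons_there,
        Dom.zero_eq, add_zero]
      exact .intro fun r _ h => h)
    (fun n r _ h => by
      simp only [eval_imp, eval_eqₒ, eval_natAdd, eval_var, Env.cons_here, Env.cons_there,
        Dom.succ_eq] at h ⊢
      refine .intro fun s _ h' => h.up.mp (forces_succ_inj ?_)
      simpa [add_assoc] using h') z
  simp only [eval_imp, eval_eqₒ, eval_natAdd, eval_var, Env.cons_here, Env.cons_there] at this
  exact this.mp h

theorem Forces.add_left_cancel {x y z : Dom Γ₀ .nat} (h : p ⊩ z + x ≐ z + y) : p ⊩ x ≐ y := by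
  rw [add_comm z, add_comm z] at h
  exact h.add_right_cancel

theorem forces_add_one_ne_zero {n : Dom Γ₀ .nat} (h : p ⊩ n + 1 ≐ 0) : p ⊩ a :=
  forces_succ_ne_zero (n := n) (by simpa using h)

theorem Forces.eq_zero_of_add {m n : Dom Γ₀ .nat} (h : p ⊩ m + n ≐ 0) : p ⊩ n ≐ 0 :=
  (forces_nat_cases n).elim (fun r _ h => h) fun r _ h' => h'.elim fun s _ k hk =>
    forces_add_one_ne_zero (n := m + k) (by
      have := (Forces.add (forces_rfl m) hk).symm.trans h.up
      rwa [← add_assoc] at this)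

theorem Forces.nle_trans {x y z : Dom Γ₀ .nat} (h : p ⊩ x.nle y) (h' : p ⊩ y.nle z) :
    p ⊩ x.nle z :=
  (forces_nle.1 h).elim fun r _ k hk => (forces_nle.1 (h' : r ⊩ y.nle z)).elim fun s _ l hl =>
    forces_nle.2 (.intro (k + l) (by
      rw [← add_assoc]
      exact (Forces.add hk.up (forces_rfl l)).trans hl))

theorem Forces.nle_antisymm {x y : Dom Γ₀ .nat} (h : p ⊩ x.nle y) (h' : p ⊩ y.nle x) :
    p ⊩ x ≐ y :=
  (forces_nle.1 h).elim fun r _ k hk => (forces_nle.1 (h' : r ⊩ y.nle x)).elim fun s _ l hl => by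
    have h₁ : s ⊩ x + (l + k) ≐ x + 0 := by
      rw [add_zero, add_comm l, ← add_assoc]
      exact (Forces.add hk.up (forces_rfl l)).trans hl
    have h₂ := (Forces.add (forces_rfl x) h₁.add_left_cancel.eq_zero_of_add).symm
    rw [add_zero] at h₂
    exact h₂.trans hk.up

theorem forces_nle_total (x y : Dom Γ₀ .nat) : p ⊩ x.nle y ∨ᵈ y.nlt x := by
  have := forces_ind (natLe v1 v0 ∨ₒ natLt v0 v1) (x ∷ Env.nil) (p := p) ?_ ?_ y
  · simpa using this
  · simp only [eval_or, eval_natLe, eval_natLt, eval_var, Env.cons_here, Env.cons_there,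
      Dom.zero_eq]
    refine (forces_nat_cases x).elim (fun r _ h => forces_inl ?_) fun r _ h => h.elim
      fun s _ k hk => forces_inr ?_
    · exact Forces.nle_congr h.symm (forces_rfl _) (by simpa using forces_nle_add 0 0)
    · refine Forces.nle_congr (forces_rfl _) hk.symm ?_
      rw [zero_add, add_comm]
      exact forces_nle_add _ _
  · intro n r _ h
    simp only [eval_or, eval_natLe, eval_natLt, eval_var, Env.cons_here, Env.cons_there,
      Dom.succ_eq] at h ⊢
    refine h.orElim (fun s _ h => forces_inl (h.nle_trans (forces_nle_add n 1))) fun s _ h => ?_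
    refine (forces_nle.1 h).elim fun t _ k hk => (forces_nat_cases k).elim
      (fun u _ h => forces_inl ?_) fun u _ h => h.elim fun w _ l hl => forces_inr ?_
    · have := (Forces.add (forces_rfl (n + 1)) h).symm.trans hk.up
      rw [add_zero] at this
      exact Forces.nle_congr this (forces_rfl _) (by simpa using forces_nle_add (n + 1) 0)
    · have := (Forces.add (forces_rfl (n + 1)) hl).symm.trans hk.up
      rw [add_comm l, ← add_assoc] at this
      exact Forces.nle_congr (forces_rfl _) this (forces_nle_add _ _)

theorem Forces.nlt_irrefl {x y : Dom Γ₀ .nat} (h : p ⊩ x.nle y) (h' : p ⊩ y.nlt x) : p ⊩ a :=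
  (forces_nle.1 (h'.nle_trans h)).elim fun r _ k hk => by
    rw [add_assoc, ← add_zero y, add_assoc y, zero_add] at hk
    have := hk.add_left_cancel
    rw [add_comm] at this
    exact forces_add_one_ne_zero this

theorem Forces.mul_nlt {x y z : Dom Γ₀ .nat} (hz : p ⊩ Dom.nlt 0 z) (h : p ⊩ x.nlt y) :
    p ⊩ (z * x).nlt (z * y) :=
  (forces_nle.1 hz).elim fun r _ k hk => (forces_nle.1 (h : r ⊩ x.nlt y)).elim fun s _ l hl => by
    refine Forces.nle_congr (((Forces.mul hk.up (forces_rfl x)).add (forces_rfl 1)))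
      (Forces.mul hk.up hl) ?_
    rw [show (0 + 1 + k) * (x + 1 + l) = (0 + 1 + k) * x + 1 + (l + k * (1 + l)) by ring]
    exact forces_nle_add _ _

/-! ### Points -/

/-- The order is entailment. Distributivity is what makes the prime ideal theorem available. -/
noncomputable instance : DistribLattice (Dom Γ₀ .prop) :=
  let _ : PartialOrder (Dom Γ₀ .prop) :=
    { le := Forces
      le_refl := forces_refl
      le_trans := fun _ _ _ => forces_trans
      le_antisymm := fun a b h h' =>
        Dom.prop_ext fun _ => ⟨fun k => forces_trans k h, fun k => forces_trans k h'⟩ }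
  let _ : Lattice (Dom Γ₀ .prop) :=
    { sup := Dom.or
      le_sup_left := fun a b => forces_inl (forces_refl a)
      le_sup_right := fun a b => forces_inr (forces_refl b)
      sup_le := fun a b c h h' => (forces_refl (a ∨ᵈ b)).orElim
        (fun r _ k => forces_trans k h) (fun r _ k => forces_trans k h')
      inf := Dom.and
      inf_le_left := fun a b => (forces_and.1 (forces_refl (a ∧ᵈ b))).1
      inf_le_right := fun a b => (forces_and.1 (forces_refl (a ∧ᵈ b))).2
      le_inf := fun a b c h h' => forces_and.2 ⟨h, h'⟩ }
  DistribLattice.ofInfSupLe fun a b c => by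
    change (a ∧ᵈ (b ∨ᵈ c)) ⊩ (a ∧ᵈ b) ∨ᵈ (a ∧ᵈ c)
    have h := forces_and.1 (forces_refl (a ∧ᵈ (b ∨ᵈ c)))
    exact h.2.orElim (fun r _ k => forces_inl (forces_and.2 ⟨h.1, k⟩))
      (fun r _ k => forces_inr (forces_and.2 ⟨h.1, k⟩))

/-- A prime filter of truth values. -/
structure Point (Γ₀ : Ctx) where
  val : Dom Γ₀ .prop → Prop
  mono : ∀ {a b}, a ⊩ b → val a → val b
  true : val (.imp .bot .bot)
  and : ∀ {a b}, val a → val b → val (a ∧ᵈ b)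
  or : ∀ {a b}, val (a ∨ᵈ b) → val a ∨ val b
  bot : ¬ val .bot

open Order in
-- A prime ideal contains `a` and avoids the principal filter of `p`; its complement is the point.
theorem exists_point (h : ¬ (p ⊩ a)) : ∃ w : Point Γ₀, w.val p ∧ ¬ w.val a := by
  have hd : Disjoint (PFilter.principal p : Set (Dom Γ₀ .prop)) (Ideal.principal a) := by
    rw [Set.disjoint_left]
    intro x hx hx'
    exact h (forces_trans (show p ≤ x by simpa using hx) (show x ≤ a by simpa using hx'))
  obtain ⟨J, hJ, ha, hp⟩ := DistribLattice.prime_ideal_of_disjoint_filter_ideal hd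
  have mono : ∀ {a b : Dom Γ₀ .prop}, a ⊩ b → b ∈ J → a ∈ J := fun h => J.lower h
  have hpJ : p ∉ J := fun h => (Set.disjoint_left.1 hp) (by simp) h
  refine ⟨⟨fun b => b ∉ J, fun h ha hb => ha (mono h hb), fun h => hpJ (mono forces_top h),
    fun ha hb h => ?_, fun h => ?_, ?_⟩, hpJ, ?_⟩
  · exact (hJ.mem_or_mem h).elim ha hb
  · by_contra! H
    exact h (Ideal.sup_mem H.1 H.2)
  · exact fun h => h (mono (forces_refl _).absurd (ha Ideal.mem_principal_self))
  · exact fun h => h (ha Ideal.mem_principal_self)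

/-- This permits classical case distinctions in the metatheory. A point is only required to respect
∧, ∨ and ⊥, so the method is confined to quantifier-free statements such as comparisons of
fractions. -/
theorem forces_of_point (h : ∀ w : Point Γ₀, w.val p → w.val a) : p ⊩ a := by
  by_contra H
  obtain ⟨w, hp, ha⟩ := exists_point H
  exact ha (h w hp)

/-! ### The ordered semiring of natural numbers at a point -/

namespace Point

variable (w : Point Γ₀)

/-- Equality of natural numbers at a point. -/
noncomputable def con : RingCon (Dom Γ₀ .nat) where
  r x y := w.val (x ≐ y)
  iseqv :=
    { refl := fun x => w.mono (forces_rfl x) w.true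
      symm := fun h => w.mono (forces_refl _).symm h
      trans := fun h h' => w.mono ((forces_and.1 (forces_refl _)).1.trans
        (forces_and.1 (forces_refl _)).2) (w.and h h') }
  add' := fun h h' => w.mono (Forces.add (forces_and.1 (forces_refl _)).1
        (forces_and.1 (forces_refl _)).2) (w.and h h')
  mul' := fun h h' => w.mono (Forces.mul (forces_and.1 (forces_refl _)).1
        (forces_and.1 (forces_refl _)).2) (w.and h h')

/-- The natural numbers at a point. -/
abbrev Nat : Type := w.con.Quotient

noncomputable instance : LE w.Nat := ⟨fun a b => ∃ x y : Dom Γ₀ .nat, x = a ∧ y = b ∧ w.val (x.nle y)⟩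

theorem coe_eq {x y : Dom Γ₀ .nat} : (x : w.Nat) = y ↔ w.val (x ≐ y) := RingCon.eq _

theorem mono₂ {a b c : Dom Γ₀ .prop} (h : ∀ {p}, p ⊩ a → p ⊩ b → p ⊩ c) (ha : w.val a)
    (hb : w.val b) : w.val c :=
  w.mono (h (forces_and.1 (forces_refl _)).1 (forces_and.1 (forces_refl _)).2) (w.and ha hb)

theorem coe_le {x y : Dom Γ₀ .nat} : (x : w.Nat) ≤ y ↔ w.val (x.nle y) := by
  refine ⟨fun ⟨x', y', hx, hy, h⟩ => ?_, fun h => ⟨x, y, rfl, rfl, h⟩⟩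
  rw [coe_eq] at hx hy
  exact w.mono₂ (fun h h' => Forces.nle_congr (forces_rfl _) h h') hy
    (w.mono₂ (fun h h' => Forces.nle_congr h (forces_rfl _) h') hx h)

theorem ind {P : w.Nat → Prop} (h : ∀ x : Dom Γ₀ .nat, P x) (a : w.Nat) : P a :=
  Quotient.inductionOn' a h

/-- Totality is where primeness enters: the internally derivable `x ≤ y ∨ y < x` splits at a prime
filter. -/
noncomputable instance : LinearOrder w.Nat where
  le_refl a := by
    induction a using ind with | h x => ?_
    rw [coe_le]
    exact w.mono (by simpa using forces_nle_add x 0) w.true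
  le_trans a b c h h' := by
    induction a using ind with | h x => ?_
    induction b using ind with | h y => ?_
    induction c using ind with | h z => ?_
    rw [coe_le] at *
    exact w.mono₂ Forces.nle_trans h h'
  le_antisymm a b h h' := by
    induction a using ind with | h x => ?_
    induction b using ind with | h y => ?_
    rw [coe_le] at *
    rw [coe_eq]
    exact w.mono₂ Forces.nle_antisymm h h'
  le_total a b := by
    induction a using ind with | h x => ?_
    induction b using ind with | h y => ?_
    rw [coe_le, coe_le]
    refine (w.or (w.mono (forces_nle_total x y) w.true)).imp id (w.mono ?_)
    have := forces_nle_add y 1 (p := y.nlt x)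
    exact this.nle_trans (forces_refl _)
  toDecidableLE := Classical.decRel _

theorem coe_lt {x y : Dom Γ₀ .nat} : (x : w.Nat) < y ↔ w.val (x.nlt y) := by
  rw [← not_le, coe_le]
  constructor
  · intro h
    exact (w.or (w.mono (forces_nle_total y x) w.true)).resolve_left h
  · intro h h'
    exact w.bot (w.mono₂ Forces.nlt_irrefl h' h)

theorem lt_iff {a b : w.Nat} : a < b ↔ a + 1 ≤ b := by
  induction a using ind with | h x => ?_
  induction b using ind with | h y => ?_
  rw [coe_lt]
  exact (w.coe_le (x := x + 1)).symm

theorem mul_lt_mul {a b c : w.Nat} (hc : 0 < c) (h : a < b) : c * a < c * b := by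
  induction a using ind with | h x => ?_
  induction b using ind with | h y => ?_
  induction c using ind with | h z => ?_
  have hc := (w.coe_lt (x := 0) (y := z)).1 hc
  rw [coe_lt] at h
  exact (w.coe_lt (x := z * x) (y := z * y)).2 (w.mono₂ Forces.mul_nlt hc h)

instance : IsStrictOrderedRing w.Nat where
  add_le_add_left a b h c := by
    induction a using ind with | h x => ?_
    induction b using ind with | h y => ?_
    induction c using ind with | h z => ?_
    rw [coe_le] at h
    refine (w.coe_le (x := x + z) (y := y + z)).2 (w.mono ?_ h)
    exact (forces_nle.1 (forces_refl _)).elim fun r _ k hk => forces_nle.2 (.intro k (by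
      rw [add_right_comm]
      exact Forces.add hk (forces_rfl z)))
  le_of_add_le_add_left a b c h := by
    induction a using ind with | h x => ?_
    induction b using ind with | h y => ?_
    induction c using ind with | h z => ?_
    have h := (w.coe_le (x := x + y) (y := x + z)).1 h
    rw [coe_le]
    refine w.mono ?_ h
    exact (forces_nle.1 (forces_refl _)).elim fun r _ k hk => forces_nle.2 (.intro k (by
      rw [add_assoc] at hk
      exact hk.add_left_cancel))
  zero_le_one := (w.coe_le (x := 0) (y := 1)).2
    (w.mono (by simpa using forces_nle_add 0 1) w.true)
  exists_pair_ne := ⟨(0 : Dom Γ₀ .nat), (1 : Dom Γ₀ .nat), fun h =>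
    w.bot (w.mono (by
      have := (forces_refl ((0 : Dom Γ₀ .nat) ≐ 1)).symm
      exact forces_add_one_ne_zero (n := 0) (by rwa [zero_add])) ((w.coe_eq (x := 0) (y := 1)).1 h))⟩
  mul_lt_mul_of_pos_left c hc a b h := w.mul_lt_mul hc h
  mul_lt_mul_of_pos_right c hc a b h := by
    simpa only [mul_comm _ c] using w.mul_lt_mul hc h

end Point

end SynthComp

namespace SynthComp

variable {Γ₀ Γ : Ctx} {A B C : Ty} {p q r a b c : Dom Γ₀ .prop}

/-! ### Rational numbers -/

namespace Dom

/-- `q < r` for rational numbers. -/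
noncomputable def qlt (q r : Dom Γ₀ rat) : Dom Γ₀ .prop := eval (ratLt v1 v0) (r ∷ q ∷ Env.nil)

/-- `q + r` for rational numbers. -/
noncomputable def qadd (q r : Dom Γ₀ rat) : Dom Γ₀ rat := eval (ratAdd v1 v0) (r ∷ q ∷ Env.nil)

/-- The rational number `0`. -/
noncomputable def qzero : Dom Γ₀ rat := .pair 0 (.pair 0 0)

/-- The rational number `1 / (n + 1)`. -/
noncomputable def inv (n : Dom Γ₀ .nat) : Dom Γ₀ rat := .pair 1 (.pair 0 n)

/-- The rational number `-1 / (n + 1)`. -/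
noncomputable def ninv (n : Dom Γ₀ .nat) : Dom Γ₀ rat := .pair 0 (.pair 1 n)

/-- The denominator of a fraction. -/
noncomputable def den (q : Dom Γ₀ rat) : Dom Γ₀ .nat := q.snd.snd + 1

end Dom

@[simp] theorem eval_ratLt (s t : Tm Γ rat) (ρ : Env Γ₀ Γ) :
    eval (ratLt s t) ρ = (eval s ρ).qlt (eval t ρ) := by
  simp [Dom.qlt, ratLt, ratPos, ratNeg, ratDen]

@[simp] theorem eval_ratAdd (s t : Tm Γ rat) (ρ : Env Γ₀ Γ) :
    eval (ratAdd s t) ρ = (eval s ρ).qadd (eval t ρ) := eval_sub₂ (ratAdd v1 v0) s t ρ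

@[simp] theorem eval_ratZero (ρ : Env Γ₀ Γ) : eval ratZero ρ = Dom.qzero := by
  simp [ratZero, Dom.qzero]

/-- The term `1 / (n + 1)`. -/
abbrev ratInv (n : Tm Γ .nat) : Tm Γ rat := .pair (.succ .zero) (.pair .zero n)

/-- The term `-1 / (n + 1)`. -/
abbrev ratNinv (n : Tm Γ .nat) : Tm Γ rat := .pair .zero (.pair (.succ .zero) n)

theorem eval_ratInv (n : Tm Γ .nat) (ρ : Env Γ₀ Γ) : eval (ratInv n) ρ = .inv (eval n ρ) := by
  simp [Dom.inv]

theorem eval_ratNinv (n : Tm Γ .nat) (ρ : Env Γ₀ Γ) : eval (ratNinv n) ρ = .ninv (eval n ρ) := by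
  simp [Dom.ninv]

namespace Dom

theorem qlt_eq (q r : Dom Γ₀ rat) : q.qlt r =
    (q.fst * r.den + r.snd.fst * q.den).nlt (r.fst * q.den + q.snd.fst * r.den) := by
  simp [qlt, ratLt, ratPos, ratNeg, ratDen, den]

theorem qadd_eq (q r : Dom Γ₀ rat) : q.qadd r = .pair (q.fst * r.den + r.fst * q.den)
    (.pair (q.snd.fst * r.den + r.snd.fst * q.den)
      (q.snd.snd * r.snd.snd + (q.snd.snd + r.snd.snd))) := by
  simp [qadd, ratAdd, ratPos, ratNeg, ratDen, den]

theorem den_qadd (q r : Dom Γ₀ rat) : (q.qadd r).den = q.den * r.den := by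
  simp only [qadd_eq, den, snd_pair]
  ring

theorem fst_qadd (q r : Dom Γ₀ rat) : (q.qadd r).fst = q.fst * r.den + r.fst * q.den := by
  simp [qadd_eq]

theorem snd_qadd (q r : Dom Γ₀ rat) :
    (q.qadd r).snd.fst = q.snd.fst * r.den + r.snd.fst * q.den := by
  simp [qadd_eq]

@[simp] theorem den_inv (n : Dom Γ₀ .nat) : (inv n).den = n + 1 := by simp [inv, den]
@[simp] theorem fst_inv (n : Dom Γ₀ .nat) : (inv n).fst = 1 := by simp [inv]
@[simp] theorem snd_inv (n : Dom Γ₀ .nat) : (inv n).snd.fst = 0 := by simp [inv]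
@[simp] theorem den_ninv (n : Dom Γ₀ .nat) : (ninv n).den = n + 1 := by simp [ninv, den]
@[simp] theorem fst_ninv (n : Dom Γ₀ .nat) : (ninv n).fst = 0 := by simp [ninv]
@[simp] theorem snd_ninv (n : Dom Γ₀ .nat) : (ninv n).snd.fst = 1 := by simp [ninv]
@[simp] theorem den_qzero : (qzero : Dom Γ₀ rat).den = 1 := by simp [qzero, den]
@[simp] theorem fst_qzero : (qzero : Dom Γ₀ rat).fst = 0 := by simp [qzero]
@[simp] theorem snd_qzero : (qzero : Dom Γ₀ rat).snd.fst = 0 := by simp [qzero]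

end Dom

namespace Point

variable (w : Point Γ₀)

theorem val_qlt {q r : Dom Γ₀ rat} : w.val (q.qlt r) ↔
    (q.fst : w.Nat) * r.den + r.snd.fst * q.den < r.fst * q.den + q.snd.fst * r.den := by
  rw [Dom.qlt_eq, ← coe_lt]
  simp only [RingCon.coe_add, RingCon.coe_mul]

theorem den_pos (q : Dom Γ₀ rat) : 0 < (q.den : w.Nat) := by
  refine (w.coe_lt (x := 0)).2 (w.mono ?_ w.true)
  rw [Dom.den, Dom.nlt, zero_add, add_comm]
  exact forces_nle_add _ _

theorem val_or {a b : Dom Γ₀ .prop} (h : w.val a ∨ w.val b) : w.val (a ∨ᵈ b) :=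
  h.elim (w.mono (forces_inl (forces_refl _))) (w.mono (forces_inr (forces_refl _)))

end Point

theorem Forces.qlt_or {x z : Dom Γ₀ rat} (h : p ⊩ x.qlt z) (y : Dom Γ₀ rat) :
    p ⊩ x.qlt y ∨ᵈ y.qlt z := by
  refine forces_of_point fun w hp => w.val_or ?_
  have h := w.mono h hp
  rw [w.val_qlt] at *
  rw [w.val_qlt]
  by_contra! H
  exact H.2.not_gt (frac_lt_of_le_of_lt (w.den_pos _) (w.den_pos _) (w.den_pos _) H.1 h)

theorem Forces.qlt_asymm {x y : Dom Γ₀ rat} (h : p ⊩ x.qlt y) (h' : p ⊩ y.qlt x) : p ⊩ a := by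
  refine forces_of_point fun w hp => ?_
  have h := w.mono h hp
  have h' := w.mono h' hp
  rw [w.val_qlt] at h h'
  exact (h.not_gt h').elim

theorem Forces.qlt_trans {x y z : Dom Γ₀ rat} (h : p ⊩ x.qlt y) (h' : p ⊩ y.qlt z) :
    p ⊩ x.qlt z :=
  (h.qlt_or z).orElim (fun _ _ k => k) fun _ _ k => Forces.qlt_asymm k h'.up

theorem forces_lt_add_inv (x : Dom Γ₀ rat) (n : Dom Γ₀ .nat) : p ⊩ x.qlt (x.qadd (.inv n)) := by
  refine forces_of_point fun w _ => ?_
  rw [w.val_qlt]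
  simp only [Dom.fst_qadd, Dom.snd_qadd, Dom.den_qadd, Dom.den_inv, Dom.fst_inv, Dom.snd_inv,
    RingCon.coe_add, RingCon.coe_mul, RingCon.coe_one, RingCon.coe_zero]
  exact frac_lt_add_inv (w.den_pos x)

theorem forces_add_ninv_lt (x : Dom Γ₀ rat) (n : Dom Γ₀ .nat) :
    p ⊩ (x.qadd (.ninv n)).qlt x := by
  refine forces_of_point fun w _ => ?_
  rw [w.val_qlt]
  simp only [Dom.fst_qadd, Dom.snd_qadd, Dom.den_qadd, Dom.den_ninv, Dom.fst_ninv, Dom.snd_ninv,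
    RingCon.coe_add, RingCon.coe_mul, RingCon.coe_one, RingCon.coe_zero]
  exact frac_add_ninv_lt (w.den_pos x)

theorem Forces.add_inv_lt {x y : Dom Γ₀ rat} (h : p ⊩ x.qlt y) :
    p ⊩ (x.qadd (.inv (x.den * y.den))).qlt y := by
  refine forces_of_point fun w hp => ?_
  have h := w.mono h hp
  rw [w.val_qlt] at *
  rw [w.lt_iff] at h
  simp only [Dom.fst_qadd, Dom.snd_qadd, Dom.den_qadd, Dom.den_inv, Dom.fst_inv, Dom.snd_inv,
    RingCon.coe_add, RingCon.coe_mul, RingCon.coe_one, RingCon.coe_zero]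
  exact frac_add_inv_lt (w.den_pos x) (w.den_pos y) h

theorem Forces.lt_add_ninv {x y : Dom Γ₀ rat} (h : p ⊩ x.qlt y) :
    p ⊩ x.qlt (y.qadd (.ninv (x.den * y.den))) := by
  refine forces_of_point fun w hp => ?_
  have h := w.mono h hp
  rw [w.val_qlt] at *
  rw [w.lt_iff] at h
  simp only [Dom.fst_qadd, Dom.snd_qadd, Dom.den_qadd, Dom.den_ninv, Dom.fst_ninv, Dom.snd_ninv,
    RingCon.coe_add, RingCon.coe_mul, RingCon.coe_one, RingCon.coe_zero]
  exact frac_lt_add_ninv (w.den_pos x) (w.den_pos y) h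

theorem Forces.qadd_lt_qadd {x y x' y' : Dom Γ₀ rat} (h : p ⊩ x.qlt y) (h' : p ⊩ x'.qlt y') :
    p ⊩ (x.qadd x').qlt (y.qadd y') := by
  refine forces_of_point fun w hp => ?_
  have h := w.mono h hp
  have h' := w.mono h' hp
  rw [w.val_qlt] at *
  simp only [Dom.fst_qadd, Dom.snd_qadd, Dom.den_qadd, RingCon.coe_add, RingCon.coe_mul]
  exact frac_add_lt_add (w.den_pos x) (w.den_pos y) (w.den_pos x') (w.den_pos y') h h'

theorem Forces.qadd_self_lt {x : Dom Γ₀ rat} (h : p ⊩ x.qlt .qzero) : p ⊩ (x.qadd x).qlt x := by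
  refine forces_of_point fun w hp => ?_
  have h := w.mono h hp
  rw [w.val_qlt] at *
  simp only [Dom.fst_qadd, Dom.snd_qadd, Dom.den_qadd, RingCon.coe_add, RingCon.coe_mul,
    Dom.den_qzero, Dom.fst_qzero, Dom.snd_qzero, RingCon.coe_one, RingCon.coe_zero] at *
  exact frac_add_self_lt (w.den_pos x) h

theorem forces_inv_pos (n : Dom Γ₀ .nat) : p ⊩ Dom.qzero.qlt (.inv n) := by
  refine forces_of_point fun w hp => ?_
  rw [w.val_qlt]
  simp

theorem Forces.inv_lt_inv {m n : Dom Γ₀ .nat} (h : p ⊩ m.nlt n) : p ⊩ (Dom.inv n).qlt (.inv m) := by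
  refine forces_of_point fun w hp => ?_
  have h := w.coe_lt.2 (w.mono h hp)
  rw [w.val_qlt]
  simpa using h

theorem Forces.exists_inv_lt {x : Dom Γ₀ rat} (h : p ⊩ Dom.qzero.qlt x) :
    p ⊩ (Dom.inv x.den).qlt x := by
  refine forces_of_point fun w hp => ?_
  have h := w.mono h hp
  have hx := w.den_pos x
  rw [w.val_qlt] at *
  simp only [Dom.fst_qzero, Dom.den_qzero, Dom.snd_qzero, Dom.fst_inv, Dom.den_inv, Dom.snd_inv,
    RingCon.coe_add, RingCon.coe_one, RingCon.coe_zero] at *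
  rw [w.lt_iff] at h
  exact frac_inv_lt hx h

end SynthComp

namespace SynthComp

variable {Γ₀ Γ : Ctx} {A B C : Ty} {p q r a b c : Dom Γ₀ .prop}

/-! ### The postulates in the model -/

theorem forces_postulate {φ : Fm []} (h : Postulate φ) (p : Dom Γ₀ .prop) :
    p ⊩ eval φ Env.nil := by
  have := forces_of_pf (Γ := []) (Φ := []) (.postulate h) (ρ := Env.nil) (p := p) (by simp)
  rwa [eval_closed] at this

theorem LEx.mono {P Q : Dom Γ₀ .prop → Dom Γ₀ A → Prop} (h : LEx p P)
    (k : ∀ r (_ : Ext r p) x, P r x → Q r x) : LEx p Q :=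
  h.bind fun r hr x hx => .intro x (k r hr x hx)

/-- A target `c` at `r` is replaced by the target `r ⇨ᵈ c` at `p`; persistence of `P` carries each
witness to the common strengthening. -/
theorem LEx.up {P : Dom Γ₀ .prop → Dom Γ₀ A → Prop} [hr : Ext r p] (h : LEx p P)
    (hP : ∀ s t (_ : Ext t s) x, P s x → P t x) : LEx r P := fun c k => by
  have := h.elim (c := r ⇨ᵈ c) fun s _ x hx => .intro fun t _ ht =>
    have : Ext t r := ⟨ht⟩
    k t this x (hP s t inferInstance x hx)
  exact Forces.mp this.up (forces_refl r)

theorem forces_dependentChoice [Inhab Γ₀ A] (S : Dom Γ₀ (A ⇒ₜ .prop))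
    (R : Dom Γ₀ (A ⇒ₜ A ⇒ₜ .prop))
    (h : ∀ x r (_ : Ext r p), r ⊩ S ⬝ᵈ x → LEx r fun t y => t ⊩ S ⬝ᵈ y ∧ t ⊩ R ⬝ᵈ x ⬝ᵈ y)
    (a : Dom Γ₀ A) (ha : p ⊩ S ⬝ᵈ a) :
    LEx p fun r s => r ⊩ s ⬝ᵈ 0 ≐ a ∧
      ∀ n : Dom Γ₀ .nat, r ⊩ S ⬝ᵈ (s ⬝ᵈ n) ∧ r ⊩ R ⬝ᵈ (s ⬝ᵈ n) ⬝ᵈ (s ⬝ᵈ (n + 1)) := by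
  have := forces_postulate (.dependentChoice A) p
  simp only [dependentChoice, forces_all, eval_imp, forces_imp, eval_app, eval_wk, eval_var,
    Env.cons_here, forces_ex, eval_and, forces_and, eval_eqₒ, eval_zero,
    Dom.zero_eq, eval_succ, Dom.succ_eq] at this
  exact this S R p (fun x r hr => h x r hr) a p ha

theorem Forces.orElim' {R : Dom Γ₀ .prop → Dom Γ₀ A → Prop} (h : p ⊩ a ∨ᵈ b)
    (k : ∀ r (_ : Ext r p), r ⊩ a → LEx r R) (l : ∀ r (_ : Ext r p), r ⊩ b → LEx r R) : LEx p R :=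
  (forces_or.1 h).bind k l

/-- Countable choice for a definable relation. -/
theorem countable_choice [Inhab Γ₀ B] (φ : Fm (B :: .nat :: Γ)) (ρ : Env Γ₀ Γ)
    (h : ∀ n, LEx p fun r y => r ⊩ eval φ (y ∷ n ∷ ρ)) :
    LEx p fun r s => ∀ n, r ⊩ eval φ (s ⬝ᵈ n ∷ n ∷ ρ) := by
  set R : Dom Γ₀ (.nat ⇒ₜ B ⇒ₜ .prop) := eval (.lam (.lam φ)) ρ with hR
  have hR : ∀ n y, R ⬝ᵈ n ⬝ᵈ y = eval φ (y ∷ n ∷ ρ) := fun n y => by simp [R]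
  -- Dependent choice is applied to pairs `(n, y)` related by `φ`, each step raising the index by
  -- one; the second components then form the choice sequence.
  set S : Dom Γ₀ ((.nat ×ₜ B) ⇒ₜ .prop) := eval (.lam (v1 ⬝ .fst v0 ⬝ .snd v0)) (R ∷ Env.nil)
    with hS
  have hS : ∀ u, S ⬝ᵈ u = R ⬝ᵈ u.fst ⬝ᵈ u.snd := fun u => by simp [S]
  set T : Dom Γ₀ ((.nat ×ₜ B) ⇒ₜ (.nat ×ₜ B) ⇒ₜ .prop) :=
    eval (.lam (.lam (.fst v0 =ₒ .succ (.fst v1)))) Env.nil with hT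
  have hT : ∀ u v, T ⬝ᵈ u ⬝ᵈ v = (v.fst ≐ u.fst + 1) := fun u v => by simp [T]
  refine (h 0).bind fun r _ y₀ hy₀ => ?_
  refine (forces_dependentChoice (p := r) S T (fun u t _ _ => ?_) (.pair 0 y₀) ?_).bind
    fun t _ s hs => ?_
  · refine ((h (u.fst + 1)).up (r := t) fun s t _ y hy => hy.up).bind fun s _ y hy =>
      .intro (.pair (u.fst + 1) y) ?_
    rw [hS, hT, hR]
    simpa using And.intro hy (forces_rfl (u.fst + 1))
  · rw [hS, hR]
    simpa using hy₀
  · have hn : ∀ n, t ⊩ (s ⬝ᵈ n).fst ≐ n := by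
      intro n
      have := forces_ind (.fst (v1 ⬝ v0) =ₒ v0) (s ∷ Env.nil) (p := t) ?_ ?_ n
      · simpa using this
      · simpa using forces_congr (.fst v0) Env.nil hs.1
      · intro n u _ hn
        have := (hs.2 n).2
        rw [hT] at this
        simp only [eval_eqₒ, eval_fst, eval_app, eval_var, Env.cons_here, Env.cons_there,
          Dom.succ_eq] at hn ⊢
        exact this.up.trans (hn.add (forces_rfl 1))
    refine .intro (eval (.lam (.snd (v1 ⬝ v0))) (s ∷ Env.nil)) fun n => ?_
    have h₁ := (hs.2 n).1
    rw [hS] at h₁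
    have := forces_subst (v2 ⬝ v0 ⬝ v1) ((s ⬝ᵈ n).snd ∷ R ∷ Env.nil) (hn n) (by simpa using h₁)
    simpa [hR] using this

/-! ### Semidecidable truth values -/

/-- `f` is a binary sequence. -/
noncomputable def Dom.isBinary (f : Dom Γ₀ (.nat ⇒ₜ .nat)) : Dom Γ₀ .prop :=
  eval (IsBinary v0) (f ∷ Env.nil)

/-- The truth value `a` is semidecidable. -/
noncomputable def Dom.semidec (a : Dom Γ₀ .prop) : Dom Γ₀ .prop :=
  eval (IsSemidec v0) (a ∷ Env.nil)

@[simp] theorem eval_isBinary (f : Tm Γ (.nat ⇒ₜ .nat)) (ρ : Env Γ₀ Γ) :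
    eval (IsBinary f) ρ = (eval f ρ).isBinary := eval_sub₁ (IsBinary v0) f ρ

@[simp] theorem eval_isSemidec (φ : Fm Γ) (ρ : Env Γ₀ Γ) :
    eval (IsSemidec φ) ρ = (eval φ ρ).semidec := eval_sub₁ (IsSemidec v0) φ ρ

theorem forces_isBinary {f : Dom Γ₀ (.nat ⇒ₜ .nat)} :
    p ⊩ f.isBinary ↔ ∀ n, p ⊩ f ⬝ᵈ n ≐ 0 ∨ᵈ f ⬝ᵈ n ≐ 1 := by
  simp only [Dom.isBinary, IsBinary, forces_all, eval_or, eval_eqₒ, eval_app, eval_wk, eval_var,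
    Env.cons_here, eval_zero, eval_succ, Dom.zero_eq, Dom.succ_eq, zero_add]

/-- The sequence `f` contains a one. -/
noncomputable def Dom.hits (f : Dom Γ₀ (.nat ⇒ₜ .nat)) : Dom Γ₀ .prop :=
  eval (ex_ .nat fun n => v1 ⬝ n =ₒ .succ .zero) (f ∷ Env.nil)

theorem forces_hits {f : Dom Γ₀ (.nat ⇒ₜ .nat)} :
    p ⊩ f.hits ↔ LEx p fun r n => r ⊩ f ⬝ᵈ n ≐ 1 := by
  simp only [Dom.hits, forces_ex, eval_eqₒ, eval_app, eval_var, Env.cons_here, Env.cons_there,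
    eval_zero, eval_succ, Dom.zero_eq, Dom.succ_eq, zero_add]

theorem forces_semidec : p ⊩ a.semidec ↔
    LEx p fun r f => r ⊩ f.isBinary ∧ r ⊩ a ⇨ᵈ f.hits ∧ r ⊩ f.hits ⇨ᵈ a := by
  simp only [Dom.semidec, IsSemidec, forces_ex, eval_and, forces_and, eval_isBinary, eval_var,
    Env.cons_here, eval_imp, eval_wk]
  have : ∀ f, eval (.ex (v0↟ ⬝ .var .here =ₒ .succ .zero)) (f ∷ a ∷ Env.nil) = f.hits := fun f =>
    Dom.prop_ext fun p => by
      simp only [forces_hits, forces_ex, eval_eqₒ, eval_app, eval_var, Env.cons_here, eval_wk,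
        eval_zero, eval_succ, Dom.zero_eq, Dom.succ_eq, zero_add]
  simp only [this]

theorem forces_one_ne_zero {n : Dom Γ₀ .nat} (h : p ⊩ n ≐ 1) (h' : p ⊩ n ≐ 0) : p ⊩ a :=
  forces_add_one_ne_zero (n := 0) (by
    rw [zero_add]
    exact h.symm.trans h')

/-- Markov's principle. -/
theorem markov {f : Dom Γ₀ (.nat ⇒ₜ .nat)} (hf : p ⊩ f.isBinary) (h : p ⊩ f.hits.not.not) :
    p ⊩ f.hits := by
  have := forces_postulate .markovPrinciple p
  simp only [markovPrinciple, forces_all, eval_imp, forces_imp, eval_isBinary, eval_var,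
    Env.cons_here, forces_ex, eval_eqₒ, eval_app, eval_wk, eval_zero, eval_succ,
    Dom.zero_eq, Dom.succ_eq, zero_add, eval_bot] at this
  rw [forces_hits]
  refine this f p hf p fun r _ hr => ?_
  refine (h.up (r := r)).mp (.intro fun t _ ht => ?_)
  exact (forces_hits.1 ht).elim fun u _ n hn => forces_one_ne_zero hn (hr n).up

theorem Forces.binary_dec {f : Dom Γ₀ (.nat ⇒ₜ .nat)} (hf : p ⊩ f.isBinary) (n : Dom Γ₀ .nat) :
    p ⊩ f ⬝ᵈ n ≐ 1 ∨ᵈ (f ⬝ᵈ n ≐ 1).not :=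
  ((forces_isBinary.1 hf) n).orElim
    (fun _ _ h => forces_inr (.intro fun _ _ h' => forces_one_ne_zero h' h.up))
    (fun _ _ h => forces_inl h)

/-- A truth value is semidecidable if some sequence of disjunctions decides it in the limit. -/
theorem semidec_of_or (C : Dom Γ₀ (.nat ⇒ₜ .prop)) (h : ∀ n, p ⊩ a ∨ᵈ C ⬝ᵈ n)
    (h' : ∀ r (_ : Ext r p), r ⊩ a → LEx r fun s n => s ⊩ (C ⬝ᵈ n).not) : p ⊩ a.semidec := by
  -- One disjunct is chosen for every `n`: the value 1 records `a`, the value 0 records `C n`. If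
  -- `a` holds, some `C n` fails, and there the value must be 1.
  have := countable_choice (p := p) ((v0 =ₒ .succ .zero ∧ₒ v3) ∨ₒ (v0 =ₒ .zero ∧ₒ v2 ⬝ v1))
    (C ∷ a ∷ Env.nil) (fun n => ?_)
  · simp only [eval_or, eval_and, eval_eqₒ, eval_app, eval_succ, eval_zero, eval_var,
      Env.cons_here, Env.cons_there, Dom.zero_eq, Dom.succ_eq, zero_add] at this
    refine forces_semidec.2 (this.mono fun r _ f hf => ⟨forces_isBinary.2 fun n => ?_,
      .intro fun s _ ha => ?_, .intro fun s _ hs => ?_⟩)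
    · exact (hf n).orElim (fun _ _ k => forces_inr (forces_and.1 k).1)
        (fun _ _ k => forces_inl (forces_and.1 k).1)
    · refine forces_hits.2 ((h' s inferInstance ha).mono fun t _ n hn => ?_)
      exact ((hf n).up (r := t)).orElim (fun _ _ k => (forces_and.1 k).1)
        (fun _ _ k => (hn.up.mp (forces_and.1 k).2).absurd)
    · refine (forces_hits.1 hs).elim fun t _ n hn => ((hf n).up (r := t)).orElim
        (fun _ _ k => (forces_and.1 k).2) (fun _ _ k => ?_)
      exact forces_one_ne_zero hn.up (forces_and.1 k).1
  · refine (h n).orElim' (fun r _ k => .intro 1 ?_) (fun r _ k => .intro 0 ?_)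
    · simpa using .inl ⟨forces_rfl 1, k⟩
    · simpa using .inr ⟨forces_rfl 0, k⟩

/-- A decidable predicate on the natural numbers has a characteristic function. -/
theorem exists_char (P : Dom Γ₀ (.nat ⇒ₜ .prop)) (h : ∀ n, p ⊩ P ⬝ᵈ n ∨ᵈ (P ⬝ᵈ n).not) :
    LEx p fun r f => r ⊩ f.isBinary ∧ ∀ n, r ⊩ P ⬝ᵈ n ⇨ᵈ f ⬝ᵈ n ≐ 1 ∧ r ⊩ f ⬝ᵈ n ≐ 1 ⇨ᵈ P ⬝ᵈ n := by
  have := countable_choice (p := p) ((v0 =ₒ .succ .zero ∧ₒ v2 ⬝ v1) ∨ₒ (v0 =ₒ .zero ∧ₒ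
    not_ (v2 ⬝ v1))) (P ∷ Env.nil) (fun n => ?_)
  · simp only [eval_or, eval_and, eval_eqₒ, eval_app, eval_succ, eval_zero, eval_var, eval_imp,
      Env.cons_here, Env.cons_there, Dom.zero_eq, Dom.succ_eq, zero_add, eval_bot] at this
    refine this.mono fun r _ f hf => ⟨forces_isBinary.2 fun n => ?_,
      fun n => ⟨.intro fun s _ ha => ?_, .intro fun s _ hs => ?_⟩⟩
    · exact (hf n).orElim (fun _ _ k => forces_inr (forces_and.1 k).1)
        (fun _ _ k => forces_inl (forces_and.1 k).1)
    · exact ((hf n).up (r := s)).orElim (fun _ _ k => (forces_and.1 k).1)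
        (fun _ _ k => ((forces_and.1 k).2.mp ha.up).absurd)
    · exact ((hf n).up (r := s)).orElim (fun _ _ k => (forces_and.1 k).2)
        (fun _ _ k => forces_one_ne_zero hs.up (forces_and.1 k).1)
  · refine (h n).orElim' (fun r _ k => .intro 1 ?_) (fun r _ k => .intro 0 ?_)
    · simpa using .inl ⟨forces_rfl 1, k⟩
    · simpa using .inr ⟨forces_rfl 0, forces_imp.1 k⟩

end SynthComp

namespace SynthComp

variable {Γ₀ Γ : Ctx} {A B C : Ty} {p q r a b c : Dom Γ₀ .prop}

/-! ### Bounded search -/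

theorem Forces.nlt_succ {k n : Dom Γ₀ .nat} (h : p ⊩ k.nlt (n + 1)) : p ⊩ k.nlt n ∨ᵈ k ≐ n := by
  refine (forces_nle_total n k).orElim (fun r _ h' => forces_inr (Forces.nle_antisymm ?_ h'))
    fun r _ h' => forces_inl h'
  refine (forces_nle.1 h.up).elim fun s _ l hl => forces_nle.2 (.intro l ?_)
  rw [add_right_comm] at hl
  exact hl.add_right_cancel

theorem forces_nlt_add (m n : Dom Γ₀ .nat) : p ⊩ m.nlt (m + n + 1) := by
  rw [Dom.nlt, add_right_comm]
  exact forces_nle_add _ _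

theorem Forces.nlt_of_nlt_of_nle {k m n : Dom Γ₀ .nat} (h : p ⊩ k.nlt m) (h' : p ⊩ m.nle n) :
    p ⊩ k.nlt n := Forces.nle_trans h h'

theorem Forces.nlt_zero {k : Dom Γ₀ .nat} (h : p ⊩ k.nlt 0) : p ⊩ a :=
  Forces.nlt_irrefl (x := 0) (y := k) (by simpa using forces_nle_add 0 k) h

/-- Some `k < n` satisfies `P`. -/
noncomputable def Dom.bex (P : Dom Γ₀ (.nat ⇒ₜ .prop)) (n : Dom Γ₀ .nat) : Dom Γ₀ .prop :=
  eval (.ex (natLt v0 v1 ∧ₒ v2 ⬝ v0)) (n ∷ P ∷ Env.nil)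

theorem forces_bex {P : Dom Γ₀ (.nat ⇒ₜ .prop)} {n : Dom Γ₀ .nat} :
    p ⊩ P.bex n ↔ LEx p fun r k => r ⊩ k.nlt n ∧ r ⊩ P ⬝ᵈ k := by
  simp [Dom.bex]

theorem dec_bex {P : Dom Γ₀ (.nat ⇒ₜ .prop)} (h : ∀ n, p ⊩ P ⬝ᵈ n ∨ᵈ (P ⬝ᵈ n).not)
    (n : Dom Γ₀ .nat) : p ⊩ P.bex n ∨ᵈ (P.bex n).not := by
  have e : ∀ n, eval (.ex (natLt v0 v1 ∧ₒ v2 ⬝ v0)) (n ∷ P ∷ Env.nil) = P.bex n := fun n => rfl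
  have := forces_ind (p := p) (.ex (natLt v0 v1 ∧ₒ v2 ⬝ v0) ∨ₒ
    not_ (.ex (natLt v0 v1 ∧ₒ v2 ⬝ v0))) (P ∷ Env.nil) ?_ ?_ n
  · simpa only [eval_or, eval_imp, eval_bot, e] using this
  · simp only [eval_or, eval_imp, eval_bot, e, Dom.zero_eq]
    exact forces_inr (.intro fun r _ h => (forces_bex.1 h).elim fun s _ k hk => hk.1.nlt_zero)
  · intro n r _ hn
    simp only [eval_or, eval_imp, eval_bot, e, Dom.succ_eq] at hn ⊢
    refine hn.orElim (fun s _ hn => forces_inl ?_) fun s _ hn => ((h n).up (r := s)).orElim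
      (fun t _ k => forces_inl ?_) fun t _ k => forces_inr (.intro fun u _ hu => ?_)
    · exact forces_bex.2 ((forces_bex.1 hn).mono fun t _ k hk =>
        ⟨hk.1.nlt_of_nlt_of_nle (forces_nle_add n 1), hk.2⟩)
    · exact forces_bex.2 (.intro n ⟨by simpa using forces_nlt_add n 0, k⟩)
    · refine (forces_bex.1 hu).elim fun v _ l hl => hl.1.nlt_succ.orElim
        (fun w _ hw => ?_) (fun w _ hw => ?_)
      · exact hn.up.mp (forces_bex.2 (.intro l ⟨hw, hl.2⟩))
      · exact k.up.mp ((Forces.app_congr (forces_rfl P) hw).eq_mp hl.2.up)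

theorem dec_and (ha : p ⊩ a ∨ᵈ a.not) (hb : p ⊩ b ∨ᵈ b.not) :
    p ⊩ (a ∧ᵈ b) ∨ᵈ (a ∧ᵈ b).not :=
  ha.orElim (fun r _ ha => (hb.up (r := r)).orElim
      (fun _ _ hb => forces_inl (forces_and.2 ⟨ha, hb⟩))
      (fun _ _ hb => forces_inr (.intro fun _ _ h => hb.up.mp (forces_and.1 h).2)))
    (fun _ _ ha => forces_inr (.intro fun _ _ h => ha.up.mp (forces_and.1 h).1))

/-- Markov's principle for decidable predicates. -/
theorem markov_dec {P : Dom Γ₀ (.nat ⇒ₜ .prop)} (h : ∀ n, p ⊩ P ⬝ᵈ n ∨ᵈ (P ⬝ᵈ n).not)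
    (h' : ∀ r (_ : Ext r p), (∀ n s (_ : Ext s r), s ⊩ P ⬝ᵈ n → s ⊩ .bot) → r ⊩ .bot) :
    LEx p fun r n => r ⊩ P ⬝ᵈ n := by
  refine (exists_char P h).bind fun r _ f hf => ?_
  have := markov hf.1 (.intro fun s _ hs => h' s inferInstance fun n t _ hn =>
    hs.up.mp (forces_hits.2 (.intro n ((hf.2 n).1.up.mp hn))))
  exact (forces_hits.1 this).mono fun s _ n hn => (hf.2 n).2.up.mp hn

/-- `R` and `S` have a common element. -/
noncomputable def Dom.meets (R S : Dom Γ₀ (.nat ⇒ₜ .prop)) : Dom Γ₀ .prop :=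
  eval (.ex (v1 ⬝ v0 ∧ₒ v2 ⬝ v0)) (R ∷ S ∷ Env.nil)

theorem forces_meets {R S : Dom Γ₀ (.nat ⇒ₜ .prop)} :
    p ⊩ R.meets S ↔ LEx p fun r n => r ⊩ R ⬝ᵈ n ∧ r ⊩ S ⬝ᵈ n := by
  simp [Dom.meets]

/-- A sequence of semidecidable truth values has a sequence of witnesses. -/
theorem exists_semidec_seq {R : Dom Γ₀ (.nat ⇒ₜ .prop)} (h : ∀ n, p ⊩ (R ⬝ᵈ n).semidec) :
    LEx p fun r F => ∀ n, r ⊩ (F ⬝ᵈ n).isBinary ∧ r ⊩ R ⬝ᵈ n ⇨ᵈ (F ⬝ᵈ n).hits ∧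
      r ⊩ (F ⬝ᵈ n).hits ⇨ᵈ R ⬝ᵈ n := by
  have e : ∀ (f : Dom Γ₀ (.nat ⇒ₜ .nat)) (n : Dom Γ₀ .nat),
      eval (.ex (v1 ⬝ v0 =ₒ .succ .zero)) (f ∷ n ∷ R ∷ Env.nil) = f.hits := fun f n =>
    Dom.prop_ext fun p => by simp [forces_hits]
  have := countable_choice (p := p) (IsBinary v0 ∧ₒ (v2 ⬝ v1 →ₒ .ex (v1 ⬝ v0 =ₒ .succ .zero)) ∧ₒ
    (.ex (v1 ⬝ v0 =ₒ .succ .zero) →ₒ v2 ⬝ v1)) (R ∷ Env.nil) (fun n => ?_)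
  · simpa only [eval_and, forces_and, eval_imp, e, eval_isBinary, eval_app, eval_var,
      Env.cons_here, Env.cons_there] using this
  · simpa only [eval_and, forces_and, eval_imp, e, eval_isBinary, eval_app, eval_var,
      Env.cons_here, Env.cons_there] using forces_semidec.1 (h n)

/-- A common element with both semidecision witnesses below a bound `n` can be searched for
decidably, so Markov's principle removes the double negation. -/
theorem meets_stable {R S : Dom Γ₀ (.nat ⇒ₜ .prop)} (hR : ∀ n, p ⊩ (R ⬝ᵈ n).semidec)
    (hS : ∀ n, p ⊩ (S ⬝ᵈ n).semidec) (h : p ⊩ (R.meets S).not.not) : p ⊩ R.meets S := by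
  refine (exists_semidec_seq hR).elim fun r _ F hF =>
    (exists_semidec_seq (p := r) (fun n => (hS n).up)).elim fun s _ G hG => forces_meets.2 ?_
  let one (F : Dom Γ₀ (.nat ⇒ₜ .nat ⇒ₜ .nat)) (m : Dom Γ₀ .nat) : Dom Γ₀ (.nat ⇒ₜ .prop) :=
    eval (.lam (v2 ⬝ v1 ⬝ v0 =ₒ .succ .zero)) (m ∷ F ∷ Env.nil)
  have hone : ∀ F m n, one F m ⬝ᵈ n = (F ⬝ᵈ m ⬝ᵈ n ≐ 1) := fun F m n => by simp [one]
  let both (n : Dom Γ₀ .nat) : Dom Γ₀ (.nat ⇒ₜ .prop) :=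
    eval (.lam ((.ex (natLt v0 v2 ∧ₒ v3 ⬝ v1 ⬝ v0 =ₒ .succ .zero)) ∧ₒ
      (.ex (natLt v0 v2 ∧ₒ v4 ⬝ v1 ⬝ v0 =ₒ .succ .zero)))) (n ∷ F ∷ G ∷ Env.nil)
  have hboth : ∀ n m, both n ⬝ᵈ m = ((one F m).bex n ∧ᵈ (one G m).bex n) := fun n m =>
    Dom.prop_ext fun p => by simp [both, forces_bex, hone]
  let P : Dom Γ₀ (.nat ⇒ₜ .prop) := eval (.lam (.ex (natLt v0 v1 ∧ₒ
    ((.ex (natLt v0 v2 ∧ₒ v3 ⬝ v1 ⬝ v0 =ₒ .succ .zero)) ∧ₒ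
      (.ex (natLt v0 v2 ∧ₒ v4 ⬝ v1 ⬝ v0 =ₒ .succ .zero)))))) (F ∷ G ∷ Env.nil)
  have hP : ∀ n, P ⬝ᵈ n = (both n).bex n := fun n =>
    Dom.prop_ext fun p => by simp [P, forces_bex, hboth, hone]
  have dec : ∀ n, s ⊩ P ⬝ᵈ n ∨ᵈ (P ⬝ᵈ n).not := fun n => by
    rw [hP]
    refine dec_bex (fun m => ?_) n
    rw [hboth]
    refine dec_and (dec_bex (fun k => ?_) n) (dec_bex (fun k => ?_) n)
    · rw [hone]
      exact (hF m).1.up.binary_dec k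
    · rw [hone]
      exact (hG m).1.binary_dec k
  refine (markov_dec dec fun t _ ht => ?_).bind fun t _ n hn => ?_
  · refine (h.up (r := t)).mp (.intro fun u _ hu => ?_)
    refine (forces_meets.1 hu).elim fun v _ m hm =>
      (forces_hits.1 ((hF m).2.1.up.mp hm.1)).elim fun w _ k hk =>
      (forces_hits.1 ((hG m).2.1.up.mp hm.2.up)).elim fun x _ l hl => ?_
    -- The bound exceeds the common element `m` and the two positions `k` and `l` of a one.
    refine ht (m + (k + l) + 1) x inferInstance ?_
    rw [hP]
    refine forces_bex.2 (.intro m ⟨forces_nlt_add _ _, ?_⟩)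
    rw [hboth]
    refine forces_and.2 ⟨forces_bex.2 (.intro k ⟨?_, ?_⟩), forces_bex.2 (.intro l ⟨?_, ?_⟩)⟩
    · rw [add_left_comm]
      exact forces_nlt_add _ _
    · rw [hone]
      exact hk.up
    · rw [add_comm k, add_left_comm]
      exact forces_nlt_add _ _
    · rw [hone]
      exact hl
  · rw [hP] at hn
    refine (forces_bex.1 hn).bind fun u _ m hm => .intro m ?_
    have hm := hm.2
    rw [hboth] at hm
    have hm := forces_and.1 hm
    refine ⟨(hF m).2.2.up.mp (forces_hits.2 ((forces_bex.1 hm.1).mono fun v _ k hk => ?_)),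
      (hG m).2.2.up.mp (forces_hits.2 ((forces_bex.1 hm.2).mono fun v _ k hk => ?_))⟩
    · rw [← hone]
      exact hk.2
    · rw [← hone]
      exact hk.2

/-! ### First hits -/

/-- `f` has no one before `n`. -/
noncomputable def Dom.clear (f : Dom Γ₀ (.nat ⇒ₜ .nat)) (n : Dom Γ₀ .nat) : Dom Γ₀ .prop :=
  eval (.all (natLt v0 v1 →ₒ not_ (v2 ⬝ v0 =ₒ .succ .zero))) (n ∷ f ∷ Env.nil)

/-- The first one of `f` is at `n`. -/
noncomputable def Dom.first (f : Dom Γ₀ (.nat ⇒ₜ .nat)) (n : Dom Γ₀ .nat) : Dom Γ₀ .prop :=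
  f ⬝ᵈ n ≐ 1 ∧ᵈ f.clear n

/-- The formula saying that `f` has no one before `n`. -/
def clearFm (f : Tm Γ (.nat ⇒ₜ .nat)) (n : Tm Γ .nat) : Fm Γ :=
  .all (natLt v0 n↟ →ₒ not_ (f↟ ⬝ v0 =ₒ .succ .zero))

/-- The formula saying that the first one of `f` is at `n`. -/
def firstFm (f : Tm Γ (.nat ⇒ₜ .nat)) (n : Tm Γ .nat) : Fm Γ :=
  f ⬝ n =ₒ .succ .zero ∧ₒ clearFm f n

@[simp] theorem eval_clearFm (f : Tm Γ (.nat ⇒ₜ .nat)) (n : Tm Γ .nat) (ρ : Env Γ₀ Γ) :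
    eval (clearFm f n) ρ = (eval f ρ).clear (eval n ρ) :=
  Dom.prop_ext fun p => by simp only [clearFm, Dom.clear, forces_all, eval_imp, eval_natLt,
    eval_var, eval_wk, Env.cons_here, Env.cons_there, eval_eqₒ, eval_app, eval_zero, eval_succ,
    eval_bot]

@[simp] theorem eval_firstFm (f : Tm Γ (.nat ⇒ₜ .nat)) (n : Tm Γ .nat) (ρ : Env Γ₀ Γ) :
    eval (firstFm f n) ρ = (eval f ρ).first (eval n ρ) := by
  simp [firstFm, Dom.first]

theorem forces_clear {f : Dom Γ₀ (.nat ⇒ₜ .nat)} {n : Dom Γ₀ .nat} :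
    p ⊩ f.clear n ↔ ∀ k, p ⊩ k.nlt n ⇨ᵈ (f ⬝ᵈ k ≐ 1).not := by
  simp only [Dom.clear, forces_all, eval_imp, eval_natLt, eval_bot,
    eval_var, Env.cons_here, Env.cons_there, eval_eqₒ, eval_app, eval_zero, eval_succ,
    Dom.zero_eq, Dom.succ_eq, zero_add]

theorem forces_first {f : Dom Γ₀ (.nat ⇒ₜ .nat)} {n : Dom Γ₀ .nat} :
    p ⊩ f.first n ↔ p ⊩ f ⬝ᵈ n ≐ 1 ∧ p ⊩ f.clear n := forces_and

theorem first_unique {f : Dom Γ₀ (.nat ⇒ₜ .nat)} {m n : Dom Γ₀ .nat} (hm : p ⊩ f.first m)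
    (hn : p ⊩ f.first n) : p ⊩ m ≐ n := by
  rw [forces_first, forces_clear] at hm hn
  refine (forces_nle_total m n).orElim (fun r _ h => ?_) fun r _ h =>
    (((hm.2 n).up.mp h).mp hn.1.up).absurd
  refine (forces_nle_total n m).orElim (fun s _ h' => h.up.nle_antisymm h') fun s _ h =>
    (((hn.2 m).up.mp h).mp hm.1.up).absurd

/-- Either `f` has no one before `n`, or there is a first one before `n`. -/
theorem clear_or_first {f : Dom Γ₀ (.nat ⇒ₜ .nat)} (hf : p ⊩ f.isBinary) (n : Dom Γ₀ .nat) :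
    LOr p (fun r => r ⊩ f.clear n) fun r => LEx r fun s i => s ⊩ i.nlt n ∧ s ⊩ f.first i := by
  have := forces_ind (p := p) (clearFm v1 v0 ∨ₒ .ex (natLt v0 v1 ∧ₒ firstFm v2 v0))
    (f ∷ Env.nil) ?_ ?_ n
  · simpa using this
  · simp only [eval_or, eval_clearFm, eval_var, Env.cons_here, Env.cons_there, Dom.zero_eq]
    exact forces_inl (forces_clear.2 fun k => .intro fun r _ h => h.nlt_zero)
  · intro n r _ hn
    simp only [forces_or, eval_or, eval_clearFm, eval_firstFm, forces_ex, eval_and, forces_and,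
      eval_natLt, eval_var, Env.cons_here, Env.cons_there, Dom.succ_eq] at hn ⊢
    intro c k l
    refine hn.elim (fun s _ hn => (hf.up.binary_dec n).orElim
      (fun t _ ht => l t inferInstance (.intro n ⟨by simpa using forces_nlt_add n 0,
        forces_first.2 ⟨ht, hn.up⟩⟩))
      (fun t _ ht => k t inferInstance (forces_clear.2 fun i => .intro fun u _ hu =>
        hu.nlt_succ.orElim (fun v _ hv => (forces_clear.1 hn.up i).mp hv)
          (fun v _ hv => .intro fun w _ hw => ht.up.mp ?_)))) fun s _ hn => ?_
    · exact (Forces.app_congr (forces_rfl f) hv.up).symm.trans hw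
    · exact l s inferInstance (hn.mono fun t _ i hi =>
        ⟨hi.1.nlt_of_nlt_of_nle (forces_nle_add n 1), hi.2⟩)

theorem exists_first {f : Dom Γ₀ (.nat ⇒ₜ .nat)} (hf : p ⊩ f.isBinary) (h : p ⊩ f.hits) :
    LEx p fun r i => r ⊩ f.first i :=
  (forces_hits.1 h).bind fun r _ n hn => (clear_or_first (p := r) hf.up n).bind
    (fun _ _ hs => .intro n (forces_first.2 ⟨hn, hs⟩))
    (fun _ _ hs => hs.mono fun _ _ _ hi => hi.2)

theorem dec_first {f : Dom Γ₀ (.nat ⇒ₜ .nat)} (hf : p ⊩ f.isBinary) (n : Dom Γ₀ .nat) :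
    p ⊩ f.first n ∨ᵈ (f.first n).not :=
  (hf.binary_dec n).orElim
    (fun r _ h => (clear_or_first (p := r) hf.up n).elim
      (fun s _ hs => forces_inl (forces_first.2 ⟨h, hs⟩))
      (fun s _ hs => forces_inr (.intro fun t _ ht => (hs.elim (c := t ⇨ᵈ .bot) fun u _ i hi =>
        .intro fun v _ hv => by
          have : Ext v t := ⟨hv⟩
          exact ((forces_clear.1 (forces_first.1 ht).2 i).up.mp hi.1.up).mp
            (forces_first.1 hi.2).1.up).up.mp (forces_refl t))))
    (fun r _ h => forces_inr (.intro fun s _ hs => h.up.mp (forces_first.1 hs).1))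

end SynthComp

/-! ### Diagonalisation from enumerability and stable subspaces. -/

namespace SynthComp

variable {Γ₀ Γ : Ctx} {A B C : Ty} {p q r a b c : Dom Γ₀ .prop}

theorem forces_enumerability (p : Dom Γ₀ .prop) :
    LEx p fun r (W : Dom Γ₀ (.nat ⇒ₜ .nat ⇒ₜ .prop)) => (∀ n i, r ⊩ (W ⬝ᵈ n ⬝ᵈ i).semidec) ∧
      ∀ S s (_ : Ext s r), (∀ i, s ⊩ (S ⬝ᵈ i).semidec) → LEx s fun t n => t ⊩ W ⬝ᵈ n ≐ S := by
  have := forces_postulate .enumerability p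
  simp only [enumerability, IsSemidecSet, forces_ex, eval_and, forces_and, forces_all, eval_imp,
    eval_isSemidec, eval_app, eval_wk, eval_var, Env.cons_here, eval_eqₒ,
    forces_imp] at this
  exact this

theorem forces_stableSubspace {X S : Dom Γ₀ (.nat ⇒ₜ .prop)}
    (hX : ∀ n r (_ : Ext r p), r ⊩ (X ⬝ᵈ n).not.not → r ⊩ X ⬝ᵈ n)
    (hS : ∀ n r (_ : Ext r p), r ⊩ X ⬝ᵈ n → r ⊩ (S ⬝ᵈ n).semidec) :
    LEx p fun r (V : Dom Γ₀ (.nat ⇒ₜ .prop)) => (∀ n, r ⊩ (V ⬝ᵈ n).semidec) ∧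
      ∀ n s (_ : Ext s r), s ⊩ X ⬝ᵈ n → s ⊩ V ⬝ᵈ n ⇨ᵈ S ⬝ᵈ n ∧ s ⊩ S ⬝ᵈ n ⇨ᵈ V ⬝ᵈ n := by
  have h₁ : ∀ n, p ⊩ (X ⬝ᵈ n).not.not ⇨ᵈ X ⬝ᵈ n := fun n => .intro (hX n)
  have h₂ : ∀ n, p ⊩ X ⬝ᵈ n ⇨ᵈ (S ⬝ᵈ n).semidec := fun n => .intro (hS n)
  have h₃ := forces_postulate .stableSubspace p
  simp only [stableSubspace, forces_all, eval_imp] at h₃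
  have h₄ := (h₃ X).mp (by simpa using h₁)
  simp only [forces_all, eval_imp] at h₄
  have h₅ := (h₄ S).mp (by
    simpa only [forces_all, eval_imp, eval_isSemidec, eval_app, eval_wk, eval_var, Env.cons_here]
      using h₂)
  simp only [IsSemidecSet, forces_ex, eval_and, forces_and, forces_all, eval_imp,
    eval_isSemidec, eval_app, eval_wk, eval_var, Env.cons_here] at h₅
  exact h₅.mono fun r _ V hV => ⟨hV.1, fun n s _ hs => forces_and.1 (forces_imp.1 (hV.2 n) s hs)⟩

/-- If for every binary sequence whose first one lies in the stable set `Q` it is semidecidable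
that it vanishes, then `Q` has a counterexample. -/
theorem exists_not_of_semidec_vanishing {Q : Dom Γ₀ (.nat ⇒ₜ .prop)}
    (hQ : ∀ i r (_ : Ext r p), r ⊩ (Q ⬝ᵈ i).not.not → r ⊩ Q ⬝ᵈ i)
    (H : ∀ (f : Dom Γ₀ (.nat ⇒ₜ .nat)) r (_ : Ext r p), r ⊩ f.isBinary → (∀ i, r ⊩ f.first i ⇨ᵈ Q ⬝ᵈ i) →
      r ⊩ f.hits.not.semidec) :
    LEx p fun r i => r ⊩ (Q ⬝ᵈ i).not := by
  refine (forces_enumerability p).bind fun r _ W hW => ?_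
  -- The diagonal set `{n | n ∈ W n}`; below, `g n` is a binary sequence that has a one exactly if
  -- `n` belongs to it.
  set R : Dom Γ₀ (.nat ⇒ₜ .prop) := eval (.lam (v1 ⬝ v0 ⬝ v0)) (W ∷ Env.nil) with hR
  have hR : ∀ n, R ⬝ᵈ n = W ⬝ᵈ n ⬝ᵈ n := fun n => by simp [R]
  refine (exists_semidec_seq (p := r) (R := R) (fun n => by rw [hR]; exact hW.1 n n)).bind
    fun s _ g hg => ?_
  -- The indices to whose sequence `g n` the hypothesis `H` applies. Stability of `Q` passes to `X`,
  -- whose definition uses only ∀ and → in front of `Q`.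
  set X : Dom Γ₀ (.nat ⇒ₜ .prop) := eval (.lam (.all (firstFm (v2 ⬝ v1) v0 →ₒ v3 ⬝ v0)))
    (g ∷ Q ∷ Env.nil) with hX
  have hX : ∀ p n, p ⊩ X ⬝ᵈ n ↔ ∀ i, p ⊩ (g ⬝ᵈ n).first i ⇨ᵈ Q ⬝ᵈ i := fun p n => by
    simp only [X, app_lam, forces_all, eval_imp, eval_firstFm, eval_app, eval_var, Env.cons_here,
      Env.cons_there]
  set S : Dom Γ₀ (.nat ⇒ₜ .prop) := eval (.lam (not_ (ex_ .nat fun n => v2 ⬝ v1 ⬝ n =ₒ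
    .succ .zero))) (g ∷ Env.nil) with hS
  have hS : ∀ n, S ⬝ᵈ n = (g ⬝ᵈ n).hits.not := fun n => by
    refine Dom.prop_ext fun p => ?_
    simp [S, forces_hits]
  refine (forces_stableSubspace (p := s) (X := X) (S := S) (fun n t _ ht => ?_)
    (fun n t _ ht => ?_)).bind fun t _ V hV => (hW.2 V t inferInstance hV.1).bind fun u _ v hv => ?_
  · refine (hX t n).2 fun i => .intro fun u _ hu => hQ i u inferInstance
      (.intro fun x _ hx => (ht.up (r := x)).mp (.intro fun y _ hy => ?_))
    exact hx.up.mp (((hX y n).1 hy i).mp hu.up)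
  · rw [hS]
    exact H _ t inferInstance (hg n).1.up ((hX t n).1 ht)
  have hWV : ∀ x (_ : Ext x u), x ⊩ V ⬝ᵈ v → x ⊩ (g ⬝ᵈ v).hits := fun x _ hx => by
    refine (hg v).2.1.up.mp ?_
    rw [hR]
    exact (Forces.app_congr hv (forces_rfl v)).symm.up.eq_mp hx
  have hVW : ∀ x (_ : Ext x u), x ⊩ (g ⬝ᵈ v).hits → x ⊩ V ⬝ᵈ v := fun x _ hx => by
    have := (hg v).2.2.up.mp hx
    rw [hR] at this
    exact (Forces.app_congr hv (forces_rfl v)).up.eq_mp this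
  -- If `v ∈ X`, then `v ∈ W v` is equivalent to `v ∈ V`, hence to `v ∉ W v`.
  have hnot : ∀ x (_ : Ext x u), x ⊩ X ⬝ᵈ v → x ⊩ .bot := fun x _ hx => by
    have h := hV.2 v x inferInstance hx
    rw [hS] at h
    have h₁ : x ⊩ (g ⬝ᵈ v).hits.not := .intro fun y _ hy =>
      (h.1.up.mp (hVW y inferInstance hy)).mp hy
    exact h₁.mp (hWV x inferInstance (h.2.mp h₁))
  -- Were `g v` zero throughout, `v` would lie in `X` vacuously. So Markov provides a one, and if
  -- the position of the first were in `Q`, uniqueness of the first one would put `v` into `X`.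
  have hhits : u ⊩ (g ⬝ᵈ v).hits := markov (hg v).1.up (.intro fun x _ hx =>
    hnot x inferInstance ((hX x v).2 fun i => .intro fun y _ hy =>
      (hx.up.mp (forces_hits.2 (.intro i (forces_first.1 hy).1))).absurd))
  refine (exists_first (hg v).1.up hhits).mono fun x _ i hi => .intro fun y _ hy =>
    hnot y inferInstance ((hX y v).2 fun j => .intro fun z _ hz => ?_)
  exact (Forces.app_congr (forces_rfl Q) (first_unique hi.up hz)).eq_mp hy.up

end SynthComp

namespace SynthComp

variable {Γ₀ Γ : Ctx} {A B C : Ty} {p q r a b c : Dom Γ₀ .prop}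

theorem Forces.semidec_congr (h : ∀ r (_ : Ext r p), r ⊩ a → r ⊩ b)
    (h' : ∀ r (_ : Ext r p), r ⊩ b → r ⊩ a) (ha : p ⊩ a.semidec) : p ⊩ b.semidec :=
  forces_subst (IsSemidec v0) Env.nil (forces_propext h h') ha

/-! ### Real numbers -/

namespace Dom

/-- `q` lies in the lower set of `X`. -/
noncomputable def below (X : Dom Γ₀ cut) (q : Dom Γ₀ rat) : Dom Γ₀ .prop := X.fst ⬝ᵈ q

/-- `q` lies in the upper set of `X`. -/
noncomputable def above (X : Dom Γ₀ cut) (q : Dom Γ₀ rat) : Dom Γ₀ .prop := X.snd ⬝ᵈ q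

/-- `X` is a real number. -/
noncomputable def isReal (X : Dom Γ₀ cut) : Dom Γ₀ .prop := eval (IsReal v0) (X ∷ Env.nil)

/-- `X < Y`. -/
noncomputable def rlt (X Y : Dom Γ₀ cut) : Dom Γ₀ .prop :=
  eval (realLt v1 v0) (Y ∷ X ∷ Env.nil)

/-- `X` is a positive real number. -/
noncomputable def isPosReal (X : Dom Γ₀ cut) : Dom Γ₀ .prop := eval (IsPosReal v0) (X ∷ Env.nil)

/-- The real number `0`. -/
noncomputable def rzero : Dom Γ₀ cut := eval realZero Env.nil

/-- A rational number as a real number. -/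
noncomputable def realOf (q : Dom Γ₀ rat) : Dom Γ₀ cut :=
  eval (.pair (.lam (ratLt v0 v1)) (.lam (ratLt v1 v0))) (q ∷ Env.nil)

@[simp] theorem below_realOf (q r : Dom Γ₀ rat) : (realOf q).below r = r.qlt q := by
  simp [realOf, below]

@[simp] theorem above_realOf (q r : Dom Γ₀ rat) : (realOf q).above r = q.qlt r := by
  simp [realOf, above]

@[simp] theorem below_rzero (r : Dom Γ₀ rat) : rzero.below r = r.qlt qzero := by
  simp [rzero, below, realZero]

@[simp] theorem above_rzero (r : Dom Γ₀ rat) : rzero.above r = qzero.qlt r := by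
  simp [rzero, above, realZero]

end Dom

section

variable (X Y : Tm Γ cut) (ρ : Env Γ₀ Γ)

@[simp] theorem eval_below (q : Tm Γ rat) : eval (below X q) ρ = (eval X ρ).below (eval q ρ) := by
  simp [Dom.below, below]

@[simp] theorem eval_above (q : Tm Γ rat) : eval (above X q) ρ = (eval X ρ).above (eval q ρ) := by
  simp [Dom.above, above]

@[simp] theorem eval_isReal : eval (IsReal X) ρ = (eval X ρ).isReal :=
  eval_sub₁ (IsReal v0) X ρ

@[simp] theorem eval_realLt : eval (realLt X Y) ρ = (eval X ρ).rlt (eval Y ρ) :=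
  eval_sub₂ (realLt v1 v0) X Y ρ

@[simp] theorem eval_isPosReal : eval (IsPosReal X) ρ = (eval X ρ).isPosReal :=
  eval_sub₁ (IsPosReal v0) X ρ

@[simp] theorem eval_realZero : eval realZero ρ = Dom.rzero := eval_sub_nil realZero ρ

end

variable {X Y : Dom Γ₀ cut} {x y z : Dom Γ₀ rat}

theorem forces_rlt : p ⊩ X.rlt Y ↔ LEx p fun r q => r ⊩ X.above q ∧ r ⊩ Y.below q := by
  simp [Dom.rlt, realLt]

theorem forces_isPosReal : p ⊩ X.isPosReal ↔
    p ⊩ X.isReal ∧ LEx p fun r q => r ⊩ Dom.qzero.qlt q ∧ r ⊩ X.below q := by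
  simp [Dom.isPosReal, IsPosReal, forces_rlt]

theorem forces_isReal : p ⊩ X.isReal ↔ (LEx p fun r q => r ⊩ X.below q) ∧
    (LEx p fun r q => r ⊩ X.above q) ∧
    (∀ q, p ⊩ X.below q ⇨ᵈ eval (.ex (ratLt v1 v0 ∧ₒ below v2 v0)) (q ∷ X ∷ Env.nil) ∧
      p ⊩ eval (.ex (ratLt v1 v0 ∧ₒ below v2 v0)) (q ∷ X ∷ Env.nil) ⇨ᵈ X.below q) ∧
    (∀ q, p ⊩ X.above q ⇨ᵈ eval (.ex (ratLt v0 v1 ∧ₒ above v2 v0)) (q ∷ X ∷ Env.nil) ∧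
      p ⊩ eval (.ex (ratLt v0 v1 ∧ₒ above v2 v0)) (q ∷ X ∷ Env.nil) ⇨ᵈ X.above q) ∧
    (∀ q, p ⊩ (X.below q ∧ᵈ X.above q).not) ∧
    ∀ q r, p ⊩ q.qlt r ⇨ᵈ X.below q ∨ᵈ X.above r := by
  simp only [Dom.isReal, IsReal, eval_and, forces_and, forces_ex, forces_all, eval_imp, eval_bot,
    eval_or, eval_below, eval_above, eval_wk, eval_var, Env.cons_here, eval_ratLt]
  rfl

theorem Forces.below_of_lt (h : p ⊩ X.isReal) (hy : p ⊩ X.below y) (hxy : p ⊩ x.qlt y) :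
    p ⊩ X.below x :=
  ((forces_isReal.1 h).2.2.1 x).2.mp (by simpa using LEx.intro y ⟨hxy, hy⟩)

theorem Forces.above_of_lt (h : p ⊩ X.isReal) (hx : p ⊩ X.above x) (hxy : p ⊩ x.qlt y) :
    p ⊩ X.above y :=
  ((forces_isReal.1 h).2.2.2.1 y).2.mp (by simpa using LEx.intro x ⟨hxy, hx⟩)

theorem Forces.below_rounded (h : p ⊩ X.isReal) (hx : p ⊩ X.below x) :
    LEx p fun r y => r ⊩ x.qlt y ∧ r ⊩ X.below y := by
  simpa using ((forces_isReal.1 h).2.2.1 x).1.mp hx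

theorem Forces.above_rounded (h : p ⊩ X.isReal) (hy : p ⊩ X.above y) :
    LEx p fun r x => r ⊩ x.qlt y ∧ r ⊩ X.above x := by
  simpa using ((forces_isReal.1 h).2.2.2.1 y).1.mp hy

theorem Forces.disjoint (h : p ⊩ X.isReal) (hx : p ⊩ X.below x) (hx' : p ⊩ X.above x) : p ⊩ a :=
  (((forces_isReal.1 h).2.2.2.2.1 x).mp (forces_and.2 ⟨hx, hx'⟩)).absurd

theorem Forces.located (h : p ⊩ X.isReal) (hxy : p ⊩ x.qlt y) : p ⊩ X.below x ∨ᵈ X.above y :=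
  ((forces_isReal.1 h).2.2.2.2.2 x y).mp hxy

theorem Forces.lt_of_below_of_above (h : p ⊩ X.isReal) (hx : p ⊩ X.below x)
    (hy : p ⊩ X.above y) : p ⊩ x.qlt y :=
  (Forces.below_rounded h hx).elim fun _ _ _ hz => (hz.1.qlt_or y).orElim (fun _ _ k => k)
    fun _ _ k => Forces.disjoint h.up (Forces.below_of_lt h.up hz.2.up k) hy.up

/-- Locatedness offers, for each `n`, either `x` below `X` or `x + 1/(n+1)` above `X`. If `x` is
below, roundedness yields a larger rational below, and the second alternative fails once `x +
1/(n+1)` stays under it. -/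
theorem Forces.semidec_below (h : p ⊩ X.isReal) (x : Dom Γ₀ rat) : p ⊩ (X.below x).semidec := by
  have e : ∀ n, eval (.lam (above v1 (ratAdd v2 (ratInv v0)))) (X ∷ x ∷ Env.nil) ⬝ᵈ n =
      X.above (x.qadd (.inv n)) := fun n => by
    simp only [app_lam, eval_above, eval_ratAdd, eval_ratInv, eval_var, Env.cons_here,
      Env.cons_there]
  refine semidec_of_or (eval (.lam (above v1 (ratAdd v2 (ratInv v0)))) (X ∷ x ∷ Env.nil))
    (fun n => ?_) fun r _ hx => ?_
  · rw [e]
    exact h.located (forces_lt_add_inv _ _)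
  · refine (Forces.below_rounded h.up hx).bind fun s _ y hy => .intro (x.den * y.den) ?_
    rw [e]
    exact .intro fun t _ ht => Forces.disjoint h.up hy.2.up (h.up.above_of_lt ht hy.1.add_inv_lt.up)

theorem Forces.semidec_above (h : p ⊩ X.isReal) (x : Dom Γ₀ rat) : p ⊩ (X.above x).semidec := by
  have e : ∀ n, eval (.lam (below v1 (ratAdd v2 (ratNinv v0)))) (X ∷ x ∷ Env.nil) ⬝ᵈ n =
      X.below (x.qadd (.ninv n)) := fun n => by
    simp only [app_lam, eval_below, eval_ratAdd, eval_ratNinv, eval_var, Env.cons_here,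
      Env.cons_there]
  refine semidec_of_or (eval (.lam (below v1 (ratAdd v2 (ratNinv v0)))) (X ∷ x ∷ Env.nil))
    (fun n => ?_) fun r _ hx => ?_
  · rw [e]
    exact (h.located (forces_add_ninv_lt _ _)).orElim (fun _ _ k => forces_inr k)
      fun _ _ k => forces_inl k
  · refine (Forces.above_rounded h.up hx).bind fun s _ y hy => .intro (y.den * x.den) ?_
    rw [e]
    exact .intro fun t _ ht => Forces.disjoint h.up (h.up.below_of_lt ht hy.1.lt_add_ninv.up) hy.2.up

theorem forces_isReal_realOf (x : Dom Γ₀ rat) : p ⊩ (Dom.realOf x).isReal := by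
  refine forces_isReal.2 ⟨.intro (x.qadd (.ninv 0)) ?_, .intro (x.qadd (.inv 0)) ?_, fun q =>
    ⟨.intro fun r _ h => ?_, .intro fun r _ h => ?_⟩, fun q =>
    ⟨.intro fun r _ h => ?_, .intro fun r _ h => ?_⟩, fun q => .intro fun r _ h => ?_,
    fun q r => .intro fun s _ h => ?_⟩
  · simpa using forces_add_ninv_lt x 0
  · simpa using forces_lt_add_inv x 0
  · rw [Dom.below_realOf] at h
    simpa using LEx.intro _ ⟨forces_lt_add_inv q _, h.add_inv_lt⟩
  · simp only [forces_ex, eval_and, forces_and, eval_ratLt, eval_below, eval_var, Env.cons_here,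
      Env.cons_there, Dom.below_realOf] at h ⊢
    exact h.elim fun _ _ y hy => hy.1.qlt_trans hy.2
  · rw [Dom.above_realOf] at h
    simpa using LEx.intro _ ⟨forces_add_ninv_lt q _, h.lt_add_ninv⟩
  · simp only [forces_ex, eval_and, forces_and, eval_ratLt, eval_above, eval_var, Env.cons_here,
      Env.cons_there, Dom.above_realOf] at h ⊢
    exact h.elim fun _ _ y hy => hy.2.qlt_trans hy.1
  · rw [forces_and, Dom.below_realOf, Dom.above_realOf] at h
    exact h.1.qlt_asymm h.2
  · rw [Dom.below_realOf, Dom.above_realOf]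
    exact h.qlt_or x

theorem forces_isPosReal_inv (n : Dom Γ₀ .nat) : p ⊩ (Dom.realOf (.inv n)).isPosReal := by
  refine forces_isPosReal.2 ⟨forces_isReal_realOf _, .intro (.inv (n + 1)) ⟨forces_inv_pos _, ?_⟩⟩
  rw [Dom.below_realOf]
  exact Forces.inv_lt_inv (by simpa using forces_nlt_add n 0)

theorem Forces.rlt_realOf (h : p ⊩ X.isReal) : p ⊩ X.rlt (.realOf x) ↔ p ⊩ X.above x := by
  rw [forces_rlt]
  refine ⟨fun h' => h'.elim fun r _ y hy => ?_, fun h' => (h.above_rounded h').mono fun r _ y hy =>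
    ⟨hy.2, ?_⟩⟩
  · exact h.up.above_of_lt hy.1 (by simpa using hy.2)
  · simpa using hy.1

theorem Forces.exists_inv_below (h : p ⊩ X.isPosReal) : LEx p fun r n => r ⊩ X.below (.inv n) := by
  rw [forces_isPosReal] at h
  exact h.2.bind fun r _ q hq => .intro q.den (h.1.up.below_of_lt hq.2 hq.1.exists_inv_lt)
end SynthComp

namespace SynthComp

variable {Γ₀ Γ : Ctx} {A B C : Ty} {p q r a b c : Dom Γ₀ .prop}

/-! ### Metric spaces -/

namespace Dom

/-- `d` is a metric. -/
noncomputable def isMetric (d : Dom Γ₀ (A ⇒ₜ A ⇒ₜ cut)) : Dom Γ₀ .prop :=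
  eval (IsMetric v0) (d ∷ Env.nil)

/-- The metric `d` is complete. -/
noncomputable def isComplete (d : Dom Γ₀ (A ⇒ₜ A ⇒ₜ cut)) : Dom Γ₀ .prop :=
  eval (IsComplete v0) (d ∷ Env.nil)

/-- The metric `d` is separable. -/
noncomputable def isSeparable (d : Dom Γ₀ (A ⇒ₜ A ⇒ₜ cut)) : Dom Γ₀ .prop :=
  eval (IsSeparable v0) (d ∷ Env.nil)

/-- The subset `U` is pointwise open. -/
noncomputable def isPointwiseOpen (d : Dom Γ₀ (A ⇒ₜ A ⇒ₜ cut)) (U : Dom Γ₀ (A ⇒ₜ .prop)) :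
    Dom Γ₀ .prop := eval (IsPointwiseOpen v1 v0) (U ∷ d ∷ Env.nil)

/-- The distance of `x` and `y` is less than the rational number `q`. -/
noncomputable def near (d : Dom Γ₀ (A ⇒ₜ A ⇒ₜ cut)) (q : Dom Γ₀ rat) (x y : Dom Γ₀ A) :
    Dom Γ₀ .prop := (d ⬝ᵈ x ⬝ᵈ y).above q

end Dom

section

variable (d : Tm Γ (A ⇒ₜ A ⇒ₜ cut)) (ρ : Env Γ₀ Γ)

theorem forces_eval_realLe_realAdd {X Y Z : Tm Γ cut} : p ⊩ eval (realLe X (realAdd Y Z)) ρ ↔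
    ∀ q r (_ : Ext r p), r ⊩ (eval X ρ).below q → LEx r fun t u => LEx t fun w v =>
      w ⊩ (eval Y ρ).below u ∧ w ⊩ (eval Z ρ).below v ∧ w ⊩ q.qlt (u.qadd v) := by
  have e : ∀ q : Dom Γ₀ rat, eval (below (realAdd Y Z)↟ v0) (q ∷ ρ) =
      eval (.ex (.ex (below Y↟↟↟ v1 ∧ₒ below Z↟↟↟ v0 ∧ₒ ratLt v2 (ratAdd v1 v0))))
        (q ∷ ρ) := fun q => by
    rw [eval_below, eval_wk, realAdd, eval_pair, Dom.below, Dom.fst_pair, app_lam]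
    exact Dom.prop_ext fun p => by
      simp only [forces_ex, eval_and, eval_below, eval_ratLt, eval_ratAdd, eval_wk, eval_var,
        Env.cons_here, Env.cons_there]
  simp only [realLe, forces_all, eval_imp, e, forces_imp, forces_ex, eval_below, eval_and,
    forces_and, eval_ratLt, eval_ratAdd, eval_wk, eval_var, Env.cons_here, Env.cons_there]

@[simp] theorem eval_isMetric [Inhab Γ₀ A] : eval (IsMetric d) ρ = (eval d ρ).isMetric :=
  Dom.prop_ext fun p => by
    simp only [Dom.isMetric, IsMetric, eval_and, forces_and, forces_all, eval_isReal, eval_imp,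
      eval_app, eval_eqₒ, eval_realZero, eval_wk, eval_var, Env.cons_here,
      forces_eval_realLe_realAdd]

@[simp] theorem eval_isComplete [Inhab Γ₀ A] : eval (IsComplete d) ρ = (eval d ρ).isComplete :=
  Dom.prop_ext fun p => by
    simp only [Dom.isComplete, IsComplete, forces_all, eval_imp, IsCauchySeq, ConvergesTo,
      forces_imp, forces_ex, eval_and, forces_and, eval_isPosReal, eval_natLe, eval_realLt,
      eval_app, eval_wk, eval_var, Env.cons_here]

@[simp] theorem eval_isSeparable : eval (IsSeparable d) ρ = (eval d ρ).isSeparable :=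
  eval_sub₁ (IsSeparable v0) d ρ

@[simp] theorem eval_isPointwiseOpen (U : Tm Γ (A ⇒ₜ .prop)) :
    eval (IsPointwiseOpen d U) ρ = (eval d ρ).isPointwiseOpen (eval U ρ) :=
  eval_sub₂ (IsPointwiseOpen v1 v0) d U ρ

end

variable {d : Dom Γ₀ (A ⇒ₜ A ⇒ₜ cut)} {x y z : Dom Γ₀ A} {s t u : Dom Γ₀ rat}

theorem forces_isMetric [Inhab Γ₀ A] : p ⊩ d.isMetric ↔ (∀ x y, p ⊩ (d ⬝ᵈ x ⬝ᵈ y).isReal) ∧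
    (∀ x y, p ⊩ d ⬝ᵈ x ⬝ᵈ y ≐ .rzero ⇨ᵈ x ≐ y ∧ p ⊩ x ≐ y ⇨ᵈ d ⬝ᵈ x ⬝ᵈ y ≐ .rzero) ∧
    (∀ x y, p ⊩ d ⬝ᵈ x ⬝ᵈ y ≐ d ⬝ᵈ y ⬝ᵈ x) ∧
    ∀ x y z q r (_ : Ext r p), r ⊩ (d ⬝ᵈ x ⬝ᵈ z).below q → LEx r fun t u => LEx t fun w v =>
      w ⊩ (d ⬝ᵈ x ⬝ᵈ y).below u ∧ w ⊩ (d ⬝ᵈ y ⬝ᵈ z).below v ∧ w ⊩ q.qlt (u.qadd v) := by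
  simp only [Dom.isMetric, IsMetric, eval_and, forces_and, forces_all, eval_isReal, eval_imp,
    eval_app, eval_eqₒ, eval_realZero, eval_wk, eval_var, Env.cons_here,
    forces_eval_realLe_realAdd]

/-- Real tolerances can be traded for `1/(n+1)`: each positive real has such a fraction below it,
and these fractions are positive reals themselves. -/
theorem forces_isComplete [Inhab Γ₀ A] (hd : p ⊩ d.isMetric) (hc : p ⊩ d.isComplete)
    {s : Dom Γ₀ (.nat ⇒ₜ A)} (hs : ∀ n r (_ : Ext r p), LEx r fun t k => ∀ l m u (_ : Ext u t),
      u ⊩ k.nle l → u ⊩ k.nle m → u ⊩ d.near (.inv n) (s ⬝ᵈ l) (s ⬝ᵈ m)) :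
    LEx p fun r z => ∀ n, LEx r fun t k => ∀ m u (_ : Ext u t), u ⊩ k.nle m →
      u ⊩ d.near (.inv n) (s ⬝ᵈ m) z := by
  rw [forces_isMetric] at hd
  simp only [Dom.isComplete, IsComplete, forces_all, eval_imp] at hc
  have h := (hc s).mp (by
    simp only [IsCauchySeq, forces_all, eval_imp, eval_isPosReal,
      eval_var, Env.cons_here]
    intro ε
    refine .intro fun r _ hε => ?_
    simp only [forces_ex, forces_all, eval_imp, eval_natLe, eval_and, eval_realLt, eval_app,
      eval_wk, eval_var, Env.cons_here]
    refine hε.exists_inv_below.bind fun t _ n hn => (hs n t inferInstance).mono fun u _ k hk =>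
      fun l m => .intro fun v _ hv => ?_
    rw [forces_and] at hv
    exact forces_rlt.2 (.intro (.inv n) ⟨hk l m v inferInstance hv.1 hv.2, hn.up⟩))
  simp only [forces_ex, ConvergesTo, forces_all, eval_imp, eval_isPosReal, eval_var,
    Env.cons_here] at h
  refine h.mono fun r _ z hz n => ?_
  have h := (hz (.realOf (.inv n))).mp (forces_isPosReal_inv n)
  simp only [forces_ex, forces_all, eval_imp, eval_natLe, eval_realLt, eval_app, eval_wk, eval_var,
    Env.cons_here] at h
  exact h.mono fun t _ k hk m u _ hm => (hd.1 _ _).up.rlt_realOf.1 ((hk m).up.mp hm)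

theorem forces_isSeparable [Inhab Γ₀ A] (hd : p ⊩ d.isMetric) (h : p ⊩ d.isSeparable) :
    LEx p fun r (a : Dom Γ₀ (.nat ⇒ₜ A)) => ∀ x n, LEx r fun t m => t ⊩ d.near (.inv n) x (a ⬝ᵈ m) := by
  rw [forces_isMetric] at hd
  simp only [Dom.isSeparable, IsSeparable, forces_all, forces_ex, eval_imp, eval_isPosReal,
    eval_var, Env.cons_here] at h
  refine h.mono fun r _ a ha x n => ?_
  have h := (ha x (.realOf (.inv n))).mp (forces_isPosReal_inv n)
  simp only [forces_ex, eval_realLt, eval_app, eval_wk, eval_var, Env.cons_here] at h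
  exact h.mono fun t _ m hm => (hd.1 _ _).up.rlt_realOf.1 hm

theorem forces_isPointwiseOpen [Inhab Γ₀ A] {U : Dom Γ₀ (A ⇒ₜ .prop)} :
    p ⊩ d.isPointwiseOpen U ↔ ∀ x r (_ : Ext r p), r ⊩ U ⬝ᵈ x → LEx r fun s c => LEx s fun t ρ =>
      t ⊩ ρ.isPosReal ∧ t ⊩ (d ⬝ᵈ c ⬝ᵈ x).rlt ρ ∧ ∀ y u (_ : Ext u t), u ⊩ (d ⬝ᵈ c ⬝ᵈ y).rlt ρ →
        u ⊩ U ⬝ᵈ y := by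
  simp only [Dom.isPointwiseOpen, IsPointwiseOpen, InBall, forces_all, forces_ex, eval_imp,
    forces_imp, eval_and, forces_and, eval_isPosReal, eval_realLt, eval_app,
    eval_wk, eval_var, Env.cons_here, Env.cons_there]

theorem Forces.pair_ext {X Y : Dom Γ₀ (A ×ₜ B)} (h : p ⊩ X.fst ≐ Y.fst) (h' : p ⊩ X.snd ≐ Y.snd) :
    p ⊩ X ≐ Y := by
  have h₁ : p ⊩ X ≐ .pair Y.fst X.snd := by
    simpa using forces_subst (v1 =ₒ .pair v0 v2) (X ∷ X.snd ∷ Env.nil) h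
      (by simpa using forces_rfl X)
  simpa using forces_subst (v1 =ₒ .pair v2 v0) (X ∷ Y.fst ∷ Env.nil) h' (by simpa using h₁)

theorem Forces.near_symm [Inhab Γ₀ A] (hd : p ⊩ d.isMetric) (h : p ⊩ d.near t x y) :
    p ⊩ d.near t y x := by
  simpa [Dom.near] using forces_subst (above v0 v1) (t ∷ Env.nil) ((forces_isMetric.1 hd).2.2.1 x y)
    (by simpa [Dom.near] using h)

theorem forces_near_self [Inhab Γ₀ A] (hd : p ⊩ d.isMetric) :
    p ⊩ d.near t x x ↔ p ⊩ Dom.qzero.qlt t := by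
  have h := (((forces_isMetric.1 hd).2.1 x x).2).mp (forces_rfl x)
  refine ⟨fun h' => ?_, fun h' => ?_⟩
  · simpa using forces_subst (above v0 v1) (t ∷ Env.nil) h
      (by simpa [Dom.near] using h')
  · simpa [Dom.near] using forces_subst (above v0 v1) (t ∷ Env.nil) h.symm (by simpa [Dom.near] using h')

theorem forces_near_congr {x' y' : Dom Γ₀ A} (hx : p ⊩ x ≐ x') (hy : p ⊩ y ≐ y')
    (h : p ⊩ d.near t x y) : p ⊩ d.near t x' y' := by
  simpa [Dom.near] using forces_subst (above v0 v1) (t ∷ Env.nil)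
    ((Forces.app_congr ((forces_rfl d).app_congr hx) hy)) (by simpa [Dom.near] using h)

theorem Forces.near_of_lt [Inhab Γ₀ A] (hd : p ⊩ d.isMetric) (h : p ⊩ d.near s x y)
    (hs : p ⊩ s.qlt t) : p ⊩ d.near t x y := ((forces_isMetric.1 hd).1 x y).above_of_lt h hs

/-- The internal triangle inequality speaks about lower cuts. Locatedness between `s + t` and `u`
leaves only the case of `s + t` below the distance, which would produce lower bounds of the two
summands with sum above `s + t`. -/
theorem Forces.near_triangle [Inhab Γ₀ A] (hd : p ⊩ d.isMetric) (h : p ⊩ d.near s x y)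
    (h' : p ⊩ d.near t y z) (hu : p ⊩ (s.qadd t).qlt u) : p ⊩ d.near u x z := by
  rw [forces_isMetric] at hd
  refine ((hd.1 x z).located hu).orElim (fun r _ k => ?_) fun r _ k => k
  refine (hd.2.2.2 x y z _ r inferInstance k).elim fun v _ s' h => h.elim fun w _ t' ht => ?_
  exact ht.2.2.qlt_asymm (((hd.1 x y).up.lt_of_below_of_above ht.1 ‹p ⊩ d.near s x y›.up).qadd_lt_qadd
    ((hd.1 y z).up.lt_of_below_of_above ht.2.1 h'.up))

/-- From `d(x, y) < s < 0` the triangle inequality gives `d(x, x) < s`, because `s + s < s`; but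
`d(x, x)` is zero. -/
theorem Forces.near_nonneg [Inhab Γ₀ A] (hd : p ⊩ d.isMetric) (h : p ⊩ d.near s x y)
    (hs : p ⊩ s.qlt .qzero) : p ⊩ a :=
  ((forces_near_self hd).1 (Forces.near_triangle hd h (Forces.near_symm hd h)
    hs.qadd_self_lt)).qlt_asymm hs

/-- Points at distance zero are equal. -/
theorem Forces.eq_of_near [Inhab Γ₀ A] (hd : p ⊩ d.isMetric)
    (h : ∀ n, p ⊩ d.near (.inv n) x y) : p ⊩ x ≐ y := by
  refine ((forces_isMetric.1 hd).2.1 x y).1.mp ?_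
  have hr : p ⊩ (d ⬝ᵈ x ⬝ᵈ y).isReal := (forces_isMetric.1 hd).1 x y
  refine Forces.pair_ext (forces_funext fun q => forces_propext (fun r _ k => ?_) fun r _ k => ?_)
    (forces_funext fun q => forces_propext (fun r _ k => ?_) fun r _ k => ?_)
  · change r ⊩ Dom.rzero.below q
    rw [Dom.below_rzero]
    exact (hr.up.below_rounded k).elim fun s _ q' hq' => (hq'.1.qlt_or .qzero).orElim
      (fun t _ l => l) fun t _ l => hr.up.disjoint (hr.up.below_of_lt hq'.2.up l.exists_inv_lt)
        (h q'.den).up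
  · change r ⊩ Dom.rzero.below q at k
    rw [Dom.below_rzero] at k
    exact (hr.up.located (forces_lt_add_inv q _)).orElim (fun t _ l => l) fun t _ l =>
      Forces.near_nonneg hd.up l k.add_inv_lt.up
  · change r ⊩ Dom.rzero.above q
    rw [Dom.above_rzero]
    exact (hr.up.above_rounded k).elim fun s _ q' hq' => (hq'.1.qlt_or .qzero).orElim
      (fun t _ l => Forces.near_nonneg hd.up (hq'.2.up : t ⊩ d.near q' x y) l) fun t _ l => l
  · change r ⊩ Dom.rzero.above q at k
    rw [Dom.above_rzero] at k
    exact hr.up.above_of_lt (h q.den).up k.exists_inv_lt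

end SynthComp

namespace SynthComp

variable {Γ₀ Γ : Ctx} {A B C : Ty} {p q r a b c : Dom Γ₀ .prop}

theorem Forces.nlt_add_one {m n : Dom Γ₀ .nat} (h : p ⊩ m.nle n) : p ⊩ m.nlt (n + 1) :=
  (forces_nle_total (n + 1) m).orElim (fun _ _ k => Forces.nlt_irrefl h.up k) fun _ _ k => k

/-! ### Continuity -/

/-- A semidecidable set which contains `x` is not avoided by points arbitrarily close to `x`. -/
theorem exists_not_of_near [Inhab Γ₀ A] {d : Dom Γ₀ (A ⇒ₜ A ⇒ₜ cut)} (hd : p ⊩ d.isMetric)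
    (hc : p ⊩ d.isComplete) {P : Dom Γ₀ (A ⇒ₜ .prop)} {x : Dom Γ₀ A} (hx : p ⊩ P ⬝ᵈ x)
    (hP : ∀ z, p ⊩ (P ⬝ᵈ z).semidec) {Q : Dom Γ₀ (.nat ⇒ₜ .prop)}
    (hQ : ∀ i r (_ : Ext r p), r ⊩ (Q ⬝ᵈ i).not.not → r ⊩ Q ⬝ᵈ i)
    (h : ∀ i r (_ : Ext r p), r ⊩ Q ⬝ᵈ i →
      LEx r fun s y => s ⊩ d.near (.inv i) x y ∧ s ⊩ (P ⬝ᵈ y).not) :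
    LEx p fun r i => r ⊩ (Q ⬝ᵈ i).not := by
  refine exists_not_of_semidec_vanishing hQ fun f r _ hf hfQ => ?_
  have hy := countable_choice (p := r) (B := A) (firstFm v2 v1 →ₒ
    above (v3 ⬝ v4 ⬝ v0) (ratInv v1) ∧ₒ not_ (v5 ⬝ v0))
    (f ∷ d ∷ x ∷ P ∷ Env.nil) (fun i => ?_)
  swap
  · simp only [eval_imp, eval_firstFm, eval_and, eval_above, eval_app, eval_ratInv, eval_bot,
      eval_var, Env.cons_here, Env.cons_there]
    -- Choice needs a total relation. Whether `f` has its first one at `i` is decidable, and where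
    -- it has not, the condition is vacuous and `x` serves as default value.
    refine (dec_first hf i).orElim' (fun s _ hs => ?_) fun s _ hs => .intro x (.intro fun t _ ht =>
      (hs.up.mp ht).absurd)
    exact (h i s inferInstance ((hfQ i).up.mp hs)).mono fun t _ y hy => .intro fun u _ _ =>
      forces_and.2 ⟨hy.1.up, hy.2.up⟩
  simp only [eval_imp, eval_firstFm, eval_and, eval_above, eval_app, eval_ratInv, eval_bot,
    eval_var, Env.cons_here, Env.cons_there] at hy
  refine hy.elim fun r₁ _ y hy => ?_
  -- The term with index `j` is `x` if `f` has no one at any index up to and including `j`, hence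
  -- the successor, and `y i` if the first one is at some `i ≤ j`.
  have hs := countable_choice (p := r₁) (B := A) ((clearFm v2 (.succ v1) ∧ₒ v0 =ₒ v3) ∨ₒ
    .ex (natLt v0 (.succ v2) ∧ₒ firstFm v3 v0 ∧ₒ v1 =ₒ v5 ⬝ v0)) (f ∷ x ∷ y ∷ Env.nil)
    (fun j => ?_)
  swap
  · simp only [forces_or, forces_and, forces_ex, eval_or, eval_natLt, eval_clearFm, eval_firstFm,
      eval_and, eval_app, eval_eqₒ, eval_succ, eval_var, Env.cons_here, Env.cons_there, Dom.succ_eq]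
    exact (clear_or_first (p := r₁) hf.up (j + 1)).bind
      (fun s _ hs => .intro x (.inl ⟨hs, forces_rfl x⟩))
      fun s _ hs => hs.bind fun t _ i hi => .intro (y ⬝ᵈ i)
        (.inr (.intro i ⟨hi.1, hi.2, forces_rfl _⟩))
  refine hs.elim fun t _ s hs' => ?_
  have hs : ∀ j u (_ : Ext u t), LOr u (fun v => v ⊩ f.clear (j + 1) ∧ v ⊩ s ⬝ᵈ j ≐ x)
      fun v => LEx v fun w i => w ⊩ i.nlt (j + 1) ∧ w ⊩ f.first i ∧ w ⊩ s ⬝ᵈ j ≐ y ⬝ᵈ i :=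
    fun j u _ => by
      simpa only [forces_or, forces_and, forces_ex, eval_or, eval_natLt, eval_clearFm, eval_firstFm,
        eval_and, eval_app, eval_eqₒ, eval_succ, eval_var, Env.cons_here, Env.cons_there,
        Dom.succ_eq] using (hs' j).up (r := u)
  have hvanish : ∀ u (_ : Ext u t), u ⊩ f.hits.not → ∀ j, u ⊩ s ⬝ᵈ j ≐ x := fun u _ hu j =>
    (hs j u inferInstance).elim (fun v _ hv => hv.2) fun v _ hv => hv.elim fun w _ i hi =>
      (hu.up.mp (forces_hits.2 (.intro i (forces_first.1 hi.2.1).1))).absurd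
  have hfirst : ∀ i j u (_ : Ext u t), u ⊩ f.first i → u ⊩ i.nle j → u ⊩ s ⬝ᵈ j ≐ y ⬝ᵈ i :=
    fun i j u _ hi hj => (hs j u inferInstance).elim
      (fun v _ hv => (((forces_clear.1 hv.1 i).mp hj.nlt_add_one.up).mp
        (forces_first.1 hi).1.up).absurd)
      fun v _ hv => hv.elim fun w _ k hk => hk.2.2.trans
        ((forces_rfl y).app_congr (first_unique hk.2.1 hi.up))
  -- No one up to `k` inclusive makes `k < i`, so `1/(i+1) < 1/(k+1)` is strict, as moving to a
  -- larger radius requires.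
  have hnear : ∀ i k u (_ : Ext u t), u ⊩ f.first i → u ⊩ f.clear (k + 1) →
      u ⊩ d.near (.inv k) x (y ⬝ᵈ i) := fun i k u _ hi hk => by
    refine (forces_nle_total (k + 1) i).orElim (fun v _ hv => ?_) fun v _ hv =>
      (((forces_clear.1 hk i).up.mp hv).mp (forces_first.1 hi).1.up).absurd
    have := (hy i).up.mp hi
    exact Forces.near_of_lt hd.up (forces_and.1 this).1.up (Forces.inv_lt_inv hv)
  refine (forces_isComplete (p := t) hd.up hc.up (s := s) fun n u _ => ?_).elim fun u _ z hz => ?_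
  · refine .intro n fun l m v _ hl hm => ?_
    have hself : ∀ w (_ : Ext w v), w ⊩ s ⬝ᵈ l ≐ s ⬝ᵈ m → w ⊩ d.near (.inv n) (s ⬝ᵈ l) (s ⬝ᵈ m) :=
      fun w _ hw => forces_near_congr (forces_rfl _) hw
        ((forces_near_self hd.up).2 (forces_inv_pos n))
    refine (clear_or_first (p := v) hf.up (n + 1)).elim (fun w _ hw => ?_) fun w _ hw =>
      hw.elim fun w' _ i hi => ?_
    · refine (hs l w inferInstance).elim (fun w₁ _ hl => ?_) fun w₁ _ hl => hl.elim
        fun w₂ _ i hi => ?_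
      · refine (hs m w₁ inferInstance).elim (fun w₂ _ hm => ?_) fun w₂ _ hm => hm.elim
          fun w₃ _ i hi => ?_
        · exact hself w₂ inferInstance (hl.2.up.trans hm.2.symm)
        · exact forces_near_congr hl.2.symm.up hi.2.2.symm
            (hnear i n w₃ inferInstance hi.2.1 hw.up)
      · refine (hs m w₂ inferInstance).elim (fun w₃ _ hm => ?_) fun w₃ _ hm => hm.elim
          fun w₄ _ k hk => ?_
        · exact forces_near_congr hi.2.2.symm.up hm.2.symm
            (Forces.near_symm hd.up (hnear i n w₃ inferInstance hi.2.1.up hw.up))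
        · exact hself w₄ inferInstance (hi.2.2.up.trans (((forces_rfl y).app_congr
            (first_unique hi.2.1.up hk.2.1)).trans hk.2.2.symm))
    · have hin : w' ⊩ i.nle n := (forces_nle_total i n).orElim (fun _ _ k => k) fun _ _ k =>
        Forces.nlt_irrefl k hi.1.up
      exact hself w' inferInstance ((hfirst i l w' inferInstance hi.2 (hin.nle_trans hl.up)).trans
        (hfirst i m w' inferInstance hi.2 (hin.nle_trans hm.up)).symm)
  -- An eventually constant sequence can only converge to its eventual value.
  have hlim : ∀ v (_ : Ext v u) x' k, (∀ j, v ⊩ s ⬝ᵈ (k + j) ≐ x') → v ⊩ z ≐ x' :=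
    fun v _ x' k hx' => Forces.symm <| Forces.eq_of_near hd.up fun n => by
      refine ((hz n).up (r := v) fun s t _ k hk m w _ => hk m w inferInstance).elim fun w _ j hj => ?_
      refine forces_near_congr (hx' j).up (forces_rfl z) (hj (k + j) w inferInstance ?_)
      rw [add_comm]
      exact forces_nle_add j k
  -- Vanishing of `f` is equivalent to `z ∈ P`: a one would make `z` equal to some `y i` outside
  -- `P`, and without ones `z` equals `x`.
  refine Forces.semidec_congr (fun v _ hv => ?_) (fun v _ hv => ?_) (hP z).up
  · refine .intro fun w _ hw => (exists_first hf.up hw).elim fun w₁ _ i hi => ?_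
    have hzi : w₁ ⊩ z ≐ y ⬝ᵈ i := hlim w₁ inferInstance _ i fun j =>
      hfirst i _ w₁ inferInstance hi (forces_nle_add i j)
    exact (forces_and.1 ((hy i).up.mp hi)).2.mp (((forces_rfl P).app_congr hzi).eq_mp hv.up)
  · exact ((forces_rfl P).app_congr (hlim v inferInstance x 0 fun j =>
      hvanish v inferInstance hv _).symm).eq_mp hx.up

end SynthComp

/-! ### Two applications of the metric lemma: continuity at a point. -/

namespace SynthComp

variable {Γ₀ Γ : Ctx} {A B C : Ty} {p q r a b c : Dom Γ₀ .prop}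

/-- Every map from a complete separable metric space to a metric space is pointwise continuous. -/
theorem forces_isPointwiseOpen_preimage [Inhab Γ₀ A] [Inhab Γ₀ B] {d : Dom Γ₀ (A ⇒ₜ A ⇒ₜ cut)}
    {e : Dom Γ₀ (B ⇒ₜ B ⇒ₜ cut)} (hd : p ⊩ d.isMetric) (hc : p ⊩ d.isComplete)
    (hsep : p ⊩ d.isSeparable) (he : p ⊩ e.isMetric) {f : Dom Γ₀ (A ⇒ₜ B)}
    {V : Dom Γ₀ (B ⇒ₜ .prop)} (hV : p ⊩ e.isPointwiseOpen V) {U : Dom Γ₀ (A ⇒ₜ .prop)}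
    (hU : ∀ x, U ⬝ᵈ x = V ⬝ᵈ (f ⬝ᵈ x)) : p ⊩ d.isPointwiseOpen U := by
  refine forces_isPointwiseOpen.2 fun x r _ hx => ?_
  rw [hU] at hx
  refine (forces_isPointwiseOpen.1 hV _ r inferInstance hx).bind fun r _ c hr => hr.bind
    fun r _ ρ ⟨hρ, hcx, hball⟩ => (forces_rlt.1 hcx).bind fun r _ t ⟨hcxt, hρt⟩ => ?_
  have heR : ∀ s (_ : Ext s r) x y, s ⊩ (e ⬝ᵈ x ⬝ᵈ y).isReal := fun s _ x y =>
    ((forces_isMetric.1 he).1 x y).up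
  -- The room between `t'` and `t` is what later lets locatedness decide, for a nearby `y`, between
  -- `e(c, f y) > t'` and `e(c, f y) < t`.
  refine ((heR r inferInstance _ _).above_rounded hcxt).bind fun r _ t' ⟨htt, hcxt'⟩ => ?_
  refine (forces_isSeparable (p := r) hd.up hsep.up).bind fun r _ s hs => ?_
  set P : Dom Γ₀ (A ⇒ₜ .prop) := eval (.lam (above (v1 ⬝ v2 ⬝ (v3 ⬝ v0)) v4))
    (e ∷ c ∷ f ∷ t' ∷ Env.nil) with hP
  have hP : ∀ z, P ⬝ᵈ z = (e ⬝ᵈ c ⬝ᵈ (f ⬝ᵈ z)).above t' := fun z => by simp [P]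
  set N : Dom Γ₀ (A ⇒ₜ .prop) := eval (.lam (below (v1 ⬝ v2 ⬝ (v3 ⬝ v0)) v4))
    (e ∷ c ∷ f ∷ t' ∷ Env.nil) with hN
  have hN : ∀ z, N ⬝ᵈ z = (e ⬝ᵈ c ⬝ᵈ (f ⬝ᵈ z)).below t' := fun z => by simp [N]
  set R : Dom Γ₀ (.nat ⇒ₜ .prop) := eval (.lam (v1 ⬝ (v2 ⬝ v0))) (N ∷ s ∷ Env.nil) with hR
  have hR : ∀ m, R ⬝ᵈ m = N ⬝ᵈ (s ⬝ᵈ m) := fun m => by simp [R]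
  let S (i : Dom Γ₀ .nat) : Dom Γ₀ (.nat ⇒ₜ .prop) :=
    eval (.lam (above (v2 ⬝ v3 ⬝ (v4 ⬝ v0)) (ratInv v1))) (i ∷ d ∷ x ∷ s ∷ Env.nil)
  have hS : ∀ i m, S i ⬝ᵈ m = d.near (.inv i) x (s ⬝ᵈ m) := fun i m => by
    simp only [S, app_lam, eval_above, eval_app, eval_ratInv, eval_var, Env.cons_here,
      Env.cons_there, Dom.near]
  -- Here `i ∈ Q` if some point of the dense sequence within `1/(i+1)` of `x` lies in `N`. Only an
  -- index is quantified over, so `meets_stable` makes `Q` stable; quantifying over all points of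
  -- the space would not allow that.
  set Q : Dom Γ₀ (.nat ⇒ₜ .prop) := eval (.lam (.ex (v2 ⬝ v0 ∧ₒ
    above (v3 ⬝ v4 ⬝ (v5 ⬝ v0)) (ratInv v1)))) (R ∷ d ∷ x ∷ s ∷ Env.nil) with hQ
  have hQ : ∀ i, Q ⬝ᵈ i = R.meets (S i) := fun i => Dom.prop_ext fun p => by
    simp only [Q, forces_meets, hS, app_lam, forces_ex, eval_and, forces_and, eval_above, eval_app,
      eval_ratInv, eval_var, Env.cons_here, Env.cons_there, Dom.near]
  have hRs : ∀ m, r ⊩ (R ⬝ᵈ m).semidec := fun m => by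
    rw [hR, hN]
    exact (heR r inferInstance _ _).semidec_below _
  have hSs : ∀ i m, r ⊩ (S i ⬝ᵈ m).semidec := fun i m => by
    rw [hS]
    exact (((forces_isMetric.1 hd).1 _ _).up (r := r)).semidec_above _
  refine (exists_not_of_near (p := r) hd.up hc.up (P := P) (x := x) (Q := Q) ?_ (fun z => ?_)
    (fun i u _ hi => ?_) fun i u _ hi => ?_).bind fun r₁ _ i hi => ?_
  · rw [hP]
    exact hcxt'.up
  · rw [hP]
    exact (heR r inferInstance _ _).semidec_above _
  · rw [hQ] at hi ⊢
    exact meets_stable (fun m => (hRs m).up) (fun m => (hSs i m).up) hi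
  · rw [hQ, forces_meets] at hi
    refine hi.bind fun v _ m hm => .intro (s ⬝ᵈ m) ⟨?_, .intro fun w _ hw => ?_⟩
    · rw [← hS]
      exact hm.2
    · rw [hP] at hw
      have hm := hm.1
      rw [hR, hN] at hm
      exact (heR w inferInstance _ _).disjoint hm.up hw
  -- With `i ∉ Q`, the ball of radius `1/(i+1)` about `x` is the neighbourhood sought.
  refine .intro x (.intro (.realOf (.inv i)) ⟨forces_isPosReal_inv i, ?_, fun y u _ hy => ?_⟩)
  · exact (((forces_isMetric.1 hd).1 _ _).up).rlt_realOf.2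
      ((forces_near_self hd.up).2 (forces_inv_pos i))
  rw [hU]
  have hy : u ⊩ d.near (.inv i) x y := (((forces_isMetric.1 hd).1 _ _).up).rlt_realOf.1 hy
  refine ((heR u inferInstance c (f ⬝ᵈ y)).located htt.up).orElim (fun u₁ _ hlt => ?_)
    fun u₁ _ hgt => ?_
  swap
  · exact hball _ u₁ inferInstance (forces_rlt.2 (.intro t ⟨hgt, hρt.up⟩))
  refine ((((forces_isMetric.1 hd).1 _ _).up (r := u₁)).above_rounded hy.up).elim
    fun u₂ _ δ ⟨hδ, hyδ⟩ => ?_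
  set T : Dom Γ₀ (.nat ⇒ₜ .prop) := eval (.lam (.bot →ₒ .bot)) Env.nil with hT
  have hT : ∀ k p, p ⊩ T ⬝ᵈ k := fun k p => by
    simp only [T, app_lam, eval_imp, eval_bot]
    exact .intro fun _ _ h => h
  -- Now `y ∈ N` is to be refuted. With the full set as `Q`, the conclusion of the metric lemma is
  -- absurd, so it suffices to find points outside `N` at every scale around `y`.
  refine (exists_not_of_near (p := u₂) hd.up hc.up (P := N) (x := y) (Q := T) ?_ (fun z => ?_)
    (fun k v _ _ => hT k v) fun k v _ _ => ?_).elim fun v _ k hk => (hk.mp (hT k v)).absurd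
  · rw [hN]
    exact hlt.up
  · rw [hN]
    exact (heR u₂ inferInstance _ _).semidec_below _
  -- This `j` satisfies `δ + 1/(j+1) < 1/(i+1)`. A dense point taken with index `k + j + 1` is
  -- within `1/(k+1)` of `y` and within `1/(j+1)`, so it stays in the ball about `x`, where `i ∉ Q`
  -- excludes it from `N`.
  set j := δ.den * (Dom.inv i).den with hj
  refine (((hs y (k + j + 1))).up (r := v) fun s t _ k hk => hk.up).bind fun w _ m hm =>
    .intro (s ⬝ᵈ m) ⟨?_, ?_⟩
  · exact Forces.near_of_lt hd.up hm (Forces.inv_lt_inv (forces_nlt_add k j))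
  refine .intro fun w₁ _ hw => hi.up.mp ?_
  rw [hQ]
  refine forces_meets.2 (.intro m ⟨?_, ?_⟩)
  · rw [hR]
    exact hw
  rw [hS]
  refine Forces.near_triangle hd.up hyδ.up (Forces.near_of_lt hd.up hm.up (Forces.inv_lt_inv ?_))
    hδ.add_inv_lt.up
  rw [add_comm k]
  exact forces_nlt_add j k

end SynthComp

namespace SynthComp

variable {Γ₀ Γ : Ctx} {A B C : Ty}

/-! ### Conclusion -/

theorem forces_everyMapPointwiseContinuous [Inhab Γ₀ A] [Inhab Γ₀ B] (p : Dom Γ₀ .prop) :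
    p ⊩ eval (everyMapPointwiseContinuous A B) Env.nil := by
  simp only [everyMapPointwiseContinuous, IsPointwiseContinuous, forces_all, eval_imp, eval_and,
    eval_isMetric, eval_isComplete, eval_isSeparable, eval_wk, eval_var,
    Env.cons_here]
  refine fun d e => .intro fun r _ h => ?_
  simp only [forces_and] at h
  simp only [forces_all, eval_imp, eval_isPointwiseOpen, eval_wk, eval_var, Env.cons_here]
  refine fun f V => .intro fun s _ hV => ?_
  refine forces_isPointwiseOpen_preimage h.1.up h.2.1.up h.2.2.1.up h.2.2.2.up (f := f) hV
    fun x => ?_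
  simp only [app_lam, eval_app, eval_wk, eval_var, Env.cons_here]

theorem pf_closed_of_forces {φ : Fm []} (h : ∀ p : Dom Γ₀ .prop, p ⊩ eval φ Env.nil) :
    Pf (Γ := Γ₀) [] φ.closed := by
  have h := tr_of_forces h
  rw [eval_eq φ Env.nil (n := 0) (fun x => .var (Ren.empty x)) (fun x => nomatch x), tr_mk] at h
  rwa [Tm.closed, Tm.ren_eq_sub]

/-- Extension of a renaming. -/
def Ren.cons {Γ Δ : Ctx} {B : Ty} (y : Var Δ B) (ρ : Ren Γ Δ) : Ren (B :: Γ) Δ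
  | _, .here => y
  | _, .there x => ρ x

theorem pf_all_ren {Γ Δ : Ctx} {C : Ty} {Φ : List (Fm Δ)} {φ : Fm (C :: Γ)} {ρ : Ren Γ Δ}
    (y : Var Δ C) (h : Pf Φ ((Tm.all φ).ren ρ)) : Pf Φ (φ.ren (Ren.cons y ρ)) := by
  have := Derivable.allE (.var y) h
  rw [Tm.inst, Tm.sub_ren] at this
  rw [Tm.ren_eq_sub]
  rwa [Tm.sub_ext (τ := fun x => .var (Ren.cons y ρ x)) (fun x => by cases x <;> rfl)] at this

/-- To prove a formula of this shape one may use the formula itself in the context of all its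
universally quantified variables. -/
theorem pf_of_pf_closed {D E F G C : Ty} {H : Fm [E, D]} {O : Fm [G, F, E, D]}
    {K : Fm [C, G, F, E, D]}
    (h : Pf (Γ := [C, G, F, E, D]) []
      (Tm.all (.all (H →ₒ .all (.all (O →ₒ .all K))))).closed) :
    Pf [] (Tm.all (.all (H →ₒ .all (.all (O →ₒ .all K))))) := by
  refine .allI (.allI (.impI (.allI (.allI (.impI (.allI ?_))))))
  simp only [List.map_cons, List.map_nil]
  -- The closed formula is instantiated at the very variables introduced for its quantifiers; its
  -- premises are then the assumed hypotheses, and all renamings compose to weakenings or the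
  -- identity.
  have h₁ := pf_all_ren (.there (.there (.there .here))) (pf_all_ren
    (.there (.there (.there (.there .here)))) (h.mono (Ψ := [O.wk, H.wk.wk.wk]) (by simp)))
  have h₂ := pf_all_ren (.there .here) (pf_all_ren (.there (.there .here)) (.impE h₁ (.hyp ?_)))
  · have h₃ := pf_all_ren .here (.impE h₂ (.hyp ?_))
    · rw [Tm.ren_eq_sub, Tm.sub_ext (τ := fun x => .var x), Tm.sub_var] at h₃
      · exact h₃
      · rintro _ (_ | _ | _ | _ | _ | x) <;> first | rfl | exact nomatch x
    · rw [Tm.ren_ext (τ := fun x => .there x)]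
      · simp [Tm.wk]
      · rintro _ (_ | _ | _ | _ | x) <;> first | rfl | exact nomatch x
  · rw [Tm.ren_ext (τ := fun x => .there (.there (.there x)))]
    · simp [Tm.wk, Tm.ren_ren]
    · rintro _ (_ | _ | x) <;> first | rfl | exact nomatch x

end SynthComp

theorem mainTheorem3 (A B : SynthComp.Ty) :
    SynthComp.Provable (SynthComp.everyMapPointwiseContinuous A B) := by
  -- The types `A` and `B` may be empty, so the model is not built over the empty context. Openness
  -- of the preimage is claimed at a given point, and once this point and the map are variables of
  -- the base context, they inhabit `A` and, through the image of the point, `B`.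
  refine SynthComp.pf_of_pf_closed (SynthComp.pf_closed_of_forces fun p => ?_)
  have : SynthComp.Inhab [A, B ⇒ₜ .prop, A ⇒ₜ B, B ⇒ₜ B ⇒ₜ SynthComp.cut,
    A ⇒ₜ A ⇒ₜ SynthComp.cut] A := ⟨⟨SynthComp.v0⟩⟩
  have : SynthComp.Inhab [A, B ⇒ₜ .prop, A ⇒ₜ B, B ⇒ₜ B ⇒ₜ SynthComp.cut,
    A ⇒ₜ A ⇒ₜ SynthComp.cut] B := ⟨⟨SynthComp.v2 ⬝ SynthComp.v0⟩⟩
  exact SynthComp.forces_everyMapPointwiseContinuous p
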